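/- Let $\nu\in\mathbb{C}$ with $\Re(\nu)>-1$, let $f:(0,\infty)\to\mathbb{C}$ and let $y>0$. Let $J_\nu$ be the Bessel function of the first kind and $K_\nu$ the modified Bessel function of the second kind (Macdonald function) of order $\nu$, and put $$\mathscr{H}_\nu\{f(x);y\}=\int_0^\infty\sqrt{xy}\,J_\nu(xy)\,f(x)\,dx,\qquad \mathscr{K}_\nu\{f(x);y\}=\int_0^\infty\sqrt{xy}\,K_\nu(xy)\,f(x)\,dx,\qquad \mathscr{P}\{f(x);y\}=\int_0^\infty\frac{x\,f(x)}{x^2+y^2}\,dx,$$ where an integral is said to exist if it exists as a Lebesgue integral, that is, converges absolutely. (1) If $\mathscr{K}_\nu\{f(x);u\}$ exists for almost every $u>0$, and $\mathscr{H}_\nu\{\mathscr{K}_\nu\{f(x);u\};y\}$ and $\mathscr{P}\{x^{-\nu-1/2}f(x);y\}$ exist, then $$\mathscr{H}_\nu\big\{\mathscr{K}_\nu\{f(x);u\};y\big\}=y^{\nu+1/2}\,\mathscr{P}\big\{x^{-\nu-1/2}f(x);y\big\}.$$ (2) If $\mathscr{H}_\nu\{f(x);u\}$ exists for almost every $u>0$,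 and $\mathscr{K}_\nu\{\mathscr{H}_\nu\{f(x);u\};y\}$ and $\mathscr{P}\{x^{\nu-1/2}f(x);y\}$ exist, then $$\mathscr{K}_\nu\big\{\mathscr{H}_\nu\{f(x);u\};y\big\}=y^{-\nu+1/2}\,\mathscr{P}\big\{x^{\nu-1/2}f(x);y\big\}.$$ -/

import Mathlib

open MeasureTheory Set

noncomputable section

/-- The Bessel function of the first kind `J_ν(x)` of complex order `ν` at a real argument `x > 0`,
by its power series. `Complex.Gamma` takes the value `0` at its poles, so `(Complex.Gamma s)⁻¹` is
the entire function `1 / Γ(s)`, as it should be. -/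
def besselJ (ν : ℂ) (x : ℝ) : ℂ :=
  ((x : ℂ) / 2) ^ ν *
    ∑' m : ℕ, (-1) ^ m * (m.factorial : ℂ)⁻¹ * (Complex.Gamma (m + ν + 1))⁻¹ *
      ((x : ℂ) / 2) ^ (2 * m)

/-- The modified Bessel function of the second kind (Macdonald function) `K_ν(x)` of complex
order `ν` at a real argument `x > 0`: `∫₀^∞ exp(-x cosh t) cosh(ν t) dt`. -/
def besselK (ν : ℂ) (x : ℝ) : ℂ :=
  ∫ t in Ioi (0 : ℝ), (Real.exp (-(x * Real.cosh t)) : ℂ) * Complex.cosh (ν * t)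

/-- The integrand of the Hankel transform of order `ν` of `f` at `y`. -/
def hankelIntegrand (ν : ℂ) (f : ℝ → ℂ) (y x : ℝ) : ℂ :=
  (Real.sqrt (x * y) : ℂ) * besselJ ν (x * y) * f x

/-- The integrand of the `K`-transform of order `ν` of `f` at `y`. -/
def kIntegrand (ν : ℂ) (f : ℝ → ℂ) (y x : ℝ) : ℂ :=
  (Real.sqrt (x * y) : ℂ) * besselK ν (x * y) * f x

/-- The integrand of the Widder potential transform of `f` at `y`. -/
def widderIntegrand (f : ℝ → ℂ) (y x : ℝ) : ℂ :=
  (x : ℂ) * f x / ((x : ℂ) ^ 2 + (y : ℂ) ^ 2)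

/-- The Hankel transform `H_ν{f(x); y}`. -/
def hankelTransform (ν : ℂ) (f : ℝ → ℂ) (y : ℝ) : ℂ :=
  ∫ x in Ioi (0 : ℝ), hankelIntegrand ν f y x

/-- The `K`-transform `K_ν{f(x); y}`. -/
def kTransform (ν : ℂ) (f : ℝ → ℂ) (y : ℝ) : ℂ :=
  ∫ x in Ioi (0 : ℝ), kIntegrand ν f y x

/-- The Widder potential transform `P{f(x); y}`. -/
def widderTransform (f : ℝ → ℂ) (y : ℝ) : ℂ :=
  ∫ x in Ioi (0 : ℝ), widderIntegrand f y x

/-- The integral defining `H_ν{f(x); y}` exists (as a Lebesgue integral over `(0, ∞)`). -/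
def HankelExists (ν : ℂ) (f : ℝ → ℂ) (y : ℝ) : Prop :=
  IntegrableOn (hankelIntegrand ν f y) (Ioi 0)

/-- The integral defining `K_ν{f(x); y}` exists (as a Lebesgue integral over `(0, ∞)`). -/
def KExists (ν : ℂ) (f : ℝ → ℂ) (y : ℝ) : Prop :=
  IntegrableOn (kIntegrand ν f y) (Ioi 0)

/-- The integral defining `P{f(x); y}` exists (as a Lebesgue integral over `(0, ∞)`). -/
def WidderExists (f : ℝ → ℂ) (y : ℝ) : Prop :=
  IntegrableOn (widderIntegrand f y) (Ioi 0)

end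

/-!
Formally both identities are an interchange of integrations followed by the classical integral
`∫₀^∞ u J_ν(ub) K_ν(ua) du = (b/a)^ν / (a² + b²)`. That integral comes from the representation
`K_ν(z) = ½ (z/2)^ν ∫₀^∞ t^(-ν-1) exp(-t - z²/(4t)) dt` (`besselK_eq_truncK`) and Weber's integral
`∫₀^∞ u^(ν+1) J_ν(ub) exp(-pu²) du` (`integral_cpow_mul_besselJ_mul_exp`). The point of the theorem is
that the double integrals are not assumed to converge absolutely, and the existence of the iterated
ones is not enough for Fubini's theorem.

For the Hankel transform of the `K`-transform, the outer integrand is multiplied by `exp(-εu²)`, which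
makes Fubini's theorem applicable and replaces the kernel by an explicit integral of `kernelIntegrand`
(`integral_besselJ_mul_truncK`). As `ε → 0` the left side converges because its integral exists. On the
right, dominated convergence away from `x = 0` uses the existence of the potential transform. Near
`x = 0` it uses that the regularised kernel is bounded, uniformly in `ε`, by a multiple of `x^(-|Re ν|)`,
or of `K_0` when `ν = 0` (`exists_rpow_mul_norm_kernel_le`, `exists_norm_kernel_zero_le`), and that the
existence of the `K`-transform makes `√x f` integrable against these weights
(`exists_integrableOn_of_kExists`, `exists_weight`). The delicate case is that of imaginary `ν`, where
`K_ν` has zeros accumulating at the origin: there two dilates of `K_ν` are used, which are not small at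
the same time (`exists_le_norm_besselK_add`).

For the `K`-transform of the Hankel transform, the existence of `H_ν{f; u}` for almost every `u` makes
`f` itself integrable at infinity (`exists_integrableOn_of_hankelExists`). This is a Denjoy–Lusin
argument: `√z J_ν(z)` solves a perturbed oscillator equation whose energy is bounded above and below, so
that it has a positive mean modulus on long intervals (`exists_le_integral_norm_sq_hankelW`). The
existence of the potential transform controls `f` near the origin. For `Re ν ≤ 0` the double integral
then converges absolutely. For `Re ν > 0` it does so once the `t`-integral for `K_ν` is cut off below at
`η > 0` (`integral_truncK_mul_hankelTransform`). As `η → 0` dominated convergence applies, because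
`|K_ν|` and its majorant `K_{Re ν}` are comparable near the origin
(`integrableOn_macK_mul_hankelTransform`).
-/

/-! ### Bessel's equation -/

/-- The entire function `φ_ν(v) = ∑ (-1)^m v^m / (m! Γ(m + ν + 1))`, in terms of which
`J_ν(z) = (z/2)^ν φ_ν((z/2)²)`. -/
noncomputable def besselPhi (ν v : ℂ) : ℂ :=
  ∑' m : ℕ, (-1) ^ m * (m.factorial : ℂ)⁻¹ * (Complex.Gamma (m + ν + 1))⁻¹ * v ^ m

theorem besselJ_eq_besselPhi (ν : ℂ) (x : ℝ) :
    besselJ ν x = ((x : ℂ) / 2) ^ ν * besselPhi ν (((x : ℂ) / 2) ^ 2) := by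
  simp only [besselJ, besselPhi, pow_mul]

theorem exists_norm_inv_Gamma_le {ν : ℂ} (hν : -1 < ν.re) :
    ∃ C : ℝ, 0 ≤ C ∧ ∀ m : ℕ, ‖(Complex.Gamma (m + ν + 1))⁻¹‖ ≤ C := by
  refine ⟨max ‖(Complex.Gamma (ν + 1))⁻¹‖ ‖(Complex.Gamma (1 + ν + 1))⁻¹‖, by positivity, ?_⟩
  intro m
  rcases m with _ | m
  · simp
  · refine le_max_of_le_right ?_
    induction m with
    | zero => simp
    | succ k ih =>
      have hre : (1 : ℝ) ≤ (k + 1 + ν + 1 : ℂ).re := by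
        simp; linarith [(Nat.cast_nonneg k : (0 : ℝ) ≤ k)]
      have hne : (k + 1 + ν + 1 : ℂ) ≠ 0 := by
        intro h; rw [h] at hre; norm_num at hre
      have h1 : ((k + 1 + 1 : ℕ) : ℂ) + ν + 1 = (k + 1 + ν + 1) + 1 := by push_cast; ring
      rw [h1, Complex.Gamma_add_one _ hne, mul_inv, norm_mul, norm_inv]
      have h2 : ‖(k + 1 + ν + 1 : ℂ)‖⁻¹ ≤ 1 :=
        inv_le_one_of_one_le₀ (hre.trans (Complex.re_le_norm _))
      push_cast at ih
      calc _ ≤ 1 * ‖(Complex.Gamma (k + 1 + ν + 1))⁻¹‖ := by gcongr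
        _ ≤ _ := by rw [one_mul]; exact ih

theorem norm_besselPhi_coeff_le {ν : ℂ} {C : ℝ}
    (hC : ∀ m : ℕ, ‖(Complex.Gamma (m + ν + 1))⁻¹‖ ≤ C) (m : ℕ) :
    ‖(-1) ^ m * (m.factorial : ℂ)⁻¹ * (Complex.Gamma (m + ν + 1))⁻¹‖ ≤
      C * ((m.factorial : ℝ))⁻¹ := by
  rw [norm_mul, norm_mul, norm_pow, norm_neg, norm_one, one_pow, one_mul, norm_inv,
    Complex.norm_natCast, mul_comm]
  gcongr
  exact hC m

theorem summable_besselPhi {ν : ℂ} (hν : -1 < ν.re) (v : ℂ) :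
    Summable fun m : ℕ =>
      (-1) ^ m * (m.factorial : ℂ)⁻¹ * (Complex.Gamma (m + ν + 1))⁻¹ * v ^ m := by
  obtain ⟨C, hC0, hC⟩ := exists_norm_inv_Gamma_le hν
  refine Summable.of_norm_bounded
    (g := fun m : ℕ => C * (‖v‖ ^ m / (m.factorial : ℝ)))
    ((Real.summable_pow_div_factorial ‖v‖).mul_left C) fun m => ?_
  rw [norm_mul, norm_pow, div_eq_inv_mul, ← mul_assoc]
  gcongr
  exact norm_besselPhi_coeff_le hC m

theorem besselPhi_zero (ν : ℂ) : besselPhi ν 0 = (Complex.Gamma (ν + 1))⁻¹ := by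
  rw [besselPhi, tsum_eq_single 0]
  · simp
  · intro m hm; simp [hm]

/-- The three-term recurrence of the Bessel functions, in terms of `φ`. -/
theorem besselPhi_recurrence {ν : ℂ} (hν : -1 < ν.re) (v : ℂ) :
    v * besselPhi (ν + 2) v = (ν + 1) * besselPhi (ν + 1) v - besselPhi ν v := by
  have h0 := summable_besselPhi hν v
  have h1 := summable_besselPhi (ν := ν + 1) (by simp; linarith) v
  have h2 := summable_besselPhi (ν := ν + 2) (by simp; linarith) v
  simp only [besselPhi]
  rw [← tsum_mul_left, ← tsum_mul_left, ← (h1.mul_left (ν + 1)).tsum_sub h0]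
  rw [((h1.mul_left (ν + 1)).sub h0).tsum_eq_zero_add]
  have hne : ∀ m : ℕ, (m + ν + 1 : ℂ) ≠ 0 := by
    intro m h
    have := congrArg Complex.re h
    simp at this
    linarith [(Nat.cast_nonneg m : (0 : ℝ) ≤ m)]
  -- the right side has no constant term, so that its index shifts by one
  have hz : (ν + 1) * ((-1) ^ 0 * ((0 : ℕ).factorial : ℂ)⁻¹ *
      (Complex.Gamma ((0 : ℕ) + (ν + 1) + 1))⁻¹ * v ^ 0) -
      (-1) ^ 0 * ((0 : ℕ).factorial : ℂ)⁻¹ * (Complex.Gamma ((0 : ℕ) + ν + 1))⁻¹ * v ^ 0 = 0 := by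
    have := hne 0
    simp only [Nat.cast_zero, zero_add] at this ⊢
    rw [Complex.Gamma_add_one _ this]
    simp
    field_simp
    simp
  rw [hz, zero_add]
  refine tsum_congr fun m => ?_
  have hm := hne (m + 1)
  push_cast at hm ⊢
  have e1 : (m + (ν + 2) + 1 : ℂ) = (m + 1 + ν + 1) + 1 := by ring
  have e2 : (m + 1 + (ν + 1) + 1 : ℂ) = (m + 1 + ν + 1) + 1 := by ring
  rw [e1, e2, Complex.Gamma_add_one _ hm, Nat.factorial_succ]
  have hf : (m.factorial : ℂ) ≠ 0 := by exact_mod_cast m.factorial_ne_zero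
  have hm1 : (m + 1 : ℂ) ≠ 0 := by exact_mod_cast m.succ_ne_zero
  have hG : Complex.Gamma (m + 1 + ν + 1) ≠ 0 := by
    apply Complex.Gamma_ne_zero_of_re_pos
    simp; linarith [(Nat.cast_nonneg m : (0 : ℝ) ≤ m)]
  push_cast
  field_simp
  ring

theorem hasDerivAt_besselPhi {ν : ℂ} (hν : -1 < ν.re) (v : ℂ) :
    HasDerivAt (besselPhi ν) (-besselPhi (ν + 1) v) v := by
  obtain ⟨C, hC0, hC⟩ := exists_norm_inv_Gamma_le hν
  set a : ℕ → ℂ := fun m => (-1) ^ m * (m.factorial : ℂ)⁻¹ * (Complex.Gamma (m + ν + 1))⁻¹ with ha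
  set R : ℝ := ‖v‖ + 1
  have hR : 0 ≤ R := by positivity
  have hsum : Summable fun m : ℕ => C * ((m.factorial : ℝ))⁻¹ * (m * R ^ (m - 1)) := by
    rw [← summable_nat_add_iff 1]
    refine ((Real.summable_pow_div_factorial R).mul_left C).congr fun m => ?_
    rw [Nat.factorial_succ]
    have hf : (m.factorial : ℝ) ≠ 0 := by exact_mod_cast m.factorial_ne_zero
    have hm1 : (m + 1 : ℝ) ≠ 0 := by exact_mod_cast m.succ_ne_zero
    push_cast
    field_simp
  have key := hasDerivAt_tsum_of_isPreconnected (𝕜 := ℂ) (F := ℂ)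
    (g := fun m z => a m * z ^ m) (g' := fun m z => a m * (m * z ^ (m - 1)))
    (t := Metric.ball 0 R) (y₀ := v) (y := v) hsum Metric.isOpen_ball
    (convex_ball _ _).isPreconnected
    (fun m z _ => (hasDerivAt_pow m z).const_mul (a m)) ?_ (by simp [R])
    (summable_besselPhi hν v) (by simp [R])
  · refine HasDerivAt.congr_deriv (f := besselPhi ν) key ?_
    rw [Summable.tsum_eq_zero_add]
    · rw [besselPhi, ← tsum_neg]
      simp only [Nat.cast_zero, zero_mul, mul_zero, zero_add]
      refine tsum_congr fun m => ?_
      have hf : (m.factorial : ℂ) ≠ 0 := by exact_mod_cast m.factorial_ne_zero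
      have hm1 : (m + 1 : ℂ) ≠ 0 := by exact_mod_cast m.succ_ne_zero
      simp only [ha, Nat.factorial_succ]
      push_cast
      have e : (m + 1 + ν + 1 : ℂ) = m + (ν + 1) + 1 := by ring
      rw [e]
      field_simp
      ring
    · refine Summable.of_norm_bounded hsum fun m => ?_
      rw [norm_mul, norm_mul (m : ℂ), norm_pow, Complex.norm_natCast]
      gcongr
      · exact norm_besselPhi_coeff_le hC m
      · simp [R]
  · intro m z hz
    rw [norm_mul, norm_mul (m : ℂ), norm_pow, Complex.norm_natCast]
    gcongr
    · exact norm_besselPhi_coeff_le hC m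
    · simpa using (mem_ball_zero_iff.1 hz).le

theorem continuous_besselPhi {ν : ℂ} (hν : -1 < ν.re) : Continuous (besselPhi ν) :=
  continuous_iff_continuousAt.2 fun v => (hasDerivAt_besselPhi hν v).continuousAt

/-- `√z J_ν(z)` up to the factor `2^ν`, as a function on the slit plane. -/
noncomputable def hankelW (ν z : ℂ) : ℂ := z ^ (ν + 1 / 2) * besselPhi ν ((z / 2) ^ 2)

/-- The derivative of `hankelW`. -/
noncomputable def hankelW' (ν z : ℂ) : ℂ :=
  z ^ (ν + 1 / 2) * ((ν + 1 / 2) / z * besselPhi ν ((z / 2) ^ 2) -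
    z / 2 * besselPhi (ν + 1) ((z / 2) ^ 2))

theorem hasDerivAt_besselPhi_comp {ν : ℂ} (hν : -1 < ν.re) (z : ℂ) :
    HasDerivAt (fun z => besselPhi ν ((z / 2) ^ 2)) (-(z / 2) * besselPhi (ν + 1) ((z / 2) ^ 2)) z := by
  have h1 : HasDerivAt (fun z : ℂ => (z / 2) ^ 2) (z / 2) z := by
    have := ((hasDerivAt_id z).div_const 2).pow 2
    refine this.congr_deriv ?_
    simp only [id]
    ring
  have h2 := (hasDerivAt_besselPhi hν ((z / 2) ^ 2)).comp z h1
  refine h2.congr_deriv ?_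
  ring

theorem hasDerivAt_cpow_slit {a z : ℂ} (hz : z ∈ Complex.slitPlane) :
    HasDerivAt (fun z : ℂ => z ^ a) (a * (z ^ a / z)) z := by
  have h := (hasDerivAt_id z).cpow_const (c := a) hz
  have hz0 : z ≠ 0 := Complex.slitPlane_ne_zero hz
  refine h.congr_deriv ?_
  simp only [id, mul_one]
  rw [Complex.cpow_sub _ _ hz0, Complex.cpow_one]

theorem hasDerivAt_hankelW {ν : ℂ} (hν : -1 < ν.re) {z : ℂ} (hz : z ∈ Complex.slitPlane) :
    HasDerivAt (hankelW ν) (hankelW' ν z) z := by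
  have hz0 : z ≠ 0 := Complex.slitPlane_ne_zero hz
  have := (hasDerivAt_cpow_slit (a := ν + 1 / 2) hz).mul (hasDerivAt_besselPhi_comp hν z)
  refine HasDerivAt.congr_deriv (f := hankelW ν) this ?_
  rw [hankelW']
  field_simp
  ring

/-- Bessel's equation, in the form `w'' = -(1 - (ν² - 1/4) / z²) w` for `w(z) = √z J_ν(z)`. -/
theorem hasDerivAt_hankelW' {ν : ℂ} (hν : -1 < ν.re) {z : ℂ} (hz : z ∈ Complex.slitPlane) :
    HasDerivAt (hankelW' ν) (-(1 - (ν ^ 2 - 1 / 4) / z ^ 2) * hankelW ν z) z := by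
  have hz0 : z ≠ 0 := Complex.slitPlane_ne_zero hz
  have hν1 : -1 < (ν + 1).re := by simp; linarith
  have d1 := hasDerivAt_besselPhi_comp hν z
  have d2 := hasDerivAt_besselPhi_comp hν1 z
  have d3 : HasDerivAt (fun z : ℂ => (ν + 1 / 2) / z) (-(ν + 1 / 2) / z ^ 2) z := by
    have := (hasDerivAt_inv hz0).const_mul (ν + 1 / 2)
    refine this.congr_deriv ?_
    ring
  have d4 : HasDerivAt (fun z : ℂ => z / 2) (1 / 2) z := (hasDerivAt_id z).div_const 2
  have := (hasDerivAt_cpow_slit (a := ν + 1 / 2) hz).mul ((d3.mul d1).sub (d4.mul d2))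
  refine HasDerivAt.congr_deriv (f := hankelW' ν) this ?_
  have hr := besselPhi_recurrence hν ((z / 2) ^ 2)
  have e : ν + 1 + 1 = ν + 2 := by ring
  have hr' : besselPhi ν ((z / 2) ^ 2) = (ν + 1) * besselPhi (ν + 1) ((z / 2) ^ 2) -
    (z / 2) ^ 2 * besselPhi (ν + 2) ((z / 2) ^ 2) := by rw [hr]; ring
  simp only [hankelW, e, hr', Pi.mul_apply, Pi.sub_apply]
  field_simp
  ring

/-! ### The energy of `√z J_ν(z)` -/

/-- The energy `|w|² + |w'|²` of `w = √z J_ν(z)`. -/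
noncomputable def hankelEnergy (ν : ℂ) (z : ℝ) : ℝ := ‖hankelW ν z‖ ^ 2 + ‖hankelW' ν z‖ ^ 2

theorem hankelEnergy_nonneg (ν : ℂ) (z : ℝ) : 0 ≤ hankelEnergy ν z := by
  unfold hankelEnergy; positivity

theorem hasDerivAt_hankelW_real {ν : ℂ} (hν : -1 < ν.re) {z : ℝ} (hz : 0 < z) :
    HasDerivAt (fun z : ℝ => hankelW ν z) (hankelW' ν z) z :=
  (hasDerivAt_hankelW hν (Complex.ofReal_mem_slitPlane.2 hz)).comp_ofReal

theorem hasDerivAt_hankelW'_real {ν : ℂ} (hν : -1 < ν.re) {z : ℝ} (hz : 0 < z) :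
    HasDerivAt (fun z : ℝ => hankelW' ν z)
      (-(1 - (ν ^ 2 - 1 / 4) / (z : ℂ) ^ 2) * hankelW ν z) z :=
  (hasDerivAt_hankelW' hν (Complex.ofReal_mem_slitPlane.2 hz)).comp_ofReal

/-- The oscillator terms of Bessel's equation drop out of the derivative of the energy, which is
therefore an integrable multiple of the energy near infinity. -/
theorem exists_hasDerivAt_hankelEnergy {ν : ℂ} (hν : -1 < ν.re) {z : ℝ} (hz : 0 < z) :
    ∃ e : ℝ, HasDerivAt (hankelEnergy ν) e z ∧
      |e| ≤ ‖ν ^ 2 - 1 / 4‖ / z ^ 2 * hankelEnergy ν z := by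
  have h1 := (hasDerivAt_hankelW_real hν hz).norm_sq
  have h2 := (hasDerivAt_hankelW'_real hν hz).norm_sq
  refine ⟨_, h1.add h2, ?_⟩
  set w := hankelW ν z with hw
  set w1 := hankelW' ν z with hw1
  set q := ν ^ 2 - 1 / 4 with hq
  have e1 : -(1 - q / (z : ℂ) ^ 2) * w = -w + (q / (z : ℂ) ^ 2) * w := by ring
  rw [e1, inner_add_right, inner_neg_right, real_inner_comm w1 w]
  have e2 : 2 * inner ℝ w1 w + 2 * (-inner ℝ w1 w + inner ℝ w1 (q / (z : ℂ) ^ 2 * w)) =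
    2 * inner ℝ w1 (q / (z : ℂ) ^ 2 * w) := by ring
  rw [e2, abs_mul, abs_two]
  have h3 := abs_real_inner_le_norm w1 (q / (z : ℂ) ^ 2 * w)
  rw [norm_mul, norm_div, norm_pow, Complex.norm_real, Real.norm_of_nonneg hz.le] at h3
  have hE : hankelEnergy ν z = ‖w‖ ^ 2 + ‖w1‖ ^ 2 := rfl
  rw [hE]
  have h4 : 0 ≤ ‖q‖ / z ^ 2 := by positivity
  nlinarith [mul_nonneg h4 (sq_nonneg (‖w‖ - ‖w1‖))]

/-- Gronwall's inequality for the energy, with the factor `exp (∫_z^∞ |ν² - 1/4| / t² dt)`. -/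
theorem antitoneOn_hankelEnergy_mul_exp {ν : ℂ} (hν : -1 < ν.re) :
    AntitoneOn (fun z : ℝ => hankelEnergy ν z * Real.exp (‖ν ^ 2 - 1 / 4‖ / z)) (Ioi 0) := by
  have hd : ∀ z ∈ Ioi (0 : ℝ), ∃ d, HasDerivAt
      (fun z : ℝ => hankelEnergy ν z * Real.exp (‖ν ^ 2 - 1 / 4‖ / z)) d z ∧ d ≤ 0 := by
    intro z hz
    obtain ⟨e, he, hle⟩ := exists_hasDerivAt_hankelEnergy hν hz
    have hz0 : z ≠ 0 := ne_of_gt hz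
    have h1 := ((hasDerivAt_inv hz0).const_mul ‖ν ^ 2 - 1 / 4‖).exp
    refine ⟨_, he.mul h1, ?_⟩
    simp only [← div_eq_mul_inv]
    have : e ≤ ‖ν ^ 2 - 1 / 4‖ / z ^ 2 * hankelEnergy ν z := (le_abs_self e).trans hle
    have hx := Real.exp_pos (‖ν ^ 2 - 1 / 4‖ / z)
    have : (e - ‖ν ^ 2 - 1 / 4‖ / z ^ 2 * hankelEnergy ν z) * Real.exp (‖ν ^ 2 - 1 / 4‖ / z) ≤ 0 :=
      mul_nonpos_of_nonpos_of_nonneg (by linarith) hx.le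
    calc _ = _ := by ring
      _ ≤ 0 := this
  refine antitoneOn_of_deriv_nonpos (convex_Ioi 0) ?_ ?_ ?_
  · intro z hz
    obtain ⟨d, h, _⟩ := hd z hz
    exact h.continuousAt.continuousWithinAt
  · rw [interior_Ioi]; intro z hz
    obtain ⟨d, h, _⟩ := hd z hz
    exact h.differentiableAt.differentiableWithinAt
  · rw [interior_Ioi]; intro z hz
    obtain ⟨d, h, h'⟩ := hd z hz
    rw [h.deriv]; exact h'

theorem monotoneOn_hankelEnergy_mul_exp {ν : ℂ} (hν : -1 < ν.re) :
    MonotoneOn (fun z : ℝ => hankelEnergy ν z * Real.exp (-‖ν ^ 2 - 1 / 4‖ / z)) (Ioi 0) := by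
  have hd : ∀ z ∈ Ioi (0 : ℝ), ∃ d, HasDerivAt
      (fun z : ℝ => hankelEnergy ν z * Real.exp (-‖ν ^ 2 - 1 / 4‖ / z)) d z ∧ 0 ≤ d := by
    intro z hz
    obtain ⟨e, he, hle⟩ := exists_hasDerivAt_hankelEnergy hν hz
    have hz0 : z ≠ 0 := ne_of_gt hz
    have h1 := ((hasDerivAt_inv hz0).const_mul (-‖ν ^ 2 - 1 / 4‖)).exp
    refine ⟨_, he.mul h1, ?_⟩
    simp only [← div_eq_mul_inv]
    have : -(‖ν ^ 2 - 1 / 4‖ / z ^ 2 * hankelEnergy ν z) ≤ e := neg_le_of_abs_le hle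
    have hx := Real.exp_pos (-‖ν ^ 2 - 1 / 4‖ / z)
    have : 0 ≤ (e + ‖ν ^ 2 - 1 / 4‖ / z ^ 2 * hankelEnergy ν z) *
        Real.exp (-‖ν ^ 2 - 1 / 4‖ / z) :=
      mul_nonneg (by linarith) hx.le
    calc 0 ≤ _ := this
      _ = _ := by ring
  refine monotoneOn_of_deriv_nonneg (convex_Ioi 0) ?_ ?_ ?_
  · intro z hz
    obtain ⟨d, h, _⟩ := hd z hz
    exact h.continuousAt.continuousWithinAt
  · rw [interior_Ioi]; intro z hz
    obtain ⟨d, h, _⟩ := hd z hz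
    exact h.differentiableAt.differentiableWithinAt
  · rw [interior_Ioi]; intro z hz
    obtain ⟨d, h, h'⟩ := hd z hz
    rw [h.deriv]; exact h'

theorem exists_hankelEnergy_le {ν : ℂ} (hν : -1 < ν.re) :
    ∃ C : ℝ, 0 < C ∧ ∀ z : ℝ, 1 ≤ z → hankelEnergy ν z ≤ C := by
  refine ⟨hankelEnergy ν 1 * Real.exp (‖ν ^ 2 - 1 / 4‖ / 1) + 1, ?_, fun z hz => ?_⟩
  · have := hankelEnergy_nonneg ν 1
    positivity
  · have hz0 : 0 < z := by linarith
    have := antitoneOn_hankelEnergy_mul_exp hν (mem_Ioi.2 one_pos) (mem_Ioi.2 hz0) hz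
    have h2 : 1 ≤ Real.exp (‖ν ^ 2 - 1 / 4‖ / z) := Real.one_le_exp (by positivity)
    have h3 := le_mul_of_one_le_right (hankelEnergy_nonneg ν z) h2
    simp only at this
    linarith

theorem eventually_besselPhi_ne_zero {ν : ℂ} (hν : -1 < ν.re) :
    ∀ᶠ z : ℝ in nhdsWithin 0 (Ioi 0), besselPhi ν (((z : ℂ) / 2) ^ 2) ≠ 0 := by
  have hc : Continuous fun z : ℝ => besselPhi ν (((z : ℂ) / 2) ^ 2) :=
    (continuous_besselPhi hν).comp (by fun_prop)
  have h0 : besselPhi ν ((((0 : ℝ) : ℂ) / 2) ^ 2) ≠ 0 := by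
    simp only [Complex.ofReal_zero, zero_div, ne_eq, OfNat.ofNat_ne_zero, not_false_eq_true,
      zero_pow, besselPhi_zero]
    exact inv_ne_zero (Complex.Gamma_ne_zero_of_re_pos (by simp; linarith))
  exact (hc.continuousAt.eventually_ne h0).filter_mono nhdsWithin_le_nhds

theorem exists_le_hankelEnergy {ν : ℂ} (hν : -1 < ν.re) :
    ∃ c : ℝ, 0 < c ∧ ∀ z : ℝ, 1 ≤ z → c ≤ hankelEnergy ν z := by
  -- the energy is positive near `0`, where `J_ν` has no zeros, and Gronwall carries this to infinity
  obtain ⟨z₀, hne, hz₀⟩ := ((eventually_besselPhi_ne_zero hν).and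
    (Ioo_mem_nhdsGT (zero_lt_one' ℝ))).exists
  have hw : hankelW ν z₀ ≠ 0 := by
    rw [hankelW]
    refine mul_ne_zero ?_ hne
    rw [Complex.cpow_ne_zero_iff]
    exact Or.inl (by exact_mod_cast hz₀.1.ne')
  have hE : 0 < hankelEnergy ν z₀ := by
    have : 0 < ‖hankelW ν z₀‖ := norm_pos_iff.2 hw
    unfold hankelEnergy; positivity
  refine ⟨hankelEnergy ν z₀ * Real.exp (-‖ν ^ 2 - 1 / 4‖ / z₀), by positivity, fun z hz => ?_⟩
  have hz0 : 0 < z := by linarith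
  have := monotoneOn_hankelEnergy_mul_exp hν (mem_Ioi.2 hz₀.1) (mem_Ioi.2 hz0)
    (hz₀.2.le.trans hz)
  refine this.trans ?_
  have h2 : Real.exp (-‖ν ^ 2 - 1 / 4‖ / z) ≤ 1 :=
    Real.exp_le_one_iff.2 (div_nonpos_of_nonpos_of_nonneg (by simp) hz0.le)
  exact mul_le_of_le_one_right (hankelEnergy_nonneg ν z) h2

theorem exists_norm_hankelW_le {ν : ℂ} (hν : -1 < ν.re) :
    ∃ C : ℝ, 0 < C ∧ ∀ z : ℝ, 1 ≤ z → ‖hankelW ν z‖ ≤ C ∧ ‖hankelW' ν z‖ ≤ C := by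
  obtain ⟨C, hC, h⟩ := exists_hankelEnergy_le hν
  refine ⟨Real.sqrt C, by positivity, fun z hz => ⟨?_, ?_⟩⟩ <;>
  · apply Real.le_sqrt_of_sq_le
    refine le_trans ?_ (h z hz)
    unfold hankelEnergy
    nlinarith [sq_nonneg ‖hankelW ν z‖, sq_nonneg ‖hankelW' ν z‖]

theorem continuousOn_hankelW {ν : ℂ} (hν : -1 < ν.re) :
    ContinuousOn (fun z : ℝ => hankelW ν z) (Ioi 0) :=
  fun _ hz => (hasDerivAt_hankelW_real hν hz).continuousAt.continuousWithinAt

theorem continuousOn_hankelW' {ν : ℂ} (hν : -1 < ν.re) :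
    ContinuousOn (fun z : ℝ => hankelW' ν z) (Ioi 0) :=
  fun _ hz => (hasDerivAt_hankelW'_real hν hz).continuousAt.continuousWithinAt

/-- Equipartition of the energy: `|w|²` has a positive mean on the long intervals `[x, 2x]`,
because `(Re (w̄ w'))' = |w'|² - (1 - Re q / z²) |w|²` with `w̄ w'` bounded. -/
theorem exists_le_integral_norm_sq_hankelW {ν : ℂ} (hν : -1 < ν.re) :
    ∃ c X : ℝ, 0 < c ∧ 1 ≤ X ∧ ∀ x : ℝ, X ≤ x →
      c * x ≤ ∫ z in x..(2 * x), ‖hankelW ν z‖ ^ 2 := by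
  obtain ⟨C, hC, hw⟩ := exists_norm_hankelW_le hν
  obtain ⟨c, hc, hE⟩ := exists_le_hankelEnergy hν
  set Q := ‖ν ^ 2 - 1 / 4‖ with hQ
  have hQ0 : 0 ≤ Q := norm_nonneg _
  refine ⟨c / (2 * (2 + Q)), max 1 (4 * C ^ 2 / c), by positivity, le_max_left _ _, ?_⟩
  intro x hx
  have hx1 : 1 ≤ x := (le_max_left _ _).trans hx
  have hxC : 4 * C ^ 2 ≤ c * x := by
    have := (le_max_right _ _).trans hx
    rw [div_le_iff₀ hc] at this; linarith
  have hx2 : x ≤ 2 * x := by linarith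
  have hsub : uIcc x (2 * x) ⊆ Ioi (0 : ℝ) := by
    rw [uIcc_of_le hx2]; intro z hz; exact mem_Ioi.2 (by linarith [hz.1])
  have hcw := (continuousOn_hankelW hν).mono hsub
  have hcw' := (continuousOn_hankelW' hν).mono hsub
  have hi1 : IntervalIntegrable (fun z : ℝ => ‖hankelW ν z‖ ^ 2) volume x (2 * x) :=
    (hcw.norm.pow 2).intervalIntegrable
  have hi2 : IntervalIntegrable (fun z : ℝ => ‖hankelW' ν z‖ ^ 2) volume x (2 * x) :=
    (hcw'.norm.pow 2).intervalIntegrable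
  have hcc : ContinuousOn (fun z : ℝ => inner ℝ (hankelW ν z)
      (-(1 - (ν ^ 2 - 1 / 4) / (z : ℂ) ^ 2) * hankelW ν z) + inner ℝ (hankelW' ν z) (hankelW' ν z))
      (uIcc x (2 * x)) := by
    refine (hcw.inner ?_).add (hcw'.inner hcw')
    refine ContinuousOn.mul ?_ hcw
    refine (continuousOn_const.sub (continuousOn_const.div ?_ ?_)).neg
    · fun_prop
    · intro z hz
      have : z ≠ 0 := (hsub hz).ne'
      exact pow_ne_zero 2 (by exact_mod_cast this)
  -- the virial identity: `⟪w, w'⟫' = |w'|² + ⟪w, w''⟫`, with bounded `⟪w, w'⟫`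
  have hftc := intervalIntegral.integral_eq_sub_of_hasDerivAt
    (f := fun z : ℝ => inner ℝ (hankelW ν z) (hankelW' ν z))
    (f' := fun z : ℝ => inner ℝ (hankelW ν z)
      (-(1 - (ν ^ 2 - 1 / 4) / (z : ℂ) ^ 2) * hankelW ν z) +
      inner ℝ (hankelW' ν z) (hankelW' ν z)) (a := x) (b := 2 * x)
    (fun z hz => (hasDerivAt_hankelW_real hν (hsub hz)).inner ℝ
      (hasDerivAt_hankelW'_real hν (hsub hz))) hcc.intervalIntegrable
  have hbd : ∀ z : ℝ, 1 ≤ z → |inner ℝ (hankelW ν z) (hankelW' ν z)| ≤ C ^ 2 := by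
    intro z hz
    refine (abs_real_inner_le_norm _ _).trans ?_
    obtain ⟨h1, h2⟩ := hw z hz
    nlinarith [norm_nonneg (hankelW ν z), norm_nonneg (hankelW' ν z)]
  have hb1 := abs_le.1 (hbd x hx1)
  have hb2 := abs_le.1 (hbd (2 * x) (by linarith))
  have hmono : ∫ z in x..(2 * x), (‖hankelW' ν z‖ ^ 2 - (1 + Q) * ‖hankelW ν z‖ ^ 2) ≤
      ∫ z in x..(2 * x), (inner ℝ (hankelW ν z)
      (-(1 - (ν ^ 2 - 1 / 4) / (z : ℂ) ^ 2) * hankelW ν z) +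
      inner ℝ (hankelW' ν z) (hankelW' ν z)) := by
    refine intervalIntegral.integral_mono_on hx2 (hi2.sub (hi1.const_mul _))
      hcc.intervalIntegrable fun z hz => ?_
    have hz1 : 1 ≤ z := hx1.trans hz.1
    rw [real_inner_self_eq_norm_sq]
    have h1 := neg_le_of_abs_le (abs_real_inner_le_norm (hankelW ν z)
      (-(1 - (ν ^ 2 - 1 / 4) / (z : ℂ) ^ 2) * hankelW ν z))
    have h2 : ‖-(1 - (ν ^ 2 - 1 / 4) / (z : ℂ) ^ 2) * hankelW ν z‖ ≤ (1 + Q) * ‖hankelW ν z‖ := by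
      rw [norm_mul, norm_neg]
      gcongr
      refine (norm_sub_le _ _).trans ?_
      rw [norm_one, norm_div, norm_pow, Complex.norm_real, Real.norm_of_nonneg (by linarith)]
      gcongr
      exact div_le_self hQ0 (by nlinarith)
    have h3 := mul_le_mul_of_nonneg_left h2 (norm_nonneg (hankelW ν z))
    nlinarith
  -- the total energy is at least `c x`, and `∫ |w'|² ≤ (1 + Q) ∫ |w|² + 2 C²`
  have hlow : c * x ≤ ∫ z in x..(2 * x), (‖hankelW ν z‖ ^ 2 + ‖hankelW' ν z‖ ^ 2) := by
    have : ∫ _ in x..(2 * x), c = c * x := by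
      rw [intervalIntegral.integral_const, smul_eq_mul]; ring
    rw [← this]
    exact intervalIntegral.integral_mono_on hx2 intervalIntegrable_const (hi1.add hi2)
      fun z hz => hE z (hx1.trans hz.1)
  rw [intervalIntegral.integral_add hi1 hi2] at hlow
  rw [intervalIntegral.integral_sub hi2 (hi1.const_mul _),
    intervalIntegral.integral_const_mul] at hmono
  rw [hftc] at hmono
  set I1 := ∫ z in x..(2 * x), ‖hankelW ν z‖ ^ 2
  rw [div_mul_eq_mul_div, div_le_iff₀ (by positivity)]
  nlinarith

/-! ### Bounds for `J_ν` -/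

theorem measurable_besselJ {ν : ℂ} (hν : -1 < ν.re) : Measurable (besselJ ν) := by
  have h : besselJ ν = fun x : ℝ => ((x : ℂ) / 2) ^ ν * besselPhi ν (((x : ℂ) / 2) ^ 2) :=
    funext fun x => besselJ_eq_besselPhi ν x
  rw [h]
  refine Measurable.mul ?_ ?_
  · exact (Complex.measurable_ofReal.div_const 2).pow_const ν
  · exact ((continuous_besselPhi hν).comp (by fun_prop)).measurable

theorem ofReal_sqrt_eq_cpow {z : ℝ} (hz : 0 ≤ z) : (Real.sqrt z : ℂ) = (z : ℂ) ^ (1 / 2 : ℂ) := by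
  rw [Real.sqrt_eq_rpow, Complex.ofReal_cpow hz]
  simp

theorem half_cpow {z : ℝ} (hz : 0 ≤ z) (ν : ℂ) :
    ((z : ℂ) / 2) ^ ν = (z : ℂ) ^ ν * (1 / 2 : ℂ) ^ ν := by
  have h : ((z : ℂ) / 2) = (z : ℂ) * ((1 / 2 : ℝ) : ℂ) := by push_cast; ring
  rw [h, Complex.mul_cpow_ofReal_nonneg hz (by norm_num)]
  simp

theorem sqrt_mul_besselJ (ν : ℂ) {z : ℝ} (hz : 0 < z) :
    (Real.sqrt z : ℂ) * besselJ ν z = (1 / 2 : ℂ) ^ ν * hankelW ν z := by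
  have hz0 : (z : ℂ) ≠ 0 := by exact_mod_cast hz.ne'
  rw [besselJ_eq_besselPhi, half_cpow hz.le, ofReal_sqrt_eq_cpow hz.le, hankelW,
    Complex.cpow_add _ _ hz0]
  ring

theorem norm_cpow_real {z : ℝ} (hz : 0 < z) (ν : ℂ) : ‖(z : ℂ) ^ ν‖ = z ^ ν.re :=
  Complex.norm_cpow_eq_rpow_re_of_pos hz ν

theorem exists_norm_besselJ_le_rpow {ν : ℂ} (hν : -1 < ν.re) :
    ∃ C : ℝ, 0 < C ∧ ∀ z : ℝ, 0 < z → z ≤ 1 → ‖besselJ ν z‖ ≤ C * z ^ ν.re := by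
  have hc : Continuous fun z : ℝ => besselPhi ν (((z : ℂ) / 2) ^ 2) :=
    (continuous_besselPhi hν).comp (by fun_prop)
  obtain ⟨M, hM⟩ := (isCompact_Icc (a := (0 : ℝ)) (b := 1)).exists_bound_of_continuousOn
    hc.continuousOn
  refine ⟨‖(1 / 2 : ℂ) ^ ν‖ * M + 1, ?_, fun z hz hz1 => ?_⟩
  · have : 0 ≤ M := (norm_nonneg _).trans (hM 0 (by simp))
    positivity
  · rw [besselJ_eq_besselPhi, half_cpow hz.le, norm_mul, norm_mul, norm_cpow_real hz]
    have h1 := hM z ⟨hz.le, hz1⟩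
    have h2 : 0 ≤ z ^ ν.re := by positivity
    calc z ^ ν.re * ‖(1 / 2 : ℂ) ^ ν‖ * ‖besselPhi ν (((z : ℂ) / 2) ^ 2)‖
        ≤ z ^ ν.re * ‖(1 / 2 : ℂ) ^ ν‖ * M := by gcongr
      _ ≤ (‖(1 / 2 : ℂ) ^ ν‖ * M + 1) * z ^ ν.re := by nlinarith

theorem exists_norm_sqrt_mul_besselJ_le {ν : ℂ} (hν : -1 < ν.re) :
    ∃ C : ℝ, 0 < C ∧ ∀ z : ℝ, 1 ≤ z → ‖(Real.sqrt z : ℂ) * besselJ ν z‖ ≤ C := by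
  obtain ⟨C, hC, h⟩ := exists_norm_hankelW_le hν
  refine ⟨‖(1 / 2 : ℂ) ^ ν‖ * C + 1, by positivity, fun z hz => ?_⟩
  rw [sqrt_mul_besselJ ν (by linarith), norm_mul]
  have := mul_le_mul_of_nonneg_left (h z hz).1 (norm_nonneg ((1 / 2 : ℂ) ^ ν))
  linarith

theorem norm_ofReal_sqrt (z : ℝ) : ‖(Real.sqrt z : ℂ)‖ = Real.sqrt z := by
  rw [Complex.norm_real, Real.norm_of_nonneg (Real.sqrt_nonneg z)]

/-- A bound for `J_ν` on the whole half line that is sharp at `0`; the growth it allows at infinity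
is immaterial. -/
theorem exists_norm_besselJ_le {ν : ℂ} (hν : -1 < ν.re) :
    ∃ C : ℝ, 0 < C ∧ ∀ z : ℝ, 0 < z → ‖besselJ ν z‖ ≤ C * (z ^ ν.re * (1 + z)) := by
  obtain ⟨C₁, hC₁, h₁⟩ := exists_norm_besselJ_le_rpow hν
  obtain ⟨C₂, hC₂, h₂⟩ := exists_norm_sqrt_mul_besselJ_le hν
  refine ⟨max C₁ C₂, by positivity, fun z hz => ?_⟩
  rcases le_total z 1 with hz1 | hz1
  · refine (h₁ z hz hz1).trans ?_
    gcongr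
    · exact le_max_left _ _
    · exact le_mul_of_one_le_right (by positivity) (by linarith)
  · have h := h₂ z hz1
    rw [norm_mul, norm_ofReal_sqrt] at h
    have hs : 1 ≤ Real.sqrt z := Real.one_le_sqrt.2 hz1
    have h3 : ‖besselJ ν z‖ ≤ C₂ := by nlinarith [norm_nonneg (besselJ ν z)]
    refine h3.trans ?_
    have h4 : 1 ≤ z ^ ν.re * (1 + z) := by
      calc (1 : ℝ) ≤ z ^ (ν.re + 1) := Real.one_le_rpow hz1 (by linarith)
        _ = z ^ ν.re * z := Real.rpow_add_one hz.ne' _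
        _ ≤ _ := by gcongr; linarith
    calc C₂ ≤ max C₁ C₂ * 1 := by rw [mul_one]; exact le_max_right _ _
      _ ≤ _ := by gcongr

theorem exists_norm_sqrt_mul_besselJ_le_min {ν : ℂ} (hν : -1 < ν.re) :
    ∃ C : ℝ, 0 < C ∧ ∀ z : ℝ, 0 < z →
      ‖(Real.sqrt z : ℂ) * besselJ ν z‖ ≤ C * (1 + z ^ min 0 (ν.re + 1 / 2)) := by
  obtain ⟨C₁, hC₁, h₁⟩ := exists_norm_besselJ_le_rpow hν
  obtain ⟨C₂, hC₂, h₂⟩ := exists_norm_sqrt_mul_besselJ_le hν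
  refine ⟨max C₁ C₂, by positivity, fun z hz => ?_⟩
  rcases le_total z 1 with hz1 | hz1
  · rw [norm_mul, norm_ofReal_sqrt]
    calc Real.sqrt z * ‖besselJ ν z‖ ≤ Real.sqrt z * (C₁ * z ^ ν.re) := by
          gcongr; exact h₁ z hz hz1
      _ = C₁ * z ^ (ν.re + 1 / 2) := by
          rw [Real.rpow_add hz, Real.sqrt_eq_rpow]; ring
      _ ≤ max C₁ C₂ * z ^ (min 0 (ν.re + 1 / 2)) :=
          mul_le_mul (le_max_left _ _)
            (Real.rpow_le_rpow_of_exponent_ge hz hz1 (min_le_right _ _)) (by positivity)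
            (by positivity)
      _ ≤ _ := by gcongr; linarith
  · refine (h₂ z hz1).trans ?_
    calc C₂ ≤ max C₁ C₂ * 1 := by rw [mul_one]; exact le_max_right _ _
      _ ≤ _ := by
        gcongr
        have : 0 ≤ z ^ min 0 (ν.re + 1 / 2) := by positivity
        linarith

/-- `√z |J_ν(z)|` has a positive mean over dilates, although it may vanish at single points: its mean
square is bounded below, and the function itself is bounded. -/
theorem exists_le_integral_norm_sqrt_mul_besselJ {ν : ℂ} (hν : -1 < ν.re) :
    ∃ c X : ℝ, 0 < c ∧ 1 ≤ X ∧ ∀ x : ℝ, X ≤ x →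
      c ≤ ∫ u in (1 : ℝ)..2, ‖(Real.sqrt (x * u) : ℂ) * besselJ ν (x * u)‖ := by
  obtain ⟨c, X, hc, hX, h⟩ := exists_le_integral_norm_sq_hankelW hν
  obtain ⟨C, hC, hw⟩ := exists_norm_hankelW_le hν
  set k := ‖(1 / 2 : ℂ) ^ ν‖ with hk
  have hk0 : 0 < k := by
    rw [hk, norm_pos_iff, Complex.cpow_ne_zero_iff]; left; norm_num
  refine ⟨k * (c / C), X, by positivity, hX, fun x hx => ?_⟩
  have hx1 : 1 ≤ x := hX.trans hx
  have hx0 : 0 < x := by linarith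
  have hx2 : x ≤ 2 * x := by linarith
  have e1 : ∫ u in (1 : ℝ)..2, ‖(Real.sqrt (x * u) : ℂ) * besselJ ν (x * u)‖ =
      ∫ u in (1 : ℝ)..2, k * ‖hankelW ν ((x * u : ℝ) : ℂ)‖ := by
    refine intervalIntegral.integral_congr fun u hu => ?_
    rw [uIcc_of_le one_le_two] at hu
    have : 0 < x * u := mul_pos hx0 (by linarith [hu.1])
    rw [sqrt_mul_besselJ ν this, norm_mul]
  have e2 := intervalIntegral.integral_comp_mul_left
    (fun z : ℝ => k * ‖hankelW ν z‖) (a := 1) (b := 2) hx0.ne'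
  rw [e1, e2, intervalIntegral.integral_const_mul, smul_eq_mul, mul_one, mul_comm x 2]
  have hsub : uIcc x (2 * x) ⊆ Ioi (0 : ℝ) := by
    rw [uIcc_of_le hx2]; intro z hz; exact mem_Ioi.2 (by linarith [hz.1])
  have hcw := (continuousOn_hankelW hν).mono hsub
  have h3 : ∫ z in x..(2 * x), ‖hankelW ν z‖ ^ 2 ≤ ∫ z in x..(2 * x), C * ‖hankelW ν z‖ := by
    refine intervalIntegral.integral_mono_on hx2 (hcw.norm.pow 2).intervalIntegrable
      (hcw.norm.intervalIntegrable.const_mul _) fun z hz => ?_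
    have := (hw z (hx1.trans hz.1)).1
    nlinarith [norm_nonneg (hankelW ν z)]
  rw [intervalIntegral.integral_const_mul] at h3
  have h4 := (h x hx).trans h3
  set I := ∫ z in x..(2 * x), ‖hankelW ν z‖
  have h5 : c / C ≤ x⁻¹ * I := by
    rw [div_le_iff₀ hC, inv_mul_eq_div, div_mul_eq_mul_div, le_div_iff₀ hx0]
    linarith
  calc k * (c / C) ≤ k * (x⁻¹ * I) := by gcongr
    _ = _ := by ring

/-! ### Weber's integral -/

/-- `Γ(Re ν + m + 1) / |Γ(ν + m + 1)|` does not increase with `m`; it is what the moduli of the terms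
of the Laplace transform below leave of the Gamma factors. -/
theorem Gamma_mul_norm_inv_Gamma_le {ν : ℂ} (hν : -1 < ν.re) (m : ℕ) :
    Real.Gamma (ν.re + m + 1) * ‖(Complex.Gamma (m + ν + 1))⁻¹‖ ≤
      Real.Gamma (ν.re + 1) * ‖(Complex.Gamma (ν + 1))⁻¹‖ := by
  induction m with
  | zero => simp
  | succ k ih =>
    have hk : (0 : ℝ) ≤ k := Nat.cast_nonneg k
    have hpos : 0 < ν.re + k + 1 := by linarith
    have hre : (k + ν + 1 : ℂ).re = ν.re + k + 1 := by simp; ring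
    have hne : (k + ν + 1 : ℂ) ≠ 0 := by
      intro h; rw [h] at hre; simp at hre; linarith
    have e1 : (((k + 1 : ℕ) : ℂ) + ν + 1) = (k + ν + 1) + 1 := by push_cast; ring
    have e2 : ν.re + ((k + 1 : ℕ) : ℝ) + 1 = (ν.re + k + 1) + 1 := by push_cast; ring
    rw [e1, e2, Complex.Gamma_add_one _ hne, Real.Gamma_add_one hpos.ne', mul_inv, norm_mul,
      norm_inv]
    refine le_trans ?_ ih
    have h1 : (ν.re + k + 1) ≤ ‖(k + ν + 1 : ℂ)‖ := hre ▸ Complex.re_le_norm _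
    have hG := Real.Gamma_pos_of_pos hpos
    have h2 : (ν.re + k + 1) * ‖(k + ν + 1 : ℂ)‖⁻¹ ≤ 1 := by
      rw [← div_eq_mul_inv]; exact div_le_one_of_le₀ h1 (norm_nonneg _)
    calc _ = ((ν.re + k + 1) * ‖(k + ν + 1 : ℂ)‖⁻¹) *
          (Real.Gamma (ν.re + k + 1) * ‖(Complex.Gamma (k + ν + 1))⁻¹‖) := by ring
      _ ≤ 1 * (Real.Gamma (ν.re + k + 1) * ‖(Complex.Gamma (k + ν + 1))⁻¹‖) := by gcongr
      _ = _ := one_mul _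

/-- The Laplace transform of `v^ν φ_ν(b v)`, integrated term by term. -/
theorem integral_cpow_mul_besselPhi_mul_exp {ν : ℂ} (hν : -1 < ν.re) (b : ℂ) {p : ℝ} (hp : 0 < p) :
    ∫ v in Ioi (0 : ℝ), (v : ℂ) ^ ν * besselPhi ν (b * v) * Complex.exp (-(p * v)) =
      (p : ℂ) ^ (-ν - 1) * Complex.exp (-(b / p)) := by
  have hp0 : (p : ℂ) ≠ 0 := by exact_mod_cast hp.ne'
  set a : ℕ → ℂ := fun m => (-1) ^ m * (m.factorial : ℂ)⁻¹ * (Complex.Gamma (m + ν + 1))⁻¹ with ha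
  set F : ℕ → ℝ → ℂ := fun m v =>
    a m * b ^ m * ((v : ℂ) ^ ((ν + m + 1) - 1) * Complex.exp (-(p * v))) with hF
  have hre : ∀ m : ℕ, (ν + m + 1 : ℂ).re = ν.re + m + 1 := fun m => by simp
  have hpos : ∀ m : ℕ, 0 < ν.re + m + 1 := fun m => by
    linarith [(Nat.cast_nonneg m : (0 : ℝ) ≤ m)]
  have hFn : ∀ m, ∀ v ∈ Ioi (0 : ℝ), ‖F m v‖ =
      ‖a m‖ * ‖b‖ ^ m * (v ^ ((ν.re + m + 1) - 1) * Real.exp (-(p * v))) := by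
    intro m v hv
    simp only [hF]
    rw [norm_mul, norm_mul, norm_pow, norm_mul ((v : ℂ) ^ _), norm_cpow_real hv, Complex.norm_exp]
    simp
  have hint : ∀ m, IntegrableOn (F m) (Ioi 0) := by
    intro m
    have hg : IntegrableOn (fun v : ℝ => ‖a m‖ * ‖b‖ ^ m *
        (v ^ ((ν.re + m + 1) - 1) * Real.exp (-(p * v)))) (Ioi 0) := by
      have := integrableOn_rpow_mul_exp_neg_mul_rpow (p := 1) (s := (ν.re + m + 1) - 1) (b := p)
        (by linarith [hpos m]) one_pos hp
      simp only [Real.rpow_one, neg_mul] at this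
      exact this.const_mul _
    refine Integrable.mono' hg ?_ ?_
    · refine (ContinuousOn.mul continuousOn_const (ContinuousOn.mul ?_ ?_)).aestronglyMeasurable
        measurableSet_Ioi
      · exact fun v hv => (Complex.continuousAt_ofReal_cpow_const _ _
          (Or.inr (ne_of_gt hv))).continuousWithinAt
      · fun_prop
    · exact (ae_restrict_mem measurableSet_Ioi).mono fun v hv => (hFn m v hv).le
  have hnorm : ∀ m, ∫ v in Ioi (0 : ℝ), ‖F m v‖ =
      ‖a m‖ * ‖b‖ ^ m * ((1 / p) ^ (ν.re + m + 1) * Real.Gamma (ν.re + m + 1)) := by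
    intro m
    rw [setIntegral_congr_fun measurableSet_Ioi (hFn m), integral_const_mul,
      Real.integral_rpow_mul_exp_neg_mul_Ioi (hpos m) hp]
  set K := Real.Gamma (ν.re + 1) * ‖(Complex.Gamma (ν + 1))⁻¹‖ with hK
  have hsum : Summable fun m => ∫ v in Ioi (0 : ℝ), ‖F m v‖ := by
    refine Summable.of_nonneg_of_le (fun m => integral_nonneg fun v => norm_nonneg _) ?_
      ((Real.summable_pow_div_factorial (‖b‖ / p)).mul_left (K * (1 / p) ^ (ν.re + 1)))
    intro m
    rw [hnorm m]
    have h1 : ‖a m‖ = ((m.factorial : ℝ))⁻¹ * ‖(Complex.Gamma (m + ν + 1))⁻¹‖ := by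
      simp only [ha]
      rw [norm_mul, norm_mul, norm_pow, norm_neg, norm_one, one_pow, one_mul, norm_inv,
        Complex.norm_natCast]
    have h2 : (1 / p) ^ (ν.re + m + 1) = (1 / p) ^ (ν.re + 1) * (1 / p) ^ m := by
      rw [show ν.re + m + 1 = (ν.re + 1) + m by ring, Real.rpow_add (by positivity),
        Real.rpow_natCast]
    have h3 := Gamma_mul_norm_inv_Gamma_le hν m
    rw [h1, h2]
    calc _ = (Real.Gamma (ν.re + m + 1) * ‖(Complex.Gamma (m + ν + 1))⁻¹‖) *
          (1 / p) ^ (ν.re + 1) * ((‖b‖ / p) ^ m / m.factorial) := by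
            rw [div_pow, div_pow]; field_simp; simp
      _ ≤ _ := by gcongr
  have hs := hasSum_integral_of_summable_integral_norm hint hsum
  have hleft : ∫ v in Ioi (0 : ℝ), (∑' m, F m v) =
      ∫ v in Ioi (0 : ℝ), (v : ℂ) ^ ν * besselPhi ν (b * v) * Complex.exp (-(p * v)) := by
    refine setIntegral_congr_fun measurableSet_Ioi fun v hv => ?_
    have hv0 : (v : ℂ) ≠ 0 := by exact_mod_cast (ne_of_gt hv)
    simp only [besselPhi]
    rw [← tsum_mul_left, ← tsum_mul_right]
    refine tsum_congr fun m => ?_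
    simp only [hF, ha]
    rw [show (ν + m + 1 - 1 : ℂ) = ν + m by ring, Complex.cpow_add _ _ hv0, Complex.cpow_natCast,
      mul_pow]
    ring
  have hterm : ∀ m, ∫ v in Ioi (0 : ℝ), F m v =
      (p : ℂ) ^ (-ν - 1) * ((-(b / p)) ^ m / m.factorial) := by
    intro m
    simp only [hF]
    rw [integral_const_mul, Complex.integral_cpow_mul_exp_neg_mul_Ioi (by rw [hre]; exact hpos m) hp]
    have hG : Complex.Gamma (m + ν + 1) ≠ 0 := by
      apply Complex.Gamma_ne_zero_of_re_pos
      have := hpos m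
      simp; linarith
    have e1 : (ν + m + 1 : ℂ) = m + ν + 1 := by ring
    have e2 : (1 / p : ℂ) ^ (m + ν + 1 : ℂ) = (p : ℂ) ^ (-ν - 1) * (1 / p) ^ m := by
      rw [one_div, Complex.inv_cpow _ _ (by
        rw [Complex.arg_ofReal_of_nonneg hp.le]; exact Real.pi_pos.ne), ← Complex.cpow_neg,
        show -(m + ν + 1 : ℂ) = (-ν - 1) + (-(m : ℂ)) by ring, Complex.cpow_add _ _ hp0,
        Complex.cpow_neg, Complex.cpow_natCast, inv_pow]
    rw [e1, e2]
    simp only [ha]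
    rw [neg_pow (b / (p : ℂ)), div_pow, div_pow, one_pow]
    field_simp
  rw [← hleft, ← hs.tsum_eq]
  simp only [hterm]
  rw [tsum_mul_left, Complex.exp_eq_exp_ℂ, NormedSpace.exp_eq_tsum_div]

/-- Weber's integral: the Gaussian moment of `J_ν`. -/
theorem integral_cpow_mul_besselJ_mul_exp {ν : ℂ} (hν : -1 < ν.re) {b p : ℝ} (hb : 0 < b)
    (hp : 0 < p) :
    ∫ u in Ioi (0 : ℝ), (u : ℂ) ^ (ν + 1) * besselJ ν (u * b) * Complex.exp (-(p * (u : ℂ) ^ 2)) =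
      (b : ℂ) ^ ν * (2 * p : ℂ) ^ (-ν - 1) * Complex.exp (-((b : ℂ) ^ 2 / (4 * p))) := by
  have h := integral_cpow_mul_besselPhi_mul_exp hν ((b / 2 : ℂ) ^ 2) hp
  -- substitute `v = u²` in the Laplace transform
  rw [← integral_comp_rpow_Ioi_of_pos (p := 2) two_pos] at h
  have hp0 : (p : ℂ) ≠ 0 := by exact_mod_cast hp.ne'
  have e : ∫ u in Ioi (0 : ℝ), (u : ℂ) ^ (ν + 1) * besselJ ν (u * b) *
      Complex.exp (-(p * (u : ℂ) ^ 2)) = (b / 2 : ℂ) ^ ν / 2 *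
      ∫ u in Ioi (0 : ℝ), (2 * u ^ ((2 : ℝ) - 1)) • (((u ^ (2 : ℝ) : ℝ) : ℂ) ^ ν *
      besselPhi ν ((b / 2 : ℂ) ^ 2 * ((u ^ (2 : ℝ) : ℝ) : ℂ)) *
      Complex.exp (-(p * ((u ^ (2 : ℝ) : ℝ) : ℂ)))) := by
    rw [← integral_const_mul]
    refine setIntegral_congr_fun measurableSet_Ioi fun u hu => ?_
    have hu' : (0 : ℝ) < u := hu
    have hu0 : (u : ℂ) ≠ 0 := by exact_mod_cast hu'.ne'
    rw [besselJ_eq_besselPhi, show (2 : ℝ) - 1 = 1 by norm_num, Real.rpow_one, Real.rpow_two]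
    have e1 : (((u * b : ℝ) : ℂ) / 2) ^ ν = (u : ℂ) ^ ν * (b / 2 : ℂ) ^ ν := by
      have : (((u * b : ℝ) : ℂ) / 2) = (u : ℂ) * ((b / 2 : ℝ) : ℂ) := by push_cast; ring
      rw [this, Complex.mul_cpow_ofReal_nonneg hu'.le (by positivity)]
      push_cast; rfl
    have e2 : ((u ^ 2 : ℝ) : ℂ) ^ ν = (u : ℂ) ^ ν * (u : ℂ) ^ ν := by
      rw [pow_two, Complex.ofReal_mul, Complex.mul_cpow_ofReal_nonneg hu'.le hu'.le]
    have e3 : (((u * b : ℝ) : ℂ) / 2) ^ 2 = (b / 2 : ℂ) ^ 2 * ((u ^ 2 : ℝ) : ℂ) := by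
      push_cast; ring
    rw [e1, e2, e3, Complex.cpow_add _ _ hu0, Complex.cpow_one, Complex.real_smul]
    push_cast
    ring
  rw [e, h]
  have e4 : (2 * p : ℂ) ^ (-ν - 1) = (2 : ℂ) ^ (-ν - 1) * (p : ℂ) ^ (-ν - 1) := by
    have := Complex.mul_cpow_ofReal_nonneg (a := 2) (b := p) zero_le_two hp.le (-ν - 1)
    simpa using this
  have e5 : (b / 2 : ℂ) ^ ν = (b : ℂ) ^ ν * (2 : ℂ) ^ (-ν) := by
    rw [half_cpow hb.le, one_div, Complex.inv_cpow _ _ (by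
      rw [show (2 : ℂ) = ((2 : ℝ) : ℂ) by simp, Complex.arg_ofReal_of_nonneg zero_le_two]
      exact Real.pi_pos.ne), Complex.cpow_neg]
  rw [e4, e5, Complex.cpow_sub _ _ two_ne_zero, Complex.cpow_one]
  have e6 : (b / 2 : ℂ) ^ 2 / p = (b : ℂ) ^ 2 / (4 * p) := by field_simp; norm_num
  rw [e6]
  ring

/-! ### Integral representations of the Macdonald function -/

/-- The integrand of `2 (z/2)^(-ν) K_ν(z) = ∫₀^∞ t^(-ν-1) exp(-t - z²/(4t)) dt`. -/
noncomputable def macdonaldIntegrand (ν : ℂ) (z t : ℝ) : ℂ :=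
  (t : ℂ) ^ (-ν - 1) * (Real.exp (-(t + z ^ 2 / (4 * t))) : ℂ)

/-- `K_ν(z)` with the lower part of its integral representation
`½ (z/2)^ν ∫ t^(-ν-1) exp(-t - z²/(4t)) dt` cut off at `t = η`. -/
noncomputable def truncK (ν : ℂ) (η z : ℝ) : ℂ :=
  1 / 2 * ((z : ℂ) / 2) ^ ν * ∫ t in Ioi η, macdonaldIntegrand ν z t

/-- The Macdonald function of real order `s`, as a real function. -/
noncomputable def macK (s z : ℝ) : ℝ :=
  ∫ t in Ioi (0 : ℝ), Real.exp (-(z * Real.cosh t)) * Real.cosh (s * t)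

theorem norm_macdonaldIntegrand (ν : ℂ) (z : ℝ) {t : ℝ} (ht : 0 < t) :
    ‖macdonaldIntegrand ν z t‖ = t ^ (-ν.re - 1) * Real.exp (-(t + z ^ 2 / (4 * t))) := by
  rw [macdonaldIntegrand, norm_mul, norm_cpow_real ht, Complex.norm_real,
    Real.norm_of_nonneg (Real.exp_pos _).le]
  simp

theorem continuousOn_cpow_ofReal (a : ℂ) : ContinuousOn (fun t : ℝ => (t : ℂ) ^ a) (Ioi 0) :=
  fun _ ht => (Complex.continuousAt_ofReal_cpow_const _ _ (Or.inr (ne_of_gt ht))).continuousWithinAt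

theorem continuousOn_macdonaldIntegrand (ν : ℂ) (z : ℝ) :
    ContinuousOn (macdonaldIntegrand ν z) (Ioi 0) := by
  refine (continuousOn_cpow_ofReal _).mul ?_
  refine Complex.continuous_ofReal.comp_continuousOn (Real.continuous_exp.comp_continuousOn ?_)
  refine (continuousOn_id.add (continuousOn_const.div (by fun_prop) fun t ht => ?_)).neg
  have : (0 : ℝ) < t := ht
  positivity

theorem integrableOn_macdonaldIntegrand (ν : ℂ) {z : ℝ} (hz : 0 < z) :
    IntegrableOn (macdonaldIntegrand ν z) (Ioi 0) := by
  -- `exp(-z²/(4t)) ≤ C tⁿ` compensates the singularity of `t^(-ν-1)` at `0`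
  obtain ⟨n, hn⟩ := exists_nat_gt ν.re
  have hg : IntegrableOn (fun t : ℝ => (n.factorial * (4 / z ^ 2) ^ n) *
      (Real.exp (-t) * t ^ ((n - ν.re) - 1))) (Ioi 0) :=
    (Real.GammaIntegral_convergent (by linarith : 0 < n - ν.re)).const_mul _
  refine Integrable.mono' hg ?_ ((ae_restrict_mem measurableSet_Ioi).mono fun t ht => ?_)
  · exact (continuousOn_macdonaldIntegrand ν z).aestronglyMeasurable measurableSet_Ioi
  · have ht0 : (0 : ℝ) < t := ht
    rw [norm_macdonaldIntegrand ν z ht0, neg_add, Real.exp_add]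
    have h1 : Real.exp (-(z ^ 2 / (4 * t))) ≤ n.factorial * (4 / z ^ 2) ^ n * t ^ n := by
      have hx : 0 < z ^ 2 / (4 * t) := by positivity
      have h2 := Real.pow_div_factorial_le_exp _ hx.le n
      rw [Real.exp_neg]
      have h3 : (Real.exp (z ^ 2 / (4 * t)))⁻¹ ≤ ((z ^ 2 / (4 * t)) ^ n / n.factorial)⁻¹ := by
        gcongr
      refine h3.trans (le_of_eq ?_)
      rw [div_pow, div_pow, mul_pow]
      field_simp
    have h4 : t ^ ((n : ℝ) - ν.re - 1) = t ^ (-ν.re - 1) * t ^ n := by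
      rw [← Real.rpow_natCast, ← Real.rpow_add ht0]; congr 1; ring
    rw [h4]
    calc _ ≤ t ^ (-ν.re - 1) * (Real.exp (-t) * (n.factorial * (4 / z ^ 2) ^ n * t ^ n)) := by
          gcongr
      _ = _ := by ring

theorem integral_comp_const_mul_exp {c : ℝ} (hc : 0 < c) (g : ℝ → ℂ) :
    ∫ t in Ioi (0 : ℝ), g t = ∫ σ : ℝ, (c * Real.exp σ) • g (c * Real.exp σ) := by
  have himg : (fun σ : ℝ => c * Real.exp σ) '' univ = Ioi 0 := by
    ext t
    simp only [image_univ, mem_range, mem_Ioi]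
    constructor
    · rintro ⟨σ, rfl⟩; positivity
    · intro ht
      exact ⟨Real.log (t / c), by rw [Real.exp_log (by positivity)]; field_simp⟩
  rw [← himg, integral_image_eq_integral_abs_deriv_smul MeasurableSet.univ
    (fun σ _ => ((Real.hasDerivAt_exp σ).const_mul c).hasDerivWithinAt)
    (fun a _ b _ hab => Real.exp_injective (mul_left_cancel₀ hc.ne' hab)), setIntegral_univ]
  refine integral_congr_ae (.of_forall fun σ => ?_)
  simp only
  rw [abs_of_pos (by positivity)]

theorem integrable_comp_const_mul_exp {c : ℝ} (hc : 0 < c) {g : ℝ → ℂ}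
    (hg : IntegrableOn g (Ioi 0)) :
    Integrable fun σ : ℝ => (c * Real.exp σ) • g (c * Real.exp σ) := by
  have himg : (fun σ : ℝ => c * Real.exp σ) '' univ = Ioi 0 := by
    ext t
    simp only [image_univ, mem_range, mem_Ioi]
    constructor
    · rintro ⟨σ, rfl⟩; positivity
    · intro ht
      exact ⟨Real.log (t / c), by rw [Real.exp_log (by positivity)]; field_simp⟩
  rw [← himg, integrableOn_image_iff_integrableOn_abs_deriv_smul MeasurableSet.univ
    (fun σ _ => ((Real.hasDerivAt_exp σ).const_mul c).hasDerivWithinAt)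
    (fun a _ b _ hab => Real.exp_injective (mul_left_cancel₀ hc.ne' hab)),
    integrableOn_univ] at hg
  refine hg.congr (.of_forall fun σ => ?_)
  simp only
  rw [abs_of_pos (by positivity)]

theorem macdonaldIntegrand_comp_exp (ν : ℂ) {z : ℝ} (hz : 0 < z) (σ : ℝ) :
    (z / 2 * Real.exp σ) • macdonaldIntegrand ν z (z / 2 * Real.exp σ) =
      ((z : ℂ) / 2) ^ (-ν) * (Complex.exp (-ν * σ) * (Real.exp (-(z * Real.cosh σ)) : ℂ)) := by
  have ht : 0 < z / 2 * Real.exp σ := by positivity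
  have ht0 : ((z / 2 * Real.exp σ : ℝ) : ℂ) ≠ 0 := by exact_mod_cast ht.ne'
  have e1 : ((z / 2 * Real.exp σ : ℝ) : ℂ) ^ (-ν) =
      ((z : ℂ) / 2) ^ (-ν) * Complex.exp (-ν * σ) := by
    rw [Complex.ofReal_mul, Complex.mul_cpow_ofReal_nonneg (by positivity) (Real.exp_pos _).le]
    congr 1
    · push_cast; rfl
    · rw [Complex.cpow_def_of_ne_zero (by exact_mod_cast (Real.exp_pos σ).ne'),
        ← Complex.ofReal_log (Real.exp_pos σ).le, Real.log_exp]
      ring_nf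
  have e2 : z / 2 * Real.exp σ + z ^ 2 / (4 * (z / 2 * Real.exp σ)) = z * Real.cosh σ := by
    rw [Real.cosh_eq, Real.exp_neg]
    field_simp
    ring
  rw [macdonaldIntegrand, e2, Complex.cpow_sub _ _ ht0, Complex.cpow_one, e1, Complex.real_smul]
  generalize ((z / 2 * Real.exp σ : ℝ) : ℂ) = c at ht0 ⊢
  field_simp

theorem integrable_cexp_mul_exp_neg_cosh (ν : ℂ) {z : ℝ} (hz : 0 < z) :
    Integrable fun σ : ℝ => Complex.exp (-ν * σ) * (Real.exp (-(z * Real.cosh σ)) : ℂ) := by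
  have hz2 : 0 < z / 2 := by positivity
  have hzc : ((z : ℂ) / 2) ≠ 0 := by exact_mod_cast hz2.ne'
  have := integrable_comp_const_mul_exp hz2 (integrableOn_macdonaldIntegrand ν hz)
  simp only [macdonaldIntegrand_comp_exp ν hz] at this
  have h2 := this.const_mul (((z : ℂ) / 2) ^ ν)
  refine h2.congr (.of_forall fun σ => ?_)
  simp only
  rw [← mul_assoc, ← Complex.cpow_add _ _ hzc, add_neg_cancel, Complex.cpow_zero, one_mul]

/-- The integral of `K_ν` over the multiplicative group, obtained from the definition by the
substitution `t = (z/2) e^σ`. -/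
theorem besselK_eq_truncK (ν : ℂ) {z : ℝ} (hz : 0 < z) : besselK ν z = truncK ν 0 z := by
  have hz2 : 0 < z / 2 := by positivity
  have hzc : ((z : ℂ) / 2) ≠ 0 := by exact_mod_cast hz2.ne'
  set h : ℝ → ℂ := fun σ => Complex.exp (-ν * σ) * (Real.exp (-(z * Real.cosh σ)) : ℂ) with hh
  have hint : Integrable h := integrable_cexp_mul_exp_neg_cosh ν hz
  have e1 : truncK ν 0 z = 1 / 2 * ∫ σ, h σ := by
    rw [truncK, integral_comp_const_mul_exp hz2]
    simp only [macdonaldIntegrand_comp_exp ν hz]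
    rw [integral_const_mul, mul_assoc, ← mul_assoc (((z : ℂ) / 2) ^ ν), ← Complex.cpow_add _ _ hzc,
      add_neg_cancel, Complex.cpow_zero, one_mul]
  have e2 : ∫ σ, h σ = ∫ σ in Ioi (0 : ℝ), (h (-σ) + h σ) := by
    rw [integral_add, integral_comp_neg_Ioi, neg_zero, intervalIntegral.integral_Iic_add_Ioi]
    · exact hint.integrableOn
    · exact hint.integrableOn
    · exact hint.comp_neg.integrableOn
    · exact hint.integrableOn
  rw [e1, e2, ← integral_const_mul, besselK]
  refine setIntegral_congr_fun measurableSet_Ioi fun σ _ => ?_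
  simp only [hh, Complex.cosh, Real.cosh_neg]
  push_cast
  ring_nf

theorem besselK_neg (ν : ℂ) (z : ℝ) : besselK (-ν) z = besselK ν z := by
  simp [besselK]

theorem besselK_ofReal (s z : ℝ) : besselK (s : ℂ) z = (macK s z : ℂ) := by
  rw [besselK, macK, ← integral_complex_ofReal]
  push_cast
  rfl

theorem macK_neg (s z : ℝ) : macK (-s) z = macK s z := by simp [macK]

theorem macK_nonneg (s z : ℝ) : 0 ≤ macK s z :=
  integral_nonneg fun _ => mul_nonneg (Real.exp_pos _).le (Real.cosh_pos _).le

theorem integral_norm_macdonaldIntegrand (ν : ℂ) {z : ℝ} (hz : 0 < z) :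
    1 / 2 * (z / 2) ^ ν.re * ∫ t in Ioi (0 : ℝ), ‖macdonaldIntegrand ν z t‖ = macK ν.re z := by
  have h := besselK_eq_truncK (ν.re : ℂ) hz
  rw [besselK_ofReal, truncK] at h
  have e : ∫ t in Ioi (0 : ℝ), macdonaldIntegrand (ν.re : ℂ) z t =
      ((∫ t in Ioi (0 : ℝ), ‖macdonaldIntegrand ν z t‖ : ℝ) : ℂ) := by
    rw [← integral_complex_ofReal]
    refine setIntegral_congr_fun measurableSet_Ioi fun t ht => ?_
    have ht0 : (0 : ℝ) < t := ht
    rw [norm_macdonaldIntegrand ν z ht0, macdonaldIntegrand, Complex.ofReal_mul,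
      Complex.ofReal_cpow ht0.le]
    push_cast
    rfl
  have e2 : ((z : ℂ) / 2) ^ (ν.re : ℂ) = (((z / 2) ^ ν.re : ℝ) : ℂ) := by
    rw [Complex.ofReal_cpow (by positivity)]; push_cast; rfl
  rw [e, e2] at h
  have h' : ((macK ν.re z : ℝ) : ℂ) = ((1 / 2 * (z / 2) ^ ν.re *
      ∫ t in Ioi (0 : ℝ), ‖macdonaldIntegrand ν z t‖ : ℝ) : ℂ) := by
    rw [h]; push_cast; rfl
  exact (Complex.ofReal_injective h').symm

theorem norm_half_cpow {z : ℝ} (hz : 0 < z) (ν : ℂ) : ‖((z : ℂ) / 2) ^ ν‖ = (z / 2) ^ ν.re := by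
  rw [show (z : ℂ) / 2 = ((z / 2 : ℝ) : ℂ) by push_cast; rfl, norm_cpow_real (by positivity)]

theorem norm_truncK_le (ν : ℂ) {η z : ℝ} (hη : 0 ≤ η) (hz : 0 < z) :
    ‖truncK ν η z‖ ≤ macK ν.re z := by
  rw [truncK, norm_mul, norm_mul, norm_half_cpow hz, ← integral_norm_macdonaldIntegrand ν hz]
  have h1 : ‖∫ t in Ioi η, macdonaldIntegrand ν z t‖ ≤
      ∫ t in Ioi (0 : ℝ), ‖macdonaldIntegrand ν z t‖ :=
    (norm_integral_le_integral_norm _).trans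
      (setIntegral_mono_set (integrableOn_macdonaldIntegrand ν hz).norm
        (.of_forall fun t => norm_nonneg _) (Ioi_subset_Ioi hη).eventuallyLE)
  have h2 : ‖(1 / 2 : ℂ)‖ = 1 / 2 := by norm_num
  rw [h2]
  gcongr

theorem norm_besselK_le (ν : ℂ) {z : ℝ} (hz : 0 < z) : ‖besselK ν z‖ ≤ macK ν.re z := by
  rw [besselK_eq_truncK ν hz]; exact norm_truncK_le ν le_rfl hz

theorem integrableOn_besselK (ν : ℂ) {z : ℝ} (hz : 0 < z) :
    IntegrableOn (fun t : ℝ => (Real.exp (-(z * Real.cosh t)) : ℂ) * Complex.cosh (ν * t))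
      (Ioi 0) := by
  refine ((((integrable_cexp_mul_exp_neg_cosh ν hz).add
    (integrable_cexp_mul_exp_neg_cosh (-ν) hz)).const_mul (1 / 2)).congr (.of_forall fun σ => ?_)).integrableOn
  simp only [Complex.cosh, Pi.add_apply]
  ring_nf

theorem integrableOn_macK (s : ℝ) {z : ℝ} (hz : 0 < z) :
    IntegrableOn (fun t : ℝ => Real.exp (-(z * Real.cosh t)) * Real.cosh (s * t)) (Ioi 0) := by
  have := (integrableOn_besselK (s : ℂ) hz).re
  refine IntegrableOn.congr_fun this (fun t _ => ?_) measurableSet_Ioi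
  have h : (Real.exp (-(z * Real.cosh t)) : ℂ) * Complex.cosh ((s : ℂ) * t) =
    ((Real.exp (-(z * Real.cosh t)) * Real.cosh (s * t) : ℝ) : ℂ) := by push_cast; rfl
  exact (congrArg Complex.re h).trans (Complex.ofReal_re _)

theorem macK_le_macK_of_abs_le {s b z : ℝ} (hz : 0 < z) (h : |s| ≤ b) : macK s z ≤ macK b z := by
  refine setIntegral_mono_on (integrableOn_macK s hz) (integrableOn_macK b hz) measurableSet_Ioi
    fun t _ => ?_
  gcongr
  rw [Real.cosh_le_cosh, abs_mul, abs_mul]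
  exact mul_le_mul_of_nonneg_right (h.trans (le_abs_self b)) (abs_nonneg t)

theorem macK_antitone {s z w : ℝ} (hz : 0 < z) (h : z ≤ w) : macK s w ≤ macK s z := by
  refine setIntegral_mono_on (integrableOn_macK s (hz.trans_le h)) (integrableOn_macK s hz)
    measurableSet_Ioi fun t _ => ?_
  have := (Real.cosh_pos (s * t)).le
  have := (Real.cosh_pos t).le
  gcongr

theorem macK_pos (s : ℝ) {z : ℝ} (hz : 0 < z) : 0 < macK s z := by
  refine (integral_pos_iff_support_of_nonneg (fun t => ?_) (integrableOn_macK s hz)).2 ?_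
  · exact mul_nonneg (Real.exp_pos _).le (Real.cosh_pos _).le
  · have : Function.support (fun t : ℝ => Real.exp (-(z * Real.cosh t)) * Real.cosh (s * t)) =
        univ := by
      ext t; simp [(Real.cosh_pos _).ne']
    rw [this]; simp

theorem macK_le_rpow {b z : ℝ} (hb : 0 < b) (hz : 0 < z) :
    macK b z ≤ 1 / 2 * Real.Gamma b * (z / 2) ^ (-b) := by
  have h := integral_norm_macdonaldIntegrand (((-b : ℝ) : ℂ)) hz
  rw [Complex.ofReal_re, macK_neg] at h
  rw [← h]
  have h1 : ∫ t in Ioi (0 : ℝ), ‖macdonaldIntegrand ((-b : ℝ) : ℂ) z t‖ ≤ Real.Gamma b := by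
    rw [Real.Gamma_eq_integral hb]
    refine setIntegral_mono_on (integrableOn_macdonaldIntegrand _ hz).norm
      (Real.GammaIntegral_convergent hb) measurableSet_Ioi fun t ht => ?_
    have ht0 : (0 : ℝ) < t := ht
    rw [norm_macdonaldIntegrand _ z ht0, Complex.ofReal_re, neg_neg, mul_comm]
    gcongr
    have : 0 ≤ z ^ 2 / (4 * t) := by positivity
    linarith
  calc _ ≤ 1 / 2 * (z / 2) ^ (-b) * Real.Gamma b := by gcongr
    _ = _ := by ring

theorem exists_macK_le_rpow {s b : ℝ} (hb : 0 < b) (h : |s| ≤ b) :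
    ∃ C : ℝ, 0 < C ∧ ∀ z : ℝ, 0 < z → macK s z ≤ C * z ^ (-b) := by
  have hG := Real.Gamma_pos_of_pos hb
  refine ⟨1 / 2 * Real.Gamma b * (1 / 2) ^ (-b), by positivity, fun z hz => ?_⟩
  refine ((macK_le_macK_of_abs_le hz h).trans (macK_le_rpow hb hz)).trans (le_of_eq ?_)
  rw [show z / 2 = 1 / 2 * z by ring, Real.mul_rpow (by norm_num) hz.le]
  ring

theorem measurable_macK (s : ℝ) : Measurable (macK s) := by
  have h : StronglyMeasurable (Function.uncurry fun z t : ℝ =>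
      Real.exp (-(z * Real.cosh t)) * Real.cosh (s * t)) := by
    apply Continuous.stronglyMeasurable
    simp only [Function.uncurry_def]
    fun_prop
  exact h.integral_prod_right.measurable

theorem measurable_besselK (ν : ℂ) : Measurable (besselK ν) := by
  have h : StronglyMeasurable (Function.uncurry fun z t : ℝ =>
      (Real.exp (-(z * Real.cosh t)) : ℂ) * Complex.cosh (ν * t)) := by
    apply Continuous.stronglyMeasurable
    simp only [Function.uncurry_def]
    fun_prop
  exact h.integral_prod_right.measurable

theorem measurable_uncurry_macdonaldIntegrand (ν : ℂ) :
    Measurable fun p : ℝ × ℝ => macdonaldIntegrand ν p.1 p.2 := by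
  unfold macdonaldIntegrand
  refine Measurable.mul ?_ ?_
  · exact (Complex.measurable_ofReal.comp measurable_snd).pow_const _
  · exact Complex.measurable_ofReal.comp (by fun_prop)

theorem measurable_truncK (ν : ℂ) (η : ℝ) : Measurable (truncK ν η) := by
  unfold truncK
  refine Measurable.mul ?_ ?_
  · exact ((Complex.measurable_ofReal.div_const 2).pow_const ν).const_mul _
  · exact (measurable_uncurry_macdonaldIntegrand ν).stronglyMeasurable.integral_prod_right.measurable

/-- The moments of `K_s` of order `a > |s| - 1` are finite: `K_s(z) = O(z^(-b))` for each
`b > |s|`, used with `b < a + 1` near `0` and with `b > a + 1` near infinity. -/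
theorem integrableOn_rpow_mul_macK {a s : ℝ} (h : |s| < a + 1) :
    IntegrableOn (fun u : ℝ => u ^ a * macK s u) (Ioi 0) := by
  have hmeas : Measurable fun u : ℝ => u ^ a * macK s u :=
    (measurable_id.pow_const a).mul (measurable_macK s)
  obtain ⟨C₁, hC₁, h₁⟩ := exists_macK_le_rpow (s := s) (b := (|s| + (a + 1)) / 2)
    (by linarith [abs_nonneg s]) (by linarith)
  obtain ⟨C₂, hC₂, h₂⟩ := exists_macK_le_rpow (s := s) (b := a + 2)
    (by linarith [abs_nonneg s]) (by linarith)
  rw [← Ioc_union_Ioi_eq_Ioi (zero_le_one' ℝ)]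
  refine IntegrableOn.union ?_ ?_
  · have hg : IntegrableOn (fun u : ℝ => C₁ * u ^ (a - (|s| + (a + 1)) / 2)) (Ioc 0 1) := by
      have := (intervalIntegral.intervalIntegrable_rpow' (a := 0) (b := 1)
        (r := a - (|s| + (a + 1)) / 2) (by linarith)).1
      exact this.const_mul _
    refine Integrable.mono' hg hmeas.aestronglyMeasurable
      ((ae_restrict_mem measurableSet_Ioc).mono fun u hu => ?_)
    have hu0 : 0 < u := hu.1
    rw [Real.norm_of_nonneg (mul_nonneg (by positivity) (macK_nonneg _ _)), sub_eq_add_neg,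
      Real.rpow_add hu0]
    have := h₁ u hu0
    calc _ ≤ u ^ a * (C₁ * u ^ (-((|s| + (a + 1)) / 2))) := by gcongr
      _ = _ := by ring
  · have hg : IntegrableOn (fun u : ℝ => C₂ * u ^ (-2 : ℝ)) (Ioi 1) :=
      (integrableOn_Ioi_rpow_of_lt (by norm_num) one_pos).const_mul _
    refine Integrable.mono' hg hmeas.aestronglyMeasurable
      ((ae_restrict_mem measurableSet_Ioi).mono fun u hu => ?_)
    have hu0 : 0 < u := one_pos.trans hu
    rw [Real.norm_of_nonneg (mul_nonneg (by positivity) (macK_nonneg _ _)),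
      show (-2 : ℝ) = a + -(a + 2) by ring, Real.rpow_add hu0]
    have := h₂ u hu0
    calc _ ≤ u ^ a * (C₂ * u ^ (-(a + 2))) := by gcongr
      _ = _ := by ring

theorem integrableOn_rpow_mul_macK_comp_mul {a s x : ℝ} (h : |s| < a + 1) (hx : 0 < x) :
    IntegrableOn (fun u : ℝ => u ^ a * macK s (x * u)) (Ioi 0) := by
  have h1 := (integrableOn_Ioi_comp_mul_left_iff (fun u : ℝ => u ^ a * macK s u) 0 hx).2
    (by rw [mul_zero]; exact integrableOn_rpow_mul_macK h)
  refine IntegrableOn.congr_fun (h1.const_mul (x ^ (-a))) (fun u hu => ?_) measurableSet_Ioi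
  have hu0 : (0 : ℝ) < u := hu
  rw [Real.mul_rpow hx.le hu0.le, Real.rpow_neg hx.le]
  have : x ^ a ≠ 0 := by positivity
  field_simp

theorem integral_rpow_mul_macK_comp_mul {a s x : ℝ} (hx : 0 < x) :
    ∫ u in Ioi (0 : ℝ), u ^ a * macK s (x * u) =
      x ^ (-a - 1) * ∫ u in Ioi (0 : ℝ), u ^ a * macK s u := by
  have h1 := integral_comp_mul_left_Ioi (fun u : ℝ => u ^ a * macK s u) 0 hx
  rw [mul_zero] at h1
  have h2 : ∫ u in Ioi (0 : ℝ), u ^ a * macK s (x * u) =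
      x ^ (-a) * ∫ u in Ioi (0 : ℝ), (x * u) ^ a * macK s (x * u) := by
    rw [← integral_const_mul]
    refine setIntegral_congr_fun measurableSet_Ioi fun u hu => ?_
    have hu0 : (0 : ℝ) < u := hu
    rw [Real.mul_rpow hx.le hu0.le, Real.rpow_neg hx.le]
    have : x ^ a ≠ 0 := by positivity
    field_simp
  rw [h2, h1, smul_eq_mul, ← mul_assoc, Real.rpow_sub_one hx.ne', div_eq_mul_inv]

/-! ### The Macdonald function near the origin -/

open Filter Topology

/-- The integral over `(0, ∞)` of the derivative of `exp(-z cosh t) sinh(νt)` vanishes. -/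
theorem besselK_recurrence (ν : ℂ) {z : ℝ} (hz : 0 < z) :
    (z : ℂ) * (besselK (ν + 1) z - besselK (ν - 1) z) = 2 * ν * besselK ν z := by
  set F : ℝ → ℂ := fun t => (Real.exp (-(z * Real.cosh t)) : ℂ) * Complex.sinh (ν * t) with hF
  set G : ℂ → ℝ → ℂ := fun μ t =>
    (Real.exp (-(z * Real.cosh t)) : ℂ) * Complex.cosh (μ * t) with hG
  have hGint : ∀ μ, IntegrableOn (G μ) (Ioi 0) := fun μ => integrableOn_besselK μ hz
  have hderiv : ∀ t : ℝ, HasDerivAt F (ν * G ν t - z / 2 * (G (ν + 1) t - G (ν - 1) t)) t := by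
    intro t
    have h1 : HasDerivAt (fun t : ℝ => (Real.exp (-(z * Real.cosh t)) : ℂ))
        ((Real.exp (-(z * Real.cosh t)) * -(z * Real.sinh t) : ℝ) : ℂ) t :=
      (((Real.hasDerivAt_cosh t).const_mul z).neg.exp).ofReal_comp
    have h2 : HasDerivAt (fun t : ℝ => Complex.sinh (ν * t)) (Complex.cosh (ν * t) * ν) t := by
      have h3 : HasDerivAt (fun t : ℂ => ν * t) ν (t : ℂ) := by
        simpa using (hasDerivAt_id (t : ℂ)).const_mul ν
      exact (((Complex.hasDerivAt_sinh (ν * t)).comp (t : ℂ) h3)).comp_ofReal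
    refine (h1.mul h2).congr_deriv ?_
    simp only [hG]
    rw [add_mul, sub_mul, one_mul, Complex.cosh_add, Complex.cosh_sub]
    push_cast
    ring
  have hFint : IntegrableOn F (Ioi 0) := by
    have h1 := ((integrable_cexp_mul_exp_neg_cosh (-ν) hz).sub
      (integrable_cexp_mul_exp_neg_cosh ν hz)).const_mul (1 / 2)
    refine (h1.congr (.of_forall fun σ => ?_)).integrableOn
    simp only [hF, Complex.sinh, Pi.sub_apply]
    ring_nf
  have hdiff : IntegrableOn (fun t => z / 2 * (G (ν + 1) t - G (ν - 1) t)) (Ioi 0) :=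
    ((hGint (ν + 1)).sub (hGint (ν - 1))).const_mul (z / 2 : ℂ)
  have hF'int : IntegrableOn (fun t => ν * G ν t - z / 2 * (G (ν + 1) t - G (ν - 1) t)) (Ioi 0) :=
    ((hGint ν).const_mul ν).sub hdiff
  have hlim := tendsto_zero_of_hasDerivAt_of_integrableOn_Ioi (fun t _ => hderiv t) hF'int hFint
  have h := integral_Ioi_of_hasDerivAt_of_tendsto (hderiv 0).continuousAt.continuousWithinAt
    (fun t _ => hderiv t) hF'int hlim
  rw [integral_sub ((hGint ν).const_mul ν) hdiff, integral_const_mul, integral_const_mul,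
    integral_sub (hGint (ν + 1)) (hGint (ν - 1))] at h
  have hF0 : F 0 = 0 := by simp [hF]
  rw [hF0, sub_zero] at h
  have e : ∀ μ, ∫ t in Ioi (0 : ℝ), G μ t = besselK μ z := fun μ => rfl
  rw [e, e, e] at h
  linear_combination (-2) * h

/-- The behaviour `K_ν(z) ~ ½ Γ(ν) (z/2)^(-ν)` at the origin for `Re ν > 0`. -/
theorem tendsto_cpow_mul_besselK {ν : ℂ} (hν : 0 < ν.re) :
    Tendsto (fun z : ℝ => ((z : ℂ) / 2) ^ ν * besselK ν z) (𝓝[>] 0)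
      (𝓝 (1 / 2 * Complex.Gamma ν)) := by
  have h1 : ∀ z ∈ Ioi (0 : ℝ), 1 / 2 * ∫ t in Ioi (0 : ℝ), macdonaldIntegrand (-ν) z t =
      ((z : ℂ) / 2) ^ ν * besselK ν z := by
    intro z hz
    have hz0 : (0 : ℝ) < z := hz
    have hzc : ((z : ℂ) / 2) ≠ 0 := by exact_mod_cast (half_pos hz0).ne'
    rw [← besselK_neg, besselK_eq_truncK _ hz0, truncK, ← mul_assoc, mul_left_comm,
      ← Complex.cpow_add _ _ hzc, add_neg_cancel, Complex.cpow_zero, mul_one]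
  refine Tendsto.congr' (eventually_nhdsWithin_of_forall h1) (Tendsto.const_mul _ ?_)
  rw [Complex.Gamma_eq_integral hν, Complex.GammaIntegral]
  refine tendsto_integral_filter_of_dominated_convergence
    (fun t => Real.exp (-t) * t ^ (ν.re - 1)) ?_ ?_ (Real.GammaIntegral_convergent hν) ?_
  · exact .of_forall fun z =>
      (continuousOn_macdonaldIntegrand (-ν) z).aestronglyMeasurable measurableSet_Ioi
  · refine .of_forall fun z => (ae_restrict_mem measurableSet_Ioi).mono fun t ht => ?_
    have ht0 : (0 : ℝ) < t := ht
    rw [norm_macdonaldIntegrand _ z ht0, Complex.neg_re, neg_neg, mul_comm]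
    gcongr
    have : 0 ≤ z ^ 2 / (4 * t) := by positivity
    linarith
  · refine (ae_restrict_mem measurableSet_Ioi).mono fun t ht => ?_
    have hc : Continuous fun z : ℝ => macdonaldIntegrand (-ν) z t := by
      unfold macdonaldIntegrand
      refine continuous_const.mul (Complex.continuous_ofReal.comp ?_)
      fun_prop
    have := (hc.tendsto 0).mono_left (nhdsWithin_le_nhds (s := Ioi 0))
    convert this using 2
    simp [macdonaldIntegrand, mul_comm]

theorem exists_rpow_le_norm_besselK_of_re_pos {ν : ℂ} (hν : 0 < ν.re) :
    ∃ c δ : ℝ, 0 < c ∧ 0 < δ ∧ ∀ z : ℝ, 0 < z → z < δ → c * z ^ (-ν.re) ≤ ‖besselK ν z‖ := by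
  have h := (tendsto_cpow_mul_besselK hν).norm
  have hL : 0 < ‖1 / 2 * Complex.Gamma ν‖ := by
    rw [norm_pos_iff]
    exact mul_ne_zero (by norm_num) (Complex.Gamma_ne_zero_of_re_pos hν)
  set L := ‖1 / 2 * Complex.Gamma ν‖
  obtain ⟨δ, hδ, hδ'⟩ := mem_nhdsGT_iff_exists_Ioo_subset.1
    (h.eventually (lt_mem_nhds (half_lt_self hL)))
  refine ⟨L / 2 * (1 / 2) ^ (-ν.re), δ, by positivity, hδ, fun z hz hzδ => ?_⟩
  have h1 : L / 2 < ‖((z : ℂ) / 2) ^ ν * besselK ν z‖ := hδ' ⟨hz, hzδ⟩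
  rw [norm_mul, norm_half_cpow hz] at h1
  have h2 : 0 < (z / 2) ^ ν.re := by positivity
  have h3 : (1 / 2 : ℝ) ^ (-ν.re) * z ^ (-ν.re) = ((z / 2) ^ ν.re)⁻¹ := by
    rw [← Real.mul_rpow (by norm_num) hz.le, ← Real.rpow_neg (by positivity)]; ring_nf
  rw [mul_assoc, h3, ← div_eq_mul_inv, div_le_iff₀ h2]
  linarith

theorem exists_rpow_le_norm_besselK {ν : ℂ} (hν : ν.re ≠ 0) :
    ∃ c δ : ℝ, 0 < c ∧ 0 < δ ∧ ∀ z : ℝ, 0 < z → z < δ → c * z ^ (-|ν.re|) ≤ ‖besselK ν z‖ := by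
  rcases lt_or_gt_of_ne hν with h | h
  · obtain ⟨c, δ, hc, hδ, h1⟩ := exists_rpow_le_norm_besselK_of_re_pos (ν := -ν) (by simpa using h)
    refine ⟨c, δ, hc, hδ, fun z hz hz' => ?_⟩
    have := h1 z hz hz'
    rwa [besselK_neg, Complex.neg_re, ← abs_of_neg h] at this
  · rw [abs_of_pos h]
    exact exists_rpow_le_norm_besselK_of_re_pos h

/-- For imaginary `ν ≠ 0` the function `K_ν` stays bounded (and oscillates) at the origin. -/
theorem exists_norm_besselK_le_of_re_eq_zero {ν : ℂ} (h0 : ν ≠ 0) (hν : ν.re = 0) :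
    ∃ C : ℝ, 0 < C ∧ ∀ z : ℝ, 0 < z → ‖besselK ν z‖ ≤ C := by
  have hn : 0 < ‖ν‖ := norm_pos_iff.2 h0
  -- the recurrence trades `K_ν` for `K_{ν±1}`, whose moduli are at most `K_1(z) ≤ 1/z`
  refine ⟨1 / ‖ν‖, by positivity, fun z hz => ?_⟩
  have h := congrArg norm (besselK_recurrence ν hz)
  rw [norm_mul, norm_mul, norm_mul, Complex.norm_real, Real.norm_of_nonneg hz.le,
    Complex.norm_two] at h
  have hb : macK 1 z ≤ 1 / z := by
    have := macK_le_rpow one_pos hz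
    rw [Real.Gamma_one, Real.rpow_neg_one] at this
    refine this.trans (le_of_eq ?_)
    field_simp
  have h1 : ‖besselK (ν + 1) z‖ ≤ 1 / z := (norm_besselK_le _ hz).trans (by simpa [hν] using hb)
  have h2 : ‖besselK (ν - 1) z‖ ≤ 1 / z := by
    refine (norm_besselK_le _ hz).trans ?_
    simp only [Complex.sub_re, hν, Complex.one_re, zero_sub, macK_neg]
    exact hb
  have h3 := norm_sub_le (besselK (ν + 1) z) (besselK (ν - 1) z)
  rw [le_div_iff₀ hn]
  have h4 : z * ‖besselK (ν + 1) z - besselK (ν - 1) z‖ ≤ z * (1 / z + 1 / z) := by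
    gcongr; linarith
  have h5 : z * (1 / z + 1 / z) = 2 := by field_simp; norm_num
  linarith

theorem exists_norm_besselK_le_rpow {ν : ℂ} (h0 : ν ≠ 0) :
    ∃ C : ℝ, 0 < C ∧ ∀ z : ℝ, 0 < z → ‖besselK ν z‖ ≤ C * z ^ (-|ν.re|) := by
  by_cases hν : ν.re = 0
  · simpa [hν] using exists_norm_besselK_le_of_re_eq_zero h0 hν
  · obtain ⟨C, hC, h⟩ := exists_macK_le_rpow (s := ν.re) (abs_pos.2 hν) le_rfl
    exact ⟨C, hC, fun z hz => (norm_besselK_le ν hz).trans (h z hz)⟩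

/-- For imaginary `ν ≠ 0` the zeros of `K_ν` accumulate at the origin, but `K_ν(z)` and `K_ν(ρz)`
are not both small when `ρ^(2ν) ≠ 1`: near the origin `K_ν` is a combination of `z^ν` and `z^(-ν)`,
and the two dilates determine its coefficients. -/
theorem exists_le_norm_besselK_add {ν : ℂ} (h0 : ν ≠ 0) (hν : ν.re = 0) {ρ : ℝ} (hρ : 0 < ρ)
    (hne : (ρ : ℂ) ^ ν ≠ (ρ : ℂ) ^ (-ν)) :
    ∃ c δ : ℝ, 0 < c ∧ 0 < δ ∧ ∀ z : ℝ, 0 < z → z < δ →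
      c ≤ ‖besselK ν z‖ + ‖besselK ν (ρ * z)‖ := by
  have hn : 0 < ‖ν‖ := norm_pos_iff.2 h0
  set P : ℝ → ℂ := fun z => ((z : ℂ) / 2) ^ (1 + ν) * besselK (1 + ν) z with hP
  set M : ℝ → ℂ := fun z => ((z : ℂ) / 2) ^ (1 - ν) * besselK (1 - ν) z with hM
  have hPt : Tendsto P (𝓝[>] 0) (𝓝 (1 / 2 * Complex.Gamma (1 + ν))) :=
    tendsto_cpow_mul_besselK (by simp [hν])
  have hMt : Tendsto M (𝓝[>] 0) (𝓝 (1 / 2 * Complex.Gamma (1 - ν))) :=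
    tendsto_cpow_mul_besselK (by simp [hν])
  have hρt : Tendsto (fun z : ℝ => ρ * z) (𝓝[>] 0) (𝓝[>] 0) := by
    refine tendsto_nhdsWithin_iff.2 ⟨?_, eventually_nhdsWithin_of_forall fun z hz =>
      mul_pos hρ hz⟩
    have : Tendsto (fun z : ℝ => ρ * z) (𝓝 0) (𝓝 (ρ * 0)) := (continuous_const_mul ρ).tendsto 0
    rw [mul_zero] at this
    exact this.mono_left nhdsWithin_le_nhds
  -- the recurrence again: `P` and `M` converge at `0`, so this is the asymptotic form of `K_ν`
  have hK : ∀ z : ℝ, 0 < z → besselK ν z =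
      1 / ν * ((((z : ℂ) / 2) ^ ν)⁻¹ * P z - ((z : ℂ) / 2) ^ ν * M z) := by
    intro z hz
    have hzc : ((z : ℂ) / 2) ≠ 0 := by exact_mod_cast (half_pos hz).ne'
    have hr := besselK_recurrence ν hz
    have e1 : besselK (ν - 1) z = besselK (1 - ν) z := by rw [← besselK_neg, neg_sub]
    rw [e1, add_comm ν 1] at hr
    simp only [hP, hM]
    rw [Complex.cpow_add _ _ hzc, Complex.cpow_sub _ _ hzc, Complex.cpow_one]
    have hzν : ((z : ℂ) / 2) ^ ν ≠ 0 := by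
      rw [Complex.cpow_ne_zero_iff]; exact Or.inl hzc
    generalize ((z : ℂ) / 2) ^ ν = ζ at hzν ⊢
    field_simp
    linear_combination (-1 : ℂ) * hr
  -- `ρ^ν K_ν(z) - K_ν(ρz)` cancels the `z^ν` component in the limit; `H` bounds it from below
  set H : ℝ → ℝ := fun z => 1 / ‖ν‖ * (‖(ρ : ℂ) ^ ν * P z - (ρ : ℂ) ^ (-ν) * P (ρ * z)‖ -
    ‖M z - M (ρ * z)‖) with hH
  have hHt : Tendsto H (𝓝[>] 0) (𝓝 (1 / ‖ν‖ * (‖(ρ : ℂ) ^ ν * (1 / 2 * Complex.Gamma (1 + ν)) -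
      (ρ : ℂ) ^ (-ν) * (1 / 2 * Complex.Gamma (1 + ν))‖ -
      ‖1 / 2 * Complex.Gamma (1 - ν) - 1 / 2 * Complex.Gamma (1 - ν)‖))) :=
    ((((hPt.const_mul _).sub ((hPt.comp hρt).const_mul _)).norm.sub
      (hMt.sub (hMt.comp hρt)).norm).const_mul _)
  rw [sub_self, norm_zero, sub_zero, ← sub_mul] at hHt
  set L := 1 / ‖ν‖ * ‖((ρ : ℂ) ^ ν - (ρ : ℂ) ^ (-ν)) * (1 / 2 * Complex.Gamma (1 + ν))‖ with hL
  have hL0 : 0 < L := by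
    refine mul_pos (by positivity) (norm_pos_iff.2 (mul_ne_zero (sub_ne_zero.2 hne)
      (mul_ne_zero (by norm_num) (Complex.Gamma_ne_zero_of_re_pos (by simp [hν])))))
  obtain ⟨δ, hδ, hδ'⟩ := mem_nhdsGT_iff_exists_Ioo_subset.1
    (hHt.eventually (lt_mem_nhds (half_lt_self hL0)))
  refine ⟨L / 2, δ, by positivity, hδ, fun z hz hzδ => ?_⟩
  have h1 : L / 2 < H z := hδ' ⟨hz, hzδ⟩
  refine h1.le.trans ?_
  have hρz : 0 < ρ * z := mul_pos hρ hz
  have hnρ : ‖(ρ : ℂ) ^ ν‖ = 1 := by rw [norm_cpow_real hρ, hν, Real.rpow_zero]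
  have hnz : ‖((z : ℂ) / 2) ^ ν‖ = 1 := by rw [norm_half_cpow hz, hν, Real.rpow_zero]
  have hzc : ((z : ℂ) / 2) ≠ 0 := by exact_mod_cast (half_pos hz).ne'
  have hρc : (ρ : ℂ) ≠ 0 := by exact_mod_cast hρ.ne'
  have hzν : ((z : ℂ) / 2) ^ ν ≠ 0 := by
    rw [Complex.cpow_ne_zero_iff]; exact Or.inl hzc
  have hρν : (ρ : ℂ) ^ ν ≠ 0 := by
    rw [Complex.cpow_ne_zero_iff]; exact Or.inl hρc
  have e1 : (((ρ * z : ℝ) : ℂ) / 2) ^ ν = (ρ : ℂ) ^ ν * ((z : ℂ) / 2) ^ ν := by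
    rw [show ((ρ * z : ℝ) : ℂ) / 2 = (ρ : ℂ) * ((z / 2 : ℝ) : ℂ) by push_cast; ring,
      Complex.mul_cpow_ofReal_nonneg hρ.le (by positivity)]
    push_cast; rfl
  have e2 : (ρ : ℂ) ^ ν * besselK ν z - besselK ν (ρ * z) = 1 / ν *
      ((((z : ℂ) / 2) ^ ν)⁻¹ * ((ρ : ℂ) ^ ν * P z - (ρ : ℂ) ^ (-ν) * P (ρ * z)) -
        (ρ : ℂ) ^ ν * ((z : ℂ) / 2) ^ ν * (M z - M (ρ * z))) := by
    rw [hK z hz, hK _ hρz, e1, Complex.cpow_neg]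
    field_simp
    ring
  have h2 : H z ≤ ‖(ρ : ℂ) ^ ν * besselK ν z - besselK ν (ρ * z)‖ := by
    rw [e2, norm_mul, norm_div, norm_one]
    simp only [hH]
    gcongr
    refine le_trans (le_of_eq ?_) (norm_sub_norm_le _ _)
    rw [norm_mul, norm_mul, norm_mul, norm_inv, hnz, hnρ]
    simp
  refine h2.trans ((norm_sub_le _ _).trans ?_)
  rw [norm_mul, hnρ, one_mul]

/-- `K_0` changes by at most a logarithm under dilation: with `l = exp(-a)`, the integrand is at most
`1` on `[0, a]`, and on `[a, ∞)` it is compared with the one for `z` shifted by `a`. -/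
theorem macK_zero_mul_le {z l : ℝ} (hz : 0 < z) (hl : 0 < l) (hl1 : l ≤ 1) :
    macK 0 (l * z) ≤ -Real.log l + Real.exp (z / 2) * macK 0 z := by
  set a := -Real.log l with ha
  have ha0 : 0 ≤ a := by have := Real.log_nonpos hl.le hl1; linarith
  have hla : l = Real.exp (-a) := by rw [ha, neg_neg, Real.exp_log hl]
  have e : ∀ z, macK 0 z = ∫ t in Ioi (0 : ℝ), Real.exp (-(z * Real.cosh t)) := by
    intro z; simp [macK]
  have hint : ∀ z : ℝ, 0 < z → IntegrableOn (fun t : ℝ => Real.exp (-(z * Real.cosh t))) (Ioi 0) := by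
    intro z hz; simpa using integrableOn_macK 0 hz
  have hlz : 0 < l * z := mul_pos hl hz
  rw [e, e, ← Ioc_union_Ioi_eq_Ioi ha0, setIntegral_union (Ioc_disjoint_Ioi le_rfl)
    measurableSet_Ioi ((hint _ hlz).mono_set Ioc_subset_Ioi_self)
    ((hint _ hlz).mono_set (Ioi_subset_Ioi ha0)), Ioc_union_Ioi_eq_Ioi ha0]
  refine add_le_add ?_ ?_
  · calc _ ≤ ∫ _ in Ioc (0 : ℝ) a, (1 : ℝ) := by
          refine setIntegral_mono_on ((hint _ hlz).mono_set Ioc_subset_Ioi_self)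
            (integrable_const _) measurableSet_Ioc fun t _ => ?_
          rw [Real.exp_le_one_iff]
          have := mul_nonneg hlz.le (Real.cosh_pos t).le
          linarith
      _ = a := by simp [ha0]
  · have hmp := measurePreserving_add_right volume a
    have hemb := measurableEmbedding_addRight a
    have hpre : (fun t => t + a) ⁻¹' Ioi a = Ioi (0 : ℝ) := by ext t; simp
    have hshift := hmp.setIntegral_preimage_emb hemb
      (fun t => Real.exp (-(l * z * Real.cosh t))) (Ioi a)
    have hsint := (hmp.integrableOn_comp_preimage hemb).2 ((hint _ hlz).mono_set (Ioi_subset_Ioi ha0))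
    rw [hpre] at hshift hsint
    rw [← hshift, ← integral_const_mul]
    refine setIntegral_mono_on hsint ((hint _ hz).const_mul _) measurableSet_Ioi fun t ht => ?_
    have ht0 : (0 : ℝ) < t := ht
    rw [← Real.exp_add, Real.exp_le_exp]
    have h1 : Real.cosh t - 1 / 2 ≤ l * Real.cosh (t + a) := by
      rw [Real.cosh_eq, Real.cosh_eq, hla, Real.exp_add]
      have h2 : Real.exp (-t) ≤ 1 := by rw [Real.exp_le_one_iff]; linarith
      have h3 : Real.exp (-a) * Real.exp a = 1 := by rw [← Real.exp_add]; simp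
      have h4 : 0 < Real.exp (-a) * Real.exp (-(t + a)) := by positivity
      calc (Real.exp t + Real.exp (-t)) / 2 - 1 / 2 ≤ Real.exp t / 2 := by linarith
        _ = (Real.exp (-a) * Real.exp a) * Real.exp t / 2 := by rw [h3, one_mul]
        _ ≤ _ := by linarith
    have h5 := mul_le_mul_of_nonneg_left h1 hz.le
    linarith

theorem exists_mem_Ioo_of_ae {p : ℝ → Prop}
    (h : ∀ᵐ u ∂(volume.restrict (Ioi (0 : ℝ))), p u) {a b : ℝ} (ha : 0 ≤ a) (hab : a < b) :
    ∃ u ∈ Ioo a b, p u := by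
  have h1 := ae_restrict_of_ae_restrict_of_subset
    (show Ioo a b ⊆ Ioi (0 : ℝ) from fun x hx => lt_of_le_of_lt ha hx.1) h
  have : NeBot (ae (volume.restrict (Ioo a b))) := by
    rw [ae_neBot, Ne, Measure.restrict_eq_zero]
    simp [hab]
  obtain ⟨u, hu⟩ := (h1.and (ae_restrict_mem measurableSet_Ioo)).exists
  exact ⟨u, hu.2, hu.1⟩

theorem norm_kIntegrand (ν : ℂ) (f : ℝ → ℂ) {u x : ℝ} (hx : 0 < x) :
    ‖kIntegrand ν f u x‖ = Real.sqrt x * Real.sqrt u * ‖besselK ν (x * u)‖ * ‖f x‖ := by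
  rw [kIntegrand, norm_mul, norm_mul, norm_ofReal_sqrt, Real.sqrt_mul hx.le]

/-- The existence of the `K`-transform controls `f` near the origin with the weight
`√x x^(-|Re ν|)`, despite the zeros that `K_ν` may have there. -/
theorem exists_integrableOn_of_kExists {ν : ℂ} (h0 : ν ≠ 0) {f : ℝ → ℂ}
    (hf : AEStronglyMeasurable f (volume.restrict (Ioi 0)))
    (h : ∀ᵐ u ∂(volume.restrict (Ioi (0 : ℝ))), KExists ν f u) :
    ∃ δ : ℝ, 0 < δ ∧ δ ≤ 1 ∧
      IntegrableOn (fun x => Real.sqrt x * x ^ (-|ν.re|) * ‖f x‖) (Ioo 0 δ) := by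
  have hmeas : ∀ δ : ℝ, AEStronglyMeasurable (fun x => Real.sqrt x * x ^ (-|ν.re|) * ‖f x‖)
      (volume.restrict (Ioo 0 δ)) := by
    intro δ
    refine AEStronglyMeasurable.mul (Measurable.aestronglyMeasurable (by fun_prop)) ?_
    exact (hf.mono_measure (Measure.restrict_mono Ioo_subset_Ioi_self le_rfl)).norm
  by_cases hν : ν.re = 0
  · have him : 0 < |ν.im| := by
      rw [abs_pos]; intro him; exact h0 (Complex.ext hν him)
    obtain ⟨u, hu, hKu⟩ := exists_mem_Ioo_of_ae h le_rfl one_pos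
    have hu0 : 0 < u := hu.1
    -- `0 < 2 |Im ν| log (v/u) < 2π`, so that `(v/u)^(2ν) ≠ 1`
    obtain ⟨v, hv, hKv⟩ := exists_mem_Ioo_of_ae h hu0.le
      (show u < u * Real.exp (Real.pi / |ν.im|) from
        lt_mul_of_one_lt_right hu0 (Real.one_lt_exp_iff.2 (by positivity)))
    have hv0 : 0 < v := hu0.trans hv.1
    have hρ : 0 < v / u := by positivity
    have hlog0 : 0 < Real.log (v / u) := Real.log_pos ((one_lt_div hu0).2 hv.1)
    have hlog1 : Real.log (v / u) * |ν.im| < Real.pi := by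
      rw [← lt_div_iff₀ him, Real.log_lt_iff_lt_exp hρ, div_lt_iff₀ hu0, mul_comm]
      exact hv.2
    have hne : ((v / u : ℝ) : ℂ) ^ ν ≠ ((v / u : ℝ) : ℂ) ^ (-ν) := by
      have hc : ((v / u : ℝ) : ℂ) ≠ 0 := by exact_mod_cast hρ.ne'
      rw [Complex.cpow_def_of_ne_zero hc, Complex.cpow_def_of_ne_zero hc, Ne,
        Complex.exp_eq_exp_iff_exists_int]
      rintro ⟨n, hn⟩
      rw [← Complex.ofReal_log hρ.le] at hn
      have h1 := congrArg Complex.im hn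
      simp at h1
      have h2 : Real.log (v / u) * ν.im = n * Real.pi := by linarith
      have h3 : Real.log (v / u) * |ν.im| = |(n : ℝ)| * Real.pi := by
        have := congrArg abs h2
        rwa [abs_mul, abs_mul, abs_of_pos hlog0, abs_of_pos Real.pi_pos] at this
      rw [h3] at hlog1
      have h4 : |(n : ℝ)| < 1 := by nlinarith [Real.pi_pos]
      have h5 : n = 0 := by
        have : |n| < 1 := by exact_mod_cast h4
        simpa using this
      rw [h5] at h3
      have : 0 < Real.log (v / u) * |ν.im| := by positivity
      simp only [Int.cast_zero, abs_zero, zero_mul] at h3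
      linarith
    obtain ⟨c, δ, hc, hδ, hlow⟩ := exists_le_norm_besselK_add h0 hν hρ hne
    refine ⟨min 1 (δ / u), by positivity, min_le_left _ _, ?_⟩
    have hdom : IntegrableOn (fun x => c⁻¹ * ((Real.sqrt u)⁻¹ * ‖kIntegrand ν f u x‖ +
        (Real.sqrt v)⁻¹ * ‖kIntegrand ν f v x‖)) (Ioi 0) :=
      ((hKu.norm.const_mul _).add (hKv.norm.const_mul _)).const_mul _
    refine Integrable.mono' (hdom.mono_set Ioo_subset_Ioi_self) (hmeas _)
      ((ae_restrict_mem measurableSet_Ioo).mono fun x hx => ?_)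
    have hx0 : 0 < x := hx.1
    have h1 := hlow (x * u) (by positivity) (by
      have := hx.2.trans_le (min_le_right _ _)
      rwa [lt_div_iff₀ hu0] at this)
    have e1 : v / u * (x * u) = x * v := by field_simp
    rw [e1] at h1
    rw [norm_kIntegrand _ _ hx0, norm_kIntegrand _ _ hx0, hν, abs_zero, neg_zero, Real.rpow_zero,
      mul_one, Real.norm_of_nonneg (by positivity)]
    have hsu : 0 < Real.sqrt u := Real.sqrt_pos.2 hu0
    have hsv : 0 < Real.sqrt v := Real.sqrt_pos.2 hv0
    have e2 : c⁻¹ * ((Real.sqrt u)⁻¹ * (Real.sqrt x * Real.sqrt u * ‖besselK ν (x * u)‖ * ‖f x‖) +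
        (Real.sqrt v)⁻¹ * (Real.sqrt x * Real.sqrt v * ‖besselK ν (x * v)‖ * ‖f x‖)) =
        c⁻¹ * (‖besselK ν (x * u)‖ + ‖besselK ν (x * v)‖) * (Real.sqrt x * ‖f x‖) := by
      field_simp
    rw [e2]
    refine le_mul_of_one_le_left (by positivity) ?_
    rw [inv_mul_eq_div, one_le_div hc]
    exact h1
  · obtain ⟨u, hu, hKu⟩ := exists_mem_Ioo_of_ae h le_rfl one_pos
    have hu0 : 0 < u := hu.1
    obtain ⟨c, δ, hc, hδ, hlow⟩ := exists_rpow_le_norm_besselK hν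
    refine ⟨min 1 (δ / u), by positivity, min_le_left _ _, ?_⟩
    have hsu : 0 < Real.sqrt u := Real.sqrt_pos.2 hu0
    have hru : 0 < u ^ (-|ν.re|) := by positivity
    have hdom : IntegrableOn (fun x => (c * Real.sqrt u * u ^ (-|ν.re|))⁻¹ *
        ‖kIntegrand ν f u x‖) (Ioi 0) := hKu.norm.const_mul _
    refine Integrable.mono' (hdom.mono_set Ioo_subset_Ioi_self) (hmeas _)
      ((ae_restrict_mem measurableSet_Ioo).mono fun x hx => ?_)
    have hx0 : 0 < x := hx.1
    have h1 := hlow (x * u) (by positivity) (by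
      have := hx.2.trans_le (min_le_right _ _)
      rwa [lt_div_iff₀ hu0] at this)
    rw [Real.mul_rpow hx0.le hu0.le] at h1
    rw [norm_kIntegrand _ _ hx0, Real.norm_of_nonneg (by positivity), inv_mul_eq_div,
      le_div_iff₀ (by positivity)]
    calc _ = Real.sqrt x * Real.sqrt u * (c * (x ^ (-|ν.re|) * u ^ (-|ν.re|))) * ‖f x‖ := by ring
      _ ≤ _ := by gcongr

/-! ### The regularised kernel -/

/-- The integrand in `t` of the kernel `(ab)^(-ν) ∫ u J_ν(ub) K_ν(ua) exp(-εu²) du`. -/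
noncomputable def kernelIntegrand (ν : ℂ) (a b ε t : ℝ) : ℂ :=
  (Real.exp (-(t + b ^ 2 * t / (a ^ 2 + 4 * ε * t))) : ℂ) *
    ((a ^ 2 + 4 * ε * t : ℝ) : ℂ) ^ (-ν - 1)

theorem integrableOn_mul_besselJ_mul_macK {ν : ℂ} (hν : -1 < ν.re) {a b : ℝ} (ha : 0 < a)
    (hb : 0 < b) :
    IntegrableOn (fun u : ℝ => u * ‖besselJ ν (u * b)‖ * macK ν.re (u * a)) (Ioi 0) := by
  obtain ⟨C, hC, hJ⟩ := exists_norm_besselJ_le hν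
  have habs : |ν.re| < ν.re + 2 := abs_lt.2 ⟨by linarith, by linarith⟩
  have h1 := integrableOn_rpow_mul_macK_comp_mul (a := ν.re + 1) (s := ν.re) (by linarith) ha
  have h2 := integrableOn_rpow_mul_macK_comp_mul (a := ν.re + 2) (s := ν.re) (by linarith) ha
  have hg : IntegrableOn (fun u : ℝ => C * b ^ ν.re * (u ^ (ν.re + 1) * macK ν.re (a * u) +
      b * (u ^ (ν.re + 2) * macK ν.re (a * u)))) (Ioi 0) :=
    (h1.add (h2.const_mul b)).const_mul _
  refine Integrable.mono' hg ?_ ((ae_restrict_mem measurableSet_Ioi).mono fun u hu => ?_)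
  · refine Measurable.aestronglyMeasurable ?_
    exact (measurable_id.mul ((measurable_besselJ hν).comp (measurable_id.mul_const b)).norm).mul
      ((measurable_macK _).comp (measurable_id.mul_const a))
  · have hu0 : (0 : ℝ) < u := hu
    have hK := macK_nonneg ν.re (u * a)
    rw [Real.norm_of_nonneg (by positivity)]
    have := hJ (u * b) (by positivity)
    calc u * ‖besselJ ν (u * b)‖ * macK ν.re (u * a)
        ≤ u * (C * ((u * b) ^ ν.re * (1 + u * b))) * macK ν.re (u * a) := by gcongr
      _ = _ := by
        rw [Real.mul_rpow hu0.le hb.le, Real.rpow_add hu0, Real.rpow_add hu0, Real.rpow_one,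
          Real.rpow_two, mul_comm a u]
        ring

theorem integrable_prod_kernel {ν : ℂ} (hν : -1 < ν.re) {a b ε η : ℝ} (ha : 0 < a)
    (hb : 0 < b) (hε : 0 ≤ ε) (hη : 0 ≤ η) :
    Integrable (fun p : ℝ × ℝ => (p.1 : ℂ) * besselJ ν (p.1 * b) *
      (1 / 2 * (((p.1 * a : ℝ) : ℂ) / 2) ^ ν * macdonaldIntegrand ν (p.1 * a) p.2) *
      (Real.exp (-(ε * p.1 ^ 2)) : ℂ))
      ((volume.restrict (Ioi 0)).prod (volume.restrict (Ioi η))) := by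
  have hJm := measurable_besselJ hν
  have hmeas : Measurable (fun p : ℝ × ℝ => (p.1 : ℂ) * besselJ ν (p.1 * b) *
      (1 / 2 * (((p.1 * a : ℝ) : ℂ) / 2) ^ ν * macdonaldIntegrand ν (p.1 * a) p.2) *
      (Real.exp (-(ε * p.1 ^ 2)) : ℂ)) := by
    have h1 : Measurable fun p : ℝ × ℝ => besselJ ν (p.1 * b) :=
      hJm.comp (measurable_fst.mul_const b)
    have h2 : Measurable fun p : ℝ × ℝ => (((p.1 * a : ℝ) : ℂ) / 2) ^ ν :=
      ((Complex.measurable_ofReal.comp (measurable_fst.mul_const a)).div_const 2).pow_const ν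
    have h3 : Measurable fun p : ℝ × ℝ => macdonaldIntegrand ν (p.1 * a) p.2 :=
      (measurable_uncurry_macdonaldIntegrand ν).comp
        ((measurable_fst.mul_const a).prodMk measurable_snd)
    have h4 : Measurable fun p : ℝ × ℝ => (Real.exp (-(ε * p.1 ^ 2)) : ℂ) :=
      Complex.measurable_ofReal.comp (by fun_prop)
    exact (((Complex.measurable_ofReal.comp measurable_fst).mul h1).mul
      ((h2.const_mul _).mul h3)).mul h4
  refine (integrable_prod_iff hmeas.aestronglyMeasurable).2 ⟨?_, ?_⟩
  · refine (ae_restrict_mem measurableSet_Ioi).mono fun u hu => ?_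
    have hu0 : (0 : ℝ) < u := hu
    have h : Integrable (macdonaldIntegrand ν (u * a)) (volume.restrict (Ioi η)) :=
      (integrableOn_macdonaldIntegrand ν (mul_pos hu0 ha)).mono_set (Ioi_subset_Ioi hη)
    exact ((h.const_mul (1 / 2 * (((u * a : ℝ) : ℂ) / 2) ^ ν)).const_mul
      ((u : ℂ) * besselJ ν (u * b))).mul_const (Real.exp (-(ε * u ^ 2)) : ℂ)
  · refine Integrable.mono' (integrableOn_mul_besselJ_mul_macK hν ha hb)
      hmeas.norm.stronglyMeasurable.integral_prod_right.aestronglyMeasurable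
      ((ae_restrict_mem measurableSet_Ioi).mono fun u hu => ?_)
    have hu0 : (0 : ℝ) < u := hu
    have hua : 0 < u * a := mul_pos hu0 ha
    rw [Real.norm_of_nonneg (integral_nonneg fun _ => norm_nonneg _)]
    have e : ∀ t : ℝ, ‖(u : ℂ) * besselJ ν (u * b) *
        (1 / 2 * (((u * a : ℝ) : ℂ) / 2) ^ ν * macdonaldIntegrand ν (u * a) t) *
        (Real.exp (-(ε * u ^ 2)) : ℂ)‖ = (u * ‖besselJ ν (u * b)‖ * Real.exp (-(ε * u ^ 2)) *
        (1 / 2 * (u * a / 2) ^ ν.re)) * ‖macdonaldIntegrand ν (u * a) t‖ := by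
      intro t
      rw [norm_mul, norm_mul, norm_mul, norm_mul, norm_mul, norm_half_cpow hua, Complex.norm_real,
        Complex.norm_real, Real.norm_of_nonneg hu0.le, Real.norm_of_nonneg (Real.exp_pos _).le]
      have : ‖(1 / 2 : ℂ)‖ = 1 / 2 := by norm_num
      rw [this]; ring
    simp only [e]
    rw [integral_const_mul]
    have h1 : ∫ t in Ioi η, ‖macdonaldIntegrand ν (u * a) t‖ ≤
        ∫ t in Ioi (0 : ℝ), ‖macdonaldIntegrand ν (u * a) t‖ :=
      setIntegral_mono_set (integrableOn_macdonaldIntegrand ν hua).norm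
        (.of_forall fun _ => norm_nonneg _) (Ioi_subset_Ioi hη).eventuallyLE
    have h2 : Real.exp (-(ε * u ^ 2)) ≤ 1 := by
      rw [Real.exp_le_one_iff]; have : 0 ≤ ε * u ^ 2 := by positivity
      linarith
    rw [← integral_norm_macdonaldIntegrand ν hua]
    calc _ ≤ (u * ‖besselJ ν (u * b)‖ * 1 * (1 / 2 * (u * a / 2) ^ ν.re)) *
          ∫ t in Ioi (0 : ℝ), ‖macdonaldIntegrand ν (u * a) t‖ := by gcongr
      _ = _ := by ring

/-- The kernel of the composed transforms, with a Gaussian factor in `u` and with `K_ν` cut off: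
the two devices that make the order of integration immaterial. For `ε = η = 0` it is
`(b/a)^ν / (a² + b²)`. -/
theorem integral_besselJ_mul_truncK {ν : ℂ} (hν : -1 < ν.re) {a b ε η : ℝ} (ha : 0 < a)
    (hb : 0 < b) (hε : 0 ≤ ε) (hη : 0 ≤ η) :
    ∫ u in Ioi (0 : ℝ), (u : ℂ) * besselJ ν (u * b) * truncK ν η (u * a) *
      (Real.exp (-(ε * u ^ 2)) : ℂ) =
      (a : ℂ) ^ ν * (b : ℂ) ^ ν * ∫ t in Ioi η, kernelIntegrand ν a b ε t := by
  have hswap := integral_integral_swap (f := fun u t : ℝ => (u : ℂ) * besselJ ν (u * b) *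
      (1 / 2 * (((u * a : ℝ) : ℂ) / 2) ^ ν * macdonaldIntegrand ν (u * a) t) *
      (Real.exp (-(ε * u ^ 2)) : ℂ)) (integrable_prod_kernel hν ha hb hε hη)
  have hl : ∀ u : ℝ, (u : ℂ) * besselJ ν (u * b) * truncK ν η (u * a) *
      (Real.exp (-(ε * u ^ 2)) : ℂ) = ∫ t in Ioi η, (u : ℂ) * besselJ ν (u * b) *
      (1 / 2 * (((u * a : ℝ) : ℂ) / 2) ^ ν * macdonaldIntegrand ν (u * a) t) *
      (Real.exp (-(ε * u ^ 2)) : ℂ) := by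
    intro u
    rw [integral_mul_const, integral_const_mul, integral_const_mul, truncK]
  simp only [hl]
  rw [hswap, ← integral_const_mul]
  refine setIntegral_congr_fun measurableSet_Ioi fun t ht => ?_
  have ht0 : (0 : ℝ) < t := lt_of_le_of_lt hη ht
  have hW : 0 < a ^ 2 + 4 * ε * t := by positivity
  -- the two Gaussians in `u` combine to `exp(-W u² / (4t))`, to which Weber's integral applies
  set W := a ^ 2 + 4 * ε * t with hWdef
  have hp : 0 < W / (4 * t) := by positivity
  have hweber := integral_cpow_mul_besselJ_mul_exp hν hb hp
  have e1 : ∫ u in Ioi (0 : ℝ), (u : ℂ) * besselJ ν (u * b) *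
      (1 / 2 * (((u * a : ℝ) : ℂ) / 2) ^ ν * macdonaldIntegrand ν (u * a) t) *
      (Real.exp (-(ε * u ^ 2)) : ℂ) = (1 / 2 * ((a : ℂ) / 2) ^ ν * (t : ℂ) ^ (-ν - 1) *
      (Real.exp (-t) : ℂ)) * ∫ u in Ioi (0 : ℝ), (u : ℂ) ^ (ν + 1) * besselJ ν (u * b) *
      Complex.exp (-((W / (4 * t) : ℝ) * (u : ℂ) ^ 2)) := by
    rw [← integral_const_mul]
    refine setIntegral_congr_fun measurableSet_Ioi fun u hu => ?_
    have hu0 : (0 : ℝ) < u := hu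
    have huc : (u : ℂ) ≠ 0 := by exact_mod_cast hu0.ne'
    have h1 : (((u * a : ℝ) : ℂ) / 2) ^ ν = (u : ℂ) ^ ν * ((a : ℂ) / 2) ^ ν := by
      rw [show ((u * a : ℝ) : ℂ) / 2 = (u : ℂ) * ((a / 2 : ℝ) : ℂ) by push_cast; ring,
        Complex.mul_cpow_ofReal_nonneg hu0.le (by positivity)]
      push_cast; rfl
    have h2 : Complex.exp (-((W / (4 * t) : ℝ) * (u : ℂ) ^ 2)) =
        (Real.exp (-(W / (4 * t) * u ^ 2)) : ℂ) := by push_cast; rfl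
    have h3 : Real.exp (-(t + (u * a) ^ 2 / (4 * t))) * Real.exp (-(ε * u ^ 2)) =
        Real.exp (-t) * Real.exp (-(W / (4 * t) * u ^ 2)) := by
      rw [← Real.exp_add, ← Real.exp_add]
      congr 1
      rw [hWdef]
      field_simp
      ring
    have h3' : (Real.exp (-(t + (u * a) ^ 2 / (4 * t))) : ℂ) * (Real.exp (-(ε * u ^ 2)) : ℂ) =
        (Real.exp (-t) : ℂ) * (Real.exp (-(W / (4 * t) * u ^ 2)) : ℂ) := by exact_mod_cast h3
    simp only [macdonaldIntegrand]
    rw [h1, h2, Complex.cpow_add _ _ huc, Complex.cpow_one]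
    linear_combination ((u : ℂ) * besselJ ν (u * b) * (1 / 2 * ((u : ℂ) ^ ν * ((a : ℂ) / 2) ^ ν) *
      (t : ℂ) ^ (-ν - 1))) * h3'
  rw [e1, hweber]
  have h4 : ((2 : ℂ) * ((W / (4 * t) : ℝ) : ℂ)) ^ (-ν - 1) * (t : ℂ) ^ (-ν - 1) =
      (W : ℂ) ^ (-ν - 1) * (1 / 2 : ℂ) ^ (-ν - 1) := by
    have e : (2 : ℂ) * ((W / (4 * t) : ℝ) : ℂ) = ((W / (2 * t) : ℝ) : ℂ) := by
      push_cast; ring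
    rw [e, ← Complex.mul_cpow_ofReal_nonneg (by positivity) ht0.le, ← half_cpow hW.le]
    congr 1
    have : (t : ℂ) ≠ 0 := by exact_mod_cast ht0.ne'
    push_cast; field_simp
  have h5 : (1 / 2 : ℂ) ^ ν * (1 / 2 : ℂ) ^ (-ν - 1) = 2 := by
    rw [← Complex.cpow_add _ _ (by norm_num), show ν + (-ν - 1) = -1 by ring,
      Complex.cpow_neg_one]
    norm_num
  have h6 : Complex.exp (-((b : ℂ) ^ 2 / (4 * ((W / (4 * t) : ℝ) : ℂ)))) =
      (Real.exp (-(b ^ 2 * t / W)) : ℂ) := by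
    rw [show (b : ℂ) ^ 2 / (4 * ((W / (4 * t) : ℝ) : ℂ)) = ((b ^ 2 * t / W : ℝ) : ℂ) by
      have h7 : (t : ℂ) ≠ 0 := by exact_mod_cast ht0.ne'
      have h8 : (W : ℂ) ≠ 0 := by exact_mod_cast hW.ne'
      push_cast; field_simp]
    push_cast; rfl
  rw [h6, half_cpow ha.le, kernelIntegrand, ← hWdef, neg_add, Real.exp_add, Complex.ofReal_mul]
  linear_combination (1 / 2 * (a : ℂ) ^ ν * (1 / 2 : ℂ) ^ ν * (Real.exp (-t) : ℂ) * (b : ℂ) ^ ν *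
    (Real.exp (-(b ^ 2 * t / W)) : ℂ)) * h4 + (1 / 2 * (a : ℂ) ^ ν * (Real.exp (-t) : ℂ) *
    (b : ℂ) ^ ν * (Real.exp (-(b ^ 2 * t / W)) : ℂ) * (W : ℂ) ^ (-ν - 1)) * h5

theorem norm_kernelIntegrand {ν : ℂ} {a b ε t : ℝ} (hW : 0 < a ^ 2 + 4 * ε * t) :
    ‖kernelIntegrand ν a b ε t‖ = Real.exp (-(t + b ^ 2 * t / (a ^ 2 + 4 * ε * t))) *
      (a ^ 2 + 4 * ε * t) ^ (-ν.re - 1) := by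
  rw [kernelIntegrand, norm_mul, norm_cpow_real hW, Complex.norm_real,
    Real.norm_of_nonneg (Real.exp_pos _).le]
  simp

theorem norm_kernelIntegrand_le {ν : ℂ} (hν : -1 < ν.re) {a b ε t : ℝ} (ha : 0 < a) (hε : 0 ≤ ε)
    (ht : 0 < t) :
    ‖kernelIntegrand ν a b ε t‖ ≤ Real.exp (-t) * (a ^ 2) ^ (-ν.re - 1) := by
  have hW : 0 < a ^ 2 + 4 * ε * t := by positivity
  rw [norm_kernelIntegrand hW]
  have h1 : (a ^ 2 + 4 * ε * t) ^ (-ν.re - 1) ≤ (a ^ 2) ^ (-ν.re - 1) :=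
    Real.rpow_le_rpow_of_nonpos (by positivity) (by have := mul_nonneg hε ht.le; linarith)
      (by linarith)
  have h2 : 0 ≤ b ^ 2 * t / (a ^ 2 + 4 * ε * t) := by positivity
  gcongr
  linarith

theorem measurable_kernelIntegrand (ν : ℂ) (b ε : ℝ) :
    Measurable fun p : ℝ × ℝ => kernelIntegrand ν p.1 b ε p.2 := by
  unfold kernelIntegrand
  refine Measurable.mul (Complex.measurable_ofReal.comp (by fun_prop)) ?_
  exact (Complex.measurable_ofReal.comp (by fun_prop)).pow_const _

theorem integrableOn_kernelIntegrand {ν : ℂ} (hν : -1 < ν.re) {a b ε : ℝ} (ha : 0 < a)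
    (hε : 0 ≤ ε) : IntegrableOn (kernelIntegrand ν a b ε) (Ioi 0) := by
  refine Integrable.mono' ((integrableOn_exp_neg_Ioi 0).mul_const ((a ^ 2) ^ (-ν.re - 1)))
    ((measurable_kernelIntegrand ν b ε).comp measurable_prodMk_left).aestronglyMeasurable ?_
  exact (ae_restrict_mem measurableSet_Ioi).mono fun t ht => norm_kernelIntegrand_le hν ha hε ht

theorem norm_integral_kernelIntegrand_le {ν : ℂ} (hν : -1 < ν.re) {a b ε : ℝ} (ha : 0 < a)
    (hε : 0 ≤ ε) :
    ‖∫ t in Ioi (0 : ℝ), kernelIntegrand ν a b ε t‖ ≤ (a ^ 2) ^ (-ν.re - 1) := by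
  refine (norm_integral_le_of_norm_le ((integrableOn_exp_neg_Ioi 0).mul_const
    ((a ^ 2) ^ (-ν.re - 1))) ((ae_restrict_mem measurableSet_Ioi).mono fun t ht =>
      norm_kernelIntegrand_le hν ha hε ht)).trans (le_of_eq ?_)
  rw [integral_mul_const, integral_exp_neg_Ioi_zero, one_mul]

theorem tendsto_integral_kernelIntegrand {ν : ℂ} (hν : -1 < ν.re) {a b : ℝ} (ha : 0 < a) :
    Tendsto (fun ε : ℝ => ∫ t in Ioi (0 : ℝ), kernelIntegrand ν a b ε t) (𝓝[>] 0)
      (𝓝 (∫ t in Ioi (0 : ℝ), kernelIntegrand ν a b 0 t)) := by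
  refine tendsto_integral_filter_of_dominated_convergence
    (fun t => Real.exp (-t) * (a ^ 2) ^ (-ν.re - 1)) ?_ ?_
    ((integrableOn_exp_neg_Ioi 0).mul_const _) ?_
  · exact .of_forall fun ε =>
      ((measurable_kernelIntegrand ν b ε).comp measurable_prodMk_left).aestronglyMeasurable
  · exact eventually_nhdsWithin_of_forall fun ε hε =>
      (ae_restrict_mem measurableSet_Ioi).mono fun t ht =>
        norm_kernelIntegrand_le hν ha (le_of_lt hε) ht
  · refine .of_forall fun t => ?_
    have h0 : a ^ 2 + 4 * (0 : ℝ) * t ≠ 0 := by simpa using ha.ne'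
    have hc : ContinuousAt (fun ε : ℝ => kernelIntegrand ν a b ε t) 0 := by
      unfold kernelIntegrand
      refine ContinuousAt.mul ?_ ?_
      · refine Complex.continuous_ofReal.continuousAt.comp
          (Real.continuous_exp.continuousAt.comp ?_)
        have hd : ContinuousAt (fun ε : ℝ => b ^ 2 * t / (a ^ 2 + 4 * ε * t)) 0 :=
          ContinuousAt.div (f := fun _ : ℝ => b ^ 2 * t) continuousAt_const (by fun_prop) h0
        exact (hd.const_add t).neg
      · refine ContinuousAt.comp (f := fun ε : ℝ => a ^ 2 + 4 * ε * t)
          (g := fun x : ℝ => (x : ℂ) ^ (-ν - 1))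
          (Complex.continuousAt_ofReal_cpow_const _ _ (Or.inr h0)) (by fun_prop)
    exact hc.tendsto.mono_left nhdsWithin_le_nhds

theorem integral_kernelIntegrand_zero (ν : ℂ) {a b : ℝ} (η : ℝ) (ha : 0 < a) :
    ∫ t in Ioi η, kernelIntegrand ν a b 0 t = ((a ^ 2 : ℝ) : ℂ) ^ (-ν) *
      ((Real.exp (-((1 + b ^ 2 / a ^ 2) * η)) : ℂ) / ((a : ℂ) ^ 2 + (b : ℂ) ^ 2)) := by
  have hk : 0 < 1 + b ^ 2 / a ^ 2 := by positivity
  have ha2 : ((a ^ 2 : ℝ) : ℂ) ≠ 0 := by exact_mod_cast (pow_pos ha 2).ne'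
  have e : ∀ t : ℝ, kernelIntegrand ν a b 0 t = ((a ^ 2 : ℝ) : ℂ) ^ (-ν - 1) *
      ((Real.exp (-(1 + b ^ 2 / a ^ 2) * t) : ℝ) : ℂ) := by
    intro t
    rw [kernelIntegrand, mul_zero, zero_mul, add_zero, mul_comm]
    congr 3
    ring
  simp only [e]
  rw [integral_const_mul, integral_complex_ofReal, integral_exp_mul_Ioi (by linarith),
    Complex.cpow_sub _ _ ha2, Complex.cpow_one]
  have hs : (a : ℂ) ^ 2 + (b : ℂ) ^ 2 ≠ 0 := by
    have : a ^ 2 + b ^ 2 ≠ 0 := by positivity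
    exact_mod_cast this
  have hs' : (1 + b ^ 2 / a ^ 2 : ℂ) ≠ 0 := by exact_mod_cast hk.ne'
  have ha' : (a : ℂ) ≠ 0 := by exact_mod_cast ha.ne'
  rw [neg_mul]
  generalize Real.exp (-((1 + b ^ 2 / a ^ 2) * η)) = E
  push_cast at ha2 ⊢
  field_simp

/-! ### Uniform bounds for the regularised kernel -/

theorem exp_neg_div_le {β ε : ℝ} (hβ : 0 < β) (hε : 0 < ε) : Real.exp (-(β / ε)) ≤ ε / β := by
  have h := Real.add_one_le_exp (β / ε)
  have h0 : 0 < β / ε := by positivity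
  rw [Real.exp_neg, ← inv_div β ε]
  gcongr
  linarith

/-- The part of the kernel integral with `4εt ≤ a²`, where `a² + 4εt` is comparable to `a²`. -/
theorem norm_integral_kernelIntegrand_Ioc_le {ν : ℂ} (hν : -1 < ν.re) {a b ε : ℝ} (ha : 0 < a)
    (hb : 0 < b) (hε : 0 < ε) :
    ‖∫ t in Ioc 0 (a ^ 2 / (4 * ε)), kernelIntegrand ν a b ε t‖ ≤
      2 / b ^ 2 * (a ^ 2) ^ (-ν.re) := by
  have hk : -(b ^ 2 / (2 * a ^ 2)) < 0 := by
    have : 0 < b ^ 2 / (2 * a ^ 2) := by positivity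
    linarith
  have hint : IntegrableOn (fun t => Real.exp (-(b ^ 2 / (2 * a ^ 2)) * t) *
      (a ^ 2) ^ (-ν.re - 1)) (Ioi 0) := (integrableOn_exp_mul_Ioi hk 0).mul_const _
  refine (norm_integral_le_of_norm_le (hint.mono_set Ioc_subset_Ioi_self)
    ((ae_restrict_mem measurableSet_Ioc).mono fun t ht => ?_)).trans
    ((setIntegral_mono_set hint (.of_forall fun t => by positivity)
      Ioc_subset_Ioi_self.eventuallyLE).trans (le_of_eq ?_))
  · have ht0 : 0 < t := ht.1
    have hW : 0 < a ^ 2 + 4 * ε * t := by positivity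
    have hW2 : a ^ 2 + 4 * ε * t ≤ 2 * a ^ 2 := by
      have := ht.2
      rw [le_div_iff₀ (by positivity)] at this
      linarith
    rw [norm_kernelIntegrand hW]
    have h1 : (a ^ 2 + 4 * ε * t) ^ (-ν.re - 1) ≤ (a ^ 2) ^ (-ν.re - 1) :=
      Real.rpow_le_rpow_of_nonpos (by positivity) (by have := mul_nonneg hε.le ht0.le; linarith)
        (by linarith)
    have h2 : b ^ 2 / (2 * a ^ 2) * t ≤ b ^ 2 * t / (a ^ 2 + 4 * ε * t) := by
      rw [div_mul_eq_mul_div]; gcongr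
    gcongr
    linarith
  · rw [integral_mul_const, integral_exp_mul_Ioi hk, mul_zero, Real.exp_zero,
      Real.rpow_sub_one (by positivity)]
    field_simp

/-- Where `4εt > a²` the factor `exp(-b²t/(a² + 4εt))` is `O(ε)`, since the exponent is at most
`-b²/(8ε)`. -/
theorem norm_kernelIntegrand_le_of_lt {ν : ℂ} {a b ε t : ℝ} (ha : 0 < a) (hb : 0 < b) (hε : 0 < ε)
    (ht : a ^ 2 / (4 * ε) < t) :
    ‖kernelIntegrand ν a b ε t‖ ≤
      8 * ε / b ^ 2 * (Real.exp (-t) * (a ^ 2 + 4 * ε * t) ^ (-ν.re - 1)) := by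
  have ht0 : 0 < t := lt_trans (by positivity) ht
  have hW : 0 < a ^ 2 + 4 * ε * t := by positivity
  have hW2 : a ^ 2 + 4 * ε * t ≤ 8 * ε * t := by
    rw [div_lt_iff₀ (by positivity)] at ht
    linarith
  rw [norm_kernelIntegrand hW, neg_add, Real.exp_add]
  have h1 : Real.exp (-(b ^ 2 * t / (a ^ 2 + 4 * ε * t))) ≤ 8 * ε / b ^ 2 := by
    refine le_trans ?_ (exp_neg_div_le (pow_pos hb 2) (by positivity : 0 < 8 * ε))
    rw [Real.exp_le_exp, neg_le_neg_iff, div_le_div_iff₀ (by positivity) hW]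
    nlinarith [pow_pos hb 2]
  calc _ = Real.exp (-(b ^ 2 * t / (a ^ 2 + 4 * ε * t))) *
        (Real.exp (-t) * (a ^ 2 + 4 * ε * t) ^ (-ν.re - 1)) := by ring
    _ ≤ _ := by gcongr

theorem integrableOn_kernelIntegrand_Ioi {ν : ℂ} (hν : -1 < ν.re) {a b ε : ℝ} (ha : 0 < a)
    (hε : 0 < ε) : IntegrableOn (kernelIntegrand ν a b ε) (Ioi (a ^ 2 / (4 * ε))) :=
  (integrableOn_kernelIntegrand hν ha hε.le).mono_set (Ioi_subset_Ioi (by positivity))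

theorem norm_integral_kernelIntegrand_Ioi_le_of_re_neg {ν : ℂ} (hν : -1 < ν.re) (hν0 : ν.re < 0)
    {a b ε : ℝ} (ha : 0 < a) (hb : 0 < b) (hε : 0 < ε) (hε1 : ε ≤ 1) :
    ‖∫ t in Ioi (a ^ 2 / (4 * ε)), kernelIntegrand ν a b ε t‖ ≤
      8 / b ^ 2 * Real.Gamma (-ν.re) := by
  have hG : IntegrableOn (fun t : ℝ => Real.exp (-t) * t ^ (-ν.re - 1)) (Ioi 0) :=
    Real.GammaIntegral_convergent (by linarith)
  have ht0 : 0 ≤ a ^ 2 / (4 * ε) := by positivity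
  refine (norm_integral_le_of_norm_le ((hG.mono_set (Ioi_subset_Ioi ht0)).const_mul (8 / b ^ 2))
    ((ae_restrict_mem measurableSet_Ioi).mono fun t ht => ?_)).trans ?_
  · have htp : 0 < t := lt_of_le_of_lt ht0 ht
    refine (norm_kernelIntegrand_le_of_lt ha hb hε ht).trans ?_
    have h1 : (a ^ 2 + 4 * ε * t) ^ (-ν.re - 1) ≤ (ε * t) ^ (-ν.re - 1) :=
      Real.rpow_le_rpow_of_nonpos (by positivity)
        (by nlinarith [mul_nonneg hε.le htp.le, sq_nonneg a]) (by linarith)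
    rw [Real.mul_rpow hε.le htp.le] at h1
    have h2 : ε * ε ^ (-ν.re - 1) ≤ 1 := by
      rw [Real.rpow_sub_one hε.ne', mul_div_cancel₀ _ hε.ne']
      exact Real.rpow_le_one hε.le hε1 (by linarith)
    calc _ ≤ 8 * ε / b ^ 2 * (Real.exp (-t) * (ε ^ (-ν.re - 1) * t ^ (-ν.re - 1))) := by gcongr
      _ = (ε * ε ^ (-ν.re - 1)) * (8 / b ^ 2 * (Real.exp (-t) * t ^ (-ν.re - 1))) := by ring
      _ ≤ 1 * (8 / b ^ 2 * (Real.exp (-t) * t ^ (-ν.re - 1))) := by gcongr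
      _ = _ := one_mul _
  · rw [integral_const_mul, Real.Gamma_eq_integral (by linarith)]
    refine mul_le_mul_of_nonneg_left (setIntegral_mono_set hG ?_
      (Ioi_subset_Ioi ht0).eventuallyLE) (by positivity)
    exact (ae_restrict_mem measurableSet_Ioi).mono fun t ht => by
      have : (0 : ℝ) < t := ht
      simp only [Pi.zero_apply]
      positivity

/-- For `ν ≠ 0` the factor `W^(-ν-1)`, `W = a² + 4εt`, is integrated by parts: for imaginary `ν` it
is too large to be replaced by its modulus. -/
theorem norm_integral_kernelIntegrand_Ioi_le_of_re_nonneg {ν : ℂ} (h0 : ν ≠ 0) (hν : 0 ≤ ν.re)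
    {a b ε : ℝ} (ha : 0 < a) (hb : 0 < b) (hε : 0 < ε) :
    ‖∫ t in Ioi (a ^ 2 / (4 * ε)), kernelIntegrand ν a b ε t‖ ≤
      4 / (b ^ 2 * ‖ν‖) * (a ^ 2) ^ (-ν.re) := by
  set t₀ := a ^ 2 / (4 * ε) with ht₀
  have ht₀0 : 0 < t₀ := by positivity
  have hn : 0 < ‖ν‖ := norm_pos_iff.2 h0
  have hεc : (ε : ℂ) ≠ 0 := by exact_mod_cast hε.ne'
  set W : ℝ → ℝ := fun t => a ^ 2 + 4 * ε * t with hWdef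
  have hW : ∀ t, 0 < t → 0 < W t := fun t ht => by simp only [hWdef]; positivity
  set h : ℝ → ℝ := fun t => Real.exp (-(t + b ^ 2 * t / W t)) with hh
  set h' : ℝ → ℝ := fun t => h t * -(1 + b ^ 2 * a ^ 2 / W t ^ 2) with hh'
  set V : ℝ → ℂ := fun t => (W t : ℂ) ^ (-ν) / (-ν * (4 * ε)) with hV
  have dW : ∀ t, HasDerivAt W (4 * ε) t := fun t => by
    have := ((hasDerivAt_id t).const_mul (4 * ε)).const_add (a ^ 2)
    rwa [mul_one] at this
  have dh : ∀ t, 0 < t → HasDerivAt h (h' t) t := by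
    intro t ht
    have hWt := (hW t ht).ne'
    have h1 := (((hasDerivAt_id t).const_mul (b ^ 2)).div (dW t) hWt)
    refine (((hasDerivAt_id t).add h1).neg.exp).congr_deriv ?_
    simp only [hh', hh, id, Pi.add_apply, Pi.neg_apply, Pi.div_apply]
    congr 3
    field_simp
    simp only [hWdef]
    ring
  have dV : ∀ t, 0 < t → HasDerivAt V ((W t : ℂ) ^ (-ν - 1)) t := by
    intro t ht
    have hWc : (W t : ℂ) ≠ 0 := by exact_mod_cast (hW t ht).ne'
    have h1 := (hasDerivAt_cpow_slit (a := -ν)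
      (Complex.ofReal_mem_slitPlane.2 (hW t ht))).comp_ofReal
    refine ((h1.scomp t (dW t)).div_const (-ν * (4 * ε))).congr_deriv ?_
    rw [Complex.cpow_sub _ _ hWc, Complex.cpow_one, Complex.real_smul]
    push_cast
    field_simp
  have hhpos : ∀ t, 0 < h t := fun t => Real.exp_pos _
  have hlim : Tendsto h atTop (𝓝 0) := by
    refine squeeze_zero' (.of_forall fun t => (hhpos t).le) ?_
      (Real.tendsto_exp_neg_atTop_nhds_zero)
    filter_upwards [eventually_gt_atTop 0] with t ht
    simp only [hh]
    rw [Real.exp_le_exp]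
    have := hW t ht
    have : 0 ≤ b ^ 2 * t / W t := by positivity
    linarith
  have hh'np : ∀ t, h' t ≤ 0 := by
    intro t
    have h1 : 0 ≤ b ^ 2 * a ^ 2 / W t ^ 2 := by positivity
    have := hhpos t
    simp only [hh']
    nlinarith
  have hcont : ContinuousWithinAt h (Ici t₀) t₀ := (dh t₀ ht₀0).continuousAt.continuousWithinAt
  have dh₀ : ∀ t ∈ Ioi t₀, HasDerivAt h (h' t) t := fun t ht => dh t (ht₀0.trans ht)
  have hint' := integrableOn_Ioi_deriv_of_nonpos hcont dh₀ (fun t _ => hh'np t) hlim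
  have hval := integral_Ioi_of_hasDerivAt_of_nonpos hcont dh₀ (fun t _ => hh'np t) hlim
  set B := (a ^ 2) ^ (-ν.re) / (‖ν‖ * (4 * ε)) with hB
  have hB0 : 0 ≤ B := by positivity
  -- `1/|ν|` enters here through the primitive `V` of `W^(-ν-1)`; `1/ε` is compensated by `h t₀`
  have hVle : ∀ t, 0 < t → ‖V t‖ ≤ B := by
    intro t ht
    simp only [hV, hB]
    rw [norm_div, norm_cpow_real (hW t ht), norm_mul, norm_neg, norm_mul, Complex.norm_real,
      Real.norm_of_nonneg hε.le, Complex.neg_re]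
    have : ‖(4 : ℂ)‖ = 4 := by norm_num
    rw [this]
    gcongr ?_ / _
    refine Real.rpow_le_rpow_of_nonpos (by positivity) ?_ (by linarith)
    simp only [hWdef]
    have := mul_pos hε ht
    linarith
  have hVh'int : IntegrableOn (fun t => (h' t : ℂ) * V t) (Ioi t₀) := by
    have hdom : IntegrableOn (fun t => -h' t * B) (Ioi t₀) := hint'.neg.mul_const B
    refine Integrable.mono' hdom ?_ ((ae_restrict_mem measurableSet_Ioi).mono fun t ht => ?_)
    · refine (Complex.continuous_ofReal.comp_aestronglyMeasurable hint'.aestronglyMeasurable).mul ?_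
      refine ContinuousOn.aestronglyMeasurable (fun t ht => ?_) measurableSet_Ioi
      exact (dV t (ht₀0.trans ht)).continuousAt.continuousWithinAt
    · rw [norm_mul, Complex.norm_real, Real.norm_of_nonpos (hh'np t)]
      have := hVle t (ht₀0.trans ht)
      have := hh'np t
      gcongr
      linarith
  have hkint : IntegrableOn (fun t => (h t : ℂ) * (W t : ℂ) ^ (-ν - 1)) (Ioi t₀) :=
    integrableOn_kernelIntegrand_Ioi (by linarith) ha hε
  have dF : ∀ t, 0 < t → HasDerivAt (fun t => (h t : ℂ) * V t)
      ((h' t : ℂ) * V t + (h t : ℂ) * (W t : ℂ) ^ (-ν - 1)) t := fun t ht =>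
    (dh t ht).ofReal_comp.mul (dV t ht)
  have hFlim : Tendsto (fun t => (h t : ℂ) * V t) atTop (𝓝 0) := by
    refine squeeze_zero_norm' ?_ (by simpa using hlim.mul_const B)
    filter_upwards [eventually_gt_atTop 0] with t ht
    rw [norm_mul, Complex.norm_real, Real.norm_of_nonneg (hhpos t).le]
    have := hVle t ht
    have := (hhpos t).le
    gcongr
  have hibp := integral_Ioi_of_hasDerivAt_of_tendsto
    (dF t₀ ht₀0).continuousAt.continuousWithinAt (fun t ht => dF t (ht₀0.trans ht))
    (hVh'int.add hkint) hFlim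
  rw [integral_add hVh'int hkint] at hibp
  have hker : ∫ t in Ioi t₀, kernelIntegrand ν a b ε t =
      -((h t₀ : ℂ) * V t₀) - ∫ t in Ioi t₀, (h' t : ℂ) * V t := by
    have e : ∫ t in Ioi t₀, kernelIntegrand ν a b ε t =
        ∫ t in Ioi t₀, (h t : ℂ) * (W t : ℂ) ^ (-ν - 1) := rfl
    rw [e]
    linear_combination hibp
  have hb1 : ‖(h t₀ : ℂ) * V t₀‖ ≤ h t₀ * B := by
    rw [norm_mul, Complex.norm_real, Real.norm_of_nonneg (hhpos _).le]
    have := hVle t₀ ht₀0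
    have := (hhpos t₀).le
    gcongr
  have hb2 : ‖∫ t in Ioi t₀, (h' t : ℂ) * V t‖ ≤ h t₀ * B := by
    have hdom : IntegrableOn (fun t => -h' t * B) (Ioi t₀) := hint'.neg.mul_const B
    refine (norm_integral_le_of_norm_le hdom
      ((ae_restrict_mem measurableSet_Ioi).mono fun t ht => ?_)).trans (le_of_eq ?_)
    · rw [norm_mul, Complex.norm_real, Real.norm_of_nonpos (hh'np t)]
      have := hVle t (ht₀0.trans ht)
      have := hh'np t
      gcongr
      linarith
    · rw [integral_mul_const, integral_neg, hval]
      ring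
  have hh₀ : h t₀ ≤ 8 * ε / b ^ 2 := by
    refine le_trans ?_ (exp_neg_div_le (pow_pos hb 2) (by positivity : 0 < 8 * ε))
    simp only [hh]
    rw [Real.exp_le_exp, neg_le_neg_iff]
    have e : b ^ 2 * t₀ / W t₀ = b ^ 2 / (8 * ε) := by
      simp only [hWdef, ht₀]
      field_simp
      ring
    rw [e]
    linarith
  rw [hker]
  calc _ ≤ ‖(h t₀ : ℂ) * V t₀‖ + ‖∫ t in Ioi t₀, (h' t : ℂ) * V t‖ := by
        refine (norm_sub_le _ _).trans ?_
        rw [norm_neg]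
    _ ≤ 2 * (8 * ε / b ^ 2 * B) := by
        have := mul_le_mul_of_nonneg_right hh₀ hB0
        linarith
    _ = _ := by
        simp only [hB]
        field_simp
        ring

/-- For `ν = 0` the integral of `1/W` is logarithmic in `a`, hence the bound by `K_0`. -/
theorem norm_integral_kernelIntegrand_Ioi_le_zero {a b ε : ℝ} (ha : 0 < a) (hb : 0 < b)
    (hε : 0 < ε) (hε1 : ε ≤ 1) :
    ‖∫ t in Ioi (a ^ 2 / (4 * ε)), kernelIntegrand 0 a b ε t‖ ≤
      4 * Real.exp 1 / b ^ 2 * macK 0 a := by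
  have ht0 : 0 ≤ a ^ 2 / (4 * ε) := by positivity
  have hI : IntegrableOn (fun t => ‖macdonaldIntegrand 0 a t‖) (Ioi 0) :=
    (integrableOn_macdonaldIntegrand 0 ha).norm
  refine (norm_integral_le_of_norm_le ((hI.mono_set (Ioi_subset_Ioi ht0)).const_mul
    (2 * Real.exp 1 / b ^ 2)) ((ae_restrict_mem measurableSet_Ioi).mono fun t ht => ?_)).trans ?_
  · have htp : 0 < t := lt_of_le_of_lt ht0 ht
    refine (norm_kernelIntegrand_le_of_lt ha hb hε ht).trans ?_
    have ht' : a ^ 2 / (4 * ε) < t := ht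
    rw [norm_macdonaldIntegrand _ _ htp, Complex.zero_re, neg_zero, zero_sub, Real.rpow_neg_one,
      Real.rpow_neg_one]
    have h1 : (a ^ 2 + 4 * ε * t)⁻¹ ≤ (4 * ε * t)⁻¹ := by
      gcongr; linarith [sq_nonneg a]
    have h2 : Real.exp (-t) ≤ Real.exp 1 * Real.exp (-(t + a ^ 2 / (4 * t))) := by
      rw [← Real.exp_add, Real.exp_le_exp]
      have : a ^ 2 / (4 * t) ≤ 1 := by
        rw [div_lt_iff₀ (by positivity)] at ht'
        rw [div_le_one (by positivity)]
        nlinarith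
      linarith
    calc _ ≤ 8 * ε / b ^ 2 * ((Real.exp 1 * Real.exp (-(t + a ^ 2 / (4 * t)))) *
          (4 * ε * t)⁻¹) := by gcongr
      _ = _ := by field_simp; norm_num
  · rw [integral_const_mul]
    have h1 : ∫ t in Ioi (a ^ 2 / (4 * ε)), ‖macdonaldIntegrand 0 a t‖ ≤
        ∫ t in Ioi (0 : ℝ), ‖macdonaldIntegrand 0 a t‖ :=
      setIntegral_mono_set hI (.of_forall fun _ => norm_nonneg _) (Ioi_subset_Ioi ht0).eventuallyLE
    have h2 := integral_norm_macdonaldIntegrand 0 ha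
    rw [Complex.zero_re, Real.rpow_zero, mul_one] at h2
    calc _ ≤ 2 * Real.exp 1 / b ^ 2 * ∫ t in Ioi (0 : ℝ), ‖macdonaldIntegrand 0 a t‖ := by gcongr
      _ = _ := by rw [← h2]; ring

theorem integral_kernelIntegrand_split {ν : ℂ} (hν : -1 < ν.re) {a b ε : ℝ} (ha : 0 < a)
    (hε : 0 < ε) :
    ‖∫ t in Ioi (0 : ℝ), kernelIntegrand ν a b ε t‖ ≤
      ‖∫ t in Ioc 0 (a ^ 2 / (4 * ε)), kernelIntegrand ν a b ε t‖ +
      ‖∫ t in Ioi (a ^ 2 / (4 * ε)), kernelIntegrand ν a b ε t‖ := by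
  have ht0 : 0 ≤ a ^ 2 / (4 * ε) := by positivity
  have hI := integrableOn_kernelIntegrand (b := b) hν ha hε.le
  rw [← Ioc_union_Ioi_eq_Ioi ht0, setIntegral_union (Ioc_disjoint_Ioi le_rfl) measurableSet_Ioi
    (hI.mono_set Ioc_subset_Ioi_self) (hI.mono_set (Ioi_subset_Ioi ht0))]
  exact norm_add_le _ _

theorem exists_rpow_mul_norm_kernel_le {ν : ℂ} (hν : -1 < ν.re) (h0 : ν ≠ 0) {b : ℝ}
    (hb : 0 < b) :
    ∃ C : ℝ, 0 < C ∧ ∀ a ε : ℝ, 0 < a → a ≤ 1 → 0 < ε → ε ≤ 1 →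
      a ^ ν.re * ‖∫ t in Ioi (0 : ℝ), kernelIntegrand ν a b ε t‖ ≤ C * a ^ (-|ν.re|) := by
  have hn : 0 < ‖ν‖ := norm_pos_iff.2 h0
  have e : ∀ a : ℝ, 0 < a → a ^ ν.re * (a ^ 2) ^ (-ν.re) = a ^ (-ν.re) := by
    intro a ha
    rw [← Real.rpow_natCast a 2, ← Real.rpow_mul ha.le, ← Real.rpow_add ha]
    congr 1; push_cast; ring
  rcases lt_or_ge ν.re 0 with hneg | hpos
  · have hG := Real.Gamma_pos_of_pos (by linarith : 0 < -ν.re)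
    refine ⟨2 / b ^ 2 + 8 / b ^ 2 * Real.Gamma (-ν.re), by positivity, fun a ε ha ha1 hε hε1 => ?_⟩
    have h1 := integral_kernelIntegrand_split (b := b) hν ha hε
    have h2 := norm_integral_kernelIntegrand_Ioc_le hν ha hb hε
    have h3 := norm_integral_kernelIntegrand_Ioi_le_of_re_neg hν hneg ha hb hε hε1
    have h4 : a ^ (-ν.re) ≤ a ^ ν.re :=
      Real.rpow_le_rpow_of_exponent_ge ha ha1 (by linarith)
    rw [abs_of_neg hneg, neg_neg]
    calc _ ≤ a ^ ν.re * (2 / b ^ 2 * (a ^ 2) ^ (-ν.re) + 8 / b ^ 2 * Real.Gamma (-ν.re)) := by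
          gcongr; linarith
      _ = 2 / b ^ 2 * (a ^ ν.re * (a ^ 2) ^ (-ν.re)) +
          8 / b ^ 2 * Real.Gamma (-ν.re) * a ^ ν.re := by ring
      _ ≤ 2 / b ^ 2 * a ^ ν.re + 8 / b ^ 2 * Real.Gamma (-ν.re) * a ^ ν.re := by
          rw [e a ha]; gcongr
      _ = _ := by ring
  · refine ⟨2 / b ^ 2 + 4 / (b ^ 2 * ‖ν‖), by positivity, fun a ε ha ha1 hε hε1 => ?_⟩
    have h1 := integral_kernelIntegrand_split (b := b) hν ha hε
    have h2 := norm_integral_kernelIntegrand_Ioc_le hν ha hb hε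
    have h3 := norm_integral_kernelIntegrand_Ioi_le_of_re_nonneg h0 hpos ha hb hε
    rw [abs_of_nonneg hpos]
    calc _ ≤ a ^ ν.re * (2 / b ^ 2 * (a ^ 2) ^ (-ν.re) +
          4 / (b ^ 2 * ‖ν‖) * (a ^ 2) ^ (-ν.re)) := by gcongr; linarith
      _ = (2 / b ^ 2 + 4 / (b ^ 2 * ‖ν‖)) * (a ^ ν.re * (a ^ 2) ^ (-ν.re)) := by ring
      _ = _ := by rw [e a ha]

theorem exists_norm_kernel_zero_le {b : ℝ} (hb : 0 < b) :
    ∃ C : ℝ, 0 < C ∧ ∀ a ε : ℝ, 0 < a → a ≤ 1 → 0 < ε → ε ≤ 1 →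
      ‖∫ t in Ioi (0 : ℝ), kernelIntegrand 0 a b ε t‖ ≤ C * macK 0 a := by
  have hm := macK_pos 0 one_pos
  refine ⟨2 / b ^ 2 / macK 0 1 + 4 * Real.exp 1 / b ^ 2, by positivity,
    fun a ε ha ha1 hε hε1 => ?_⟩
  have h0 : (-1 : ℝ) < (0 : ℂ).re := by simp
  have h1 := integral_kernelIntegrand_split (b := b) h0 ha hε
  have h2 := norm_integral_kernelIntegrand_Ioc_le h0 ha hb hε
  have h3 := norm_integral_kernelIntegrand_Ioi_le_zero ha hb hε hε1
  rw [Complex.zero_re, neg_zero, Real.rpow_zero, mul_one] at h2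
  have h4 : 2 / b ^ 2 ≤ 2 / b ^ 2 / macK 0 1 * macK 0 a := by
    rw [div_mul_eq_mul_div, le_div_iff₀ hm]
    have := macK_antitone (s := 0) ha ha1
    gcongr
  rw [add_mul]
  linarith

/-- The estimates that replace absolute convergence near the origin. The weight is
`x^(-|Re ν|)` for `ν ≠ 0`, and a dilate of `K_0` for `ν = 0`. -/
theorem exists_weight {ν : ℂ} (hν : -1 < ν.re) {f : ℝ → ℂ}
    (hf : AEStronglyMeasurable f (volume.restrict (Ioi 0)))
    (h : ∀ᵐ u ∂(volume.restrict (Ioi (0 : ℝ))), KExists ν f u) {b : ℝ} (hb : 0 < b) :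
    ∃ (wt : ℝ → ℝ) (δ C r : ℝ), 0 < δ ∧ δ ≤ 1 ∧ 0 < C ∧ r < ν.re + 2 ∧
      IntegrableOn (fun x => Real.sqrt x * wt x * ‖f x‖) (Ioo 0 δ) ∧
      ∀ x ∈ Ioo 0 δ, 0 ≤ wt x ∧
        (∀ ε : ℝ, 0 < ε → ε ≤ 1 →
          x ^ ν.re * ‖∫ t in Ioi (0 : ℝ), kernelIntegrand ν x b ε t‖ ≤ C * wt x) ∧
        ∀ u : ℝ, 0 < u → ‖besselK ν (u * x)‖ ≤ C * (1 + u ^ (-r)) * wt x := by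
  by_cases h0 : ν = 0
  · subst h0
    obtain ⟨u₀, hu₀, hK⟩ := exists_mem_Ioo_of_ae h le_rfl one_pos
    obtain ⟨C, hC, hker⟩ := exists_norm_kernel_zero_le hb
    have hu0 : 0 < u₀ := hu₀.1
    have hm := macK_pos 0 one_pos
    refine ⟨fun x => macK 0 (x * u₀), 1, C + 1 / macK 0 1 + 2, 1, one_pos, le_rfl, by positivity,
      by simp, ?_, fun x hx => ?_⟩
    · have hsu : 0 < Real.sqrt u₀ := Real.sqrt_pos.2 hu0
      have hK' : IntegrableOn (fun x => (Real.sqrt u₀)⁻¹ * ‖kIntegrand 0 f u₀ x‖) (Ioi 0) :=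
        hK.norm.const_mul (Real.sqrt u₀)⁻¹
      refine IntegrableOn.congr_fun (hK'.mono_set Ioo_subset_Ioi_self) (fun x hx => ?_) measurableSet_Ioo
      simp only
      rw [norm_kIntegrand _ _ hx.1, show (0 : ℂ) = ((0 : ℝ) : ℂ) by simp, besselK_ofReal,
        Complex.norm_real, Real.norm_of_nonneg (macK_nonneg _ _)]
      field_simp
    · have hx0 : 0 < x := hx.1
      have hxu : 0 < x * u₀ := by positivity
      have hxu1 : x * u₀ ≤ 1 := by nlinarith [hx.2, hu₀.2]
      have hw := macK_pos 0 hxu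
      have hanti : macK 0 x ≤ macK 0 (x * u₀) :=
        macK_antitone hxu (mul_le_of_le_one_right hx0.le hu₀.2.le)
      refine ⟨hw.le, fun ε hε hε1 => ?_, fun u hu => ?_⟩
      · rw [Complex.zero_re, Real.rpow_zero, one_mul]
        refine (hker x ε hx0 hx.2.le hε hε1).trans ?_
        have h1 : 0 < 1 / macK 0 1 := by positivity
        have h2 := macK_nonneg 0 x
        gcongr
        linarith
      · refine (norm_besselK_le 0 (mul_pos hu hx0)).trans ?_
        rw [Complex.zero_re, Real.rpow_neg_one]
        have hui : 0 < u⁻¹ := inv_pos.2 hu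
        have hlow : 1 ≤ 1 / macK 0 1 * macK 0 (x * u₀) := by
          rw [one_div, inv_mul_eq_div, one_le_div hm]
          exact macK_antitone hxu hxu1
        have key : macK 0 (u * x) ≤ u⁻¹ + 2 * macK 0 (x * u₀) := by
          -- the logarithm from the dilation by `u/u₀ < 1` is absorbed in `u⁻¹`
          rcases le_total u₀ u with hle | hle
          · have : macK 0 (u * x) ≤ macK 0 (x * u₀) := by
              apply macK_antitone hxu; rw [mul_comm u x]; gcongr
            linarith
          · have h1 := macK_zero_mul_le hxu (div_pos hu hu0) ((div_le_one hu0).2 hle)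
            have e1 : u / u₀ * (x * u₀) = u * x := by field_simp
            rw [e1] at h1
            have h2 : -Real.log (u / u₀) ≤ u⁻¹ := by
              rw [← Real.log_inv, inv_div]
              refine (Real.log_le_sub_one_of_pos (by positivity)).trans ?_
              have : u₀ / u ≤ u⁻¹ := by
                rw [div_eq_mul_inv]; exact mul_le_of_le_one_left hui.le hu₀.2.le
              linarith
            have h3 : Real.exp (x * u₀ / 2) ≤ 2 := by
              refine (Real.exp_le_exp.2 (show x * u₀ / 2 ≤ 1 / 2 by linarith)).trans ?_
              have : Real.exp (1 / 2) * Real.exp (1 / 2) ≤ 2 * 2 := by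
                rw [← Real.exp_add]
                have := Real.exp_one_lt_d9
                norm_num at this ⊢
                linarith
              nlinarith [Real.exp_pos (1 / 2)]
            have := mul_le_mul_of_nonneg_right h3 hw.le
            linarith
        have h5 := mul_le_mul_of_nonneg_left hlow hui.le
        have h6 : 0 ≤ (C + 1 / macK 0 1) * macK 0 (x * u₀) := by positivity
        have h7 : 0 ≤ (C + 2) * (u⁻¹ * macK 0 (x * u₀)) := by positivity
        calc _ ≤ _ := key
          _ ≤ u⁻¹ * (1 / macK 0 1 * macK 0 (x * u₀)) + 2 * macK 0 (x * u₀) +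
              (C + 1 / macK 0 1) * macK 0 (x * u₀) + (C + 2) * (u⁻¹ * macK 0 (x * u₀)) := by
            linarith
          _ = _ := by ring
  · obtain ⟨δ, hδ, hδ1, hint⟩ := exists_integrableOn_of_kExists h0 hf h
    obtain ⟨C₁, hC₁, hker⟩ := exists_rpow_mul_norm_kernel_le hν h0 hb
    obtain ⟨C₂, hC₂, hK⟩ := exists_norm_besselK_le_rpow h0
    refine ⟨fun x => x ^ (-|ν.re|), δ, C₁ + C₂, |ν.re|, hδ, hδ1, by positivity,
      abs_lt.2 ⟨by linarith, by linarith⟩, hint, fun x hx => ?_⟩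
    have hx0 : 0 < x := hx.1
    have hw : 0 < x ^ (-|ν.re|) := by positivity
    refine ⟨hw.le, fun ε hε hε1 => ?_, fun u hu => ?_⟩
    · refine (hker x ε hx0 (hx.2.le.trans hδ1) hε hε1).trans ?_
      gcongr
      linarith
    · refine (hK _ (mul_pos hu hx0)).trans ?_
      rw [Real.mul_rpow hu.le hx0.le, ← mul_assoc]
      have : 0 < u ^ (-|ν.re|) := by positivity
      gcongr <;> linarith

/-! ### The Hankel transform of the `K`-transform -/

theorem norm_widderIntegrand (a : ℂ) (f : ℝ → ℂ) (y : ℝ) {x : ℝ} (hx : 0 < x) :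
    ‖widderIntegrand (fun x => (x : ℂ) ^ a * f x) y x‖ =
      x ^ (a.re + 1) * ‖f x‖ / (x ^ 2 + y ^ 2) := by
  have h : (x : ℂ) ^ 2 + (y : ℂ) ^ 2 = ((x ^ 2 + y ^ 2 : ℝ) : ℂ) := by push_cast; rfl
  rw [widderIntegrand, h, norm_div, norm_mul, norm_mul, norm_cpow_real hx, Complex.norm_real,
    Complex.norm_real, Real.norm_of_nonneg hx.le, Real.norm_of_nonneg (by positivity),
    Real.rpow_add_one hx.ne']
  ring

theorem aestronglyMeasurable_of_widderExists {a : ℂ} {f : ℝ → ℂ} {y : ℝ}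
    (h : WidderExists (fun x => (x : ℂ) ^ a * f x) y) :
    AEStronglyMeasurable f (volume.restrict (Ioi 0)) := by
  have hm : Measurable fun x : ℝ => ((x : ℂ) ^ 2 + (y : ℂ) ^ 2) / ((x : ℂ) * (x : ℂ) ^ a) :=
    Measurable.div (by fun_prop)
      (Complex.measurable_ofReal.mul (Complex.measurable_ofReal.pow_const a))
  refine (h.aestronglyMeasurable.mul hm.aestronglyMeasurable).congr
    ((ae_restrict_mem measurableSet_Ioi).mono fun x hx => ?_)
  have hx0 : (0 : ℝ) < x := hx
  have hxc : (x : ℂ) ≠ 0 := by exact_mod_cast hx0.ne'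
  have h1 : (x : ℂ) ^ a ≠ 0 := by rw [Complex.cpow_ne_zero_iff]; exact Or.inl hxc
  have h2 : (x : ℂ) ^ 2 + (y : ℂ) ^ 2 ≠ 0 := by
    have : x ^ 2 + y ^ 2 ≠ 0 := by positivity
    exact_mod_cast this
  simp only [Pi.mul_apply, widderIntegrand]
  field_simp

theorem integrableOn_Ici_of_widderExists {a : ℂ} {f : ℝ → ℂ} {y : ℝ}
    (h : WidderExists (fun x => (x : ℂ) ^ a * f x) y) {δ : ℝ} (hδ : 0 < δ) :
    IntegrableOn (fun x => x ^ (a.re - 1) * ‖f x‖) (Ici δ) := by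
  have hsub : Ici δ ⊆ Ioi (0 : ℝ) := fun x hx => lt_of_lt_of_le hδ hx
  have hW₀ : IntegrableOn (fun x => (1 + y ^ 2 / δ ^ 2) *
      ‖widderIntegrand (fun x => (x : ℂ) ^ a * f x) y x‖) (Ioi 0) := h.norm.const_mul _
  have hW := hW₀.mono_set hsub
  refine Integrable.mono' hW (AEStronglyMeasurable.mul
    (Measurable.aestronglyMeasurable (by fun_prop))
    ((aestronglyMeasurable_of_widderExists h).mono_measure
      (Measure.restrict_mono hsub le_rfl)).norm)
    ((ae_restrict_mem measurableSet_Ici).mono fun x hx => ?_)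
  have hxδ : δ ≤ x := hx
  have hx0 : 0 < x := hδ.trans_le hxδ
  rw [Real.norm_of_nonneg (by positivity), norm_widderIntegrand _ _ _ hx0]
  have e : x ^ (a.re + 1) = x ^ (a.re - 1) * x ^ 2 := by
    rw [← Real.rpow_natCast x 2, ← Real.rpow_add hx0]; congr 1; push_cast; ring
  have h1 : 1 ≤ (1 + y ^ 2 / δ ^ 2) * (x ^ 2 / (x ^ 2 + y ^ 2)) := by
    rw [← mul_div_assoc, one_le_div (by positivity), add_mul, one_mul, div_mul_eq_mul_div]
    gcongr
    rw [le_div_iff₀ (by positivity)]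
    gcongr
  rw [e]
  calc x ^ (a.re - 1) * ‖f x‖ = 1 * (x ^ (a.re - 1) * ‖f x‖) := (one_mul _).symm
    _ ≤ (1 + y ^ 2 / δ ^ 2) * (x ^ 2 / (x ^ 2 + y ^ 2)) * (x ^ (a.re - 1) * ‖f x‖) := by gcongr
    _ = _ := by ring

theorem integrableOn_mul_besselJ_mul_exp {ν : ℂ} (hν : -1 < ν.re) {y ε r : ℝ} (hy : 0 < y)
    (hε : 0 < ε) (hr : r < ν.re + 2) :
    IntegrableOn (fun u : ℝ => u * ‖besselJ ν (u * y)‖ * (1 + u ^ (-r)) * Real.exp (-(ε * u ^ 2)))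
      (Ioi 0) := by
  obtain ⟨C, hC, hJ⟩ := exists_norm_besselJ_le hν
  have hI : ∀ p : ℝ, -1 < p → IntegrableOn (fun u : ℝ => u ^ p * Real.exp (-ε * u ^ 2)) (Ioi 0) :=
    fun p hp => integrableOn_rpow_mul_exp_neg_mul_sq hε hp
  have hg : IntegrableOn (fun u : ℝ => C * y ^ ν.re *
      ((u ^ (ν.re + 1) * Real.exp (-ε * u ^ 2) + u ^ (ν.re + 1 - r) * Real.exp (-ε * u ^ 2)) +
      y * (u ^ (ν.re + 2) * Real.exp (-ε * u ^ 2) + u ^ (ν.re + 2 - r) * Real.exp (-ε * u ^ 2))))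
      (Ioi 0) :=
    (((hI _ (by linarith)).add (hI _ (by linarith))).add
      (((hI _ (by linarith)).add (hI _ (by linarith))).const_mul y)).const_mul _
  refine Integrable.mono' hg ?_ ((ae_restrict_mem measurableSet_Ioi).mono fun u hu => ?_)
  · refine Measurable.aestronglyMeasurable ?_
    exact ((measurable_id.mul ((measurable_besselJ hν).comp (measurable_id.mul_const y)).norm).mul
      (by fun_prop)).mul (by fun_prop)
  · have hu0 : (0 : ℝ) < u := hu
    rw [Real.norm_of_nonneg (by positivity), ← neg_mul]
    have := hJ (u * y) (by positivity)
    have e1 : u ^ (ν.re + 1) = u ^ ν.re * u := Real.rpow_add_one hu0.ne' _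
    have e2 : u ^ (ν.re + 2) = u ^ ν.re * u * u := by
      rw [show ν.re + 2 = ν.re + 1 + 1 by ring, Real.rpow_add_one hu0.ne',
        Real.rpow_add_one hu0.ne']
    calc _ ≤ u * (C * ((u * y) ^ ν.re * (1 + u * y))) * (1 + u ^ (-r)) *
          Real.exp (-ε * u ^ 2) := by gcongr
      _ = _ := by
        rw [Real.mul_rpow hu0.le hy.le, sub_eq_add_neg, sub_eq_add_neg, Real.rpow_add hu0 _ (-r),
          Real.rpow_add hu0 _ (-r), e1, e2]
        ring

theorem exists_integral_mul_besselJ_mul_macK_le {ν : ℂ} (hν : -1 < ν.re) {y δ : ℝ} (hy : 0 < y)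
    (hδ : 0 < δ) : ∃ D : ℝ, 0 ≤ D ∧ ∀ x : ℝ, δ ≤ x →
      ∫ u in Ioi (0 : ℝ), u * ‖besselJ ν (u * y)‖ * macK ν.re (u * x) ≤ D * x ^ (-ν.re - 2) := by
  obtain ⟨C, hC, hJ⟩ := exists_norm_besselJ_le hν
  have habs : |ν.re| < ν.re + 2 := abs_lt.2 ⟨by linarith, by linarith⟩
  set I₁ := ∫ u in Ioi (0 : ℝ), u ^ (ν.re + 1) * macK ν.re u with hI₁
  set I₂ := ∫ u in Ioi (0 : ℝ), u ^ (ν.re + 2) * macK ν.re u with hI₂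
  have hI₁0 : 0 ≤ I₁ := setIntegral_nonneg measurableSet_Ioi fun u hu =>
    mul_nonneg (Real.rpow_nonneg (le_of_lt hu) _) (macK_nonneg _ _)
  have hI₂0 : 0 ≤ I₂ := setIntegral_nonneg measurableSet_Ioi fun u hu =>
    mul_nonneg (Real.rpow_nonneg (le_of_lt hu) _) (macK_nonneg _ _)
  refine ⟨C * y ^ ν.re * (I₁ + y * (δ⁻¹ * I₂)), by positivity, fun x hx => ?_⟩
  have hx0 : 0 < x := hδ.trans_le hx
  have h1 := integrableOn_rpow_mul_macK_comp_mul (a := ν.re + 1) (s := ν.re) (by linarith) hx0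
  have h2 := integrableOn_rpow_mul_macK_comp_mul (a := ν.re + 2) (s := ν.re) (by linarith) hx0
  have hg : IntegrableOn (fun u : ℝ => C * y ^ ν.re * (u ^ (ν.re + 1) * macK ν.re (x * u) +
      y * (u ^ (ν.re + 2) * macK ν.re (x * u)))) (Ioi 0) :=
    (h1.add (h2.const_mul y)).const_mul _
  calc _ ≤ ∫ u in Ioi (0 : ℝ), C * y ^ ν.re * (u ^ (ν.re + 1) * macK ν.re (x * u) +
        y * (u ^ (ν.re + 2) * macK ν.re (x * u))) := by
        refine setIntegral_mono_on (integrableOn_mul_besselJ_mul_macK hν hx0 hy) hg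
          measurableSet_Ioi fun u hu => ?_
        have hu0 : (0 : ℝ) < u := hu
        have hK := macK_nonneg ν.re (u * x)
        have := hJ (u * y) (by positivity)
        calc u * ‖besselJ ν (u * y)‖ * macK ν.re (u * x)
            ≤ u * (C * ((u * y) ^ ν.re * (1 + u * y))) * macK ν.re (u * x) := by gcongr
          _ = _ := by
            rw [Real.mul_rpow hu0.le hy.le, Real.rpow_add hu0, Real.rpow_add hu0, Real.rpow_one,
              Real.rpow_two, mul_comm x u]
            ring
    _ = C * y ^ ν.re * (x ^ (-ν.re - 2) * I₁ + y * (x ^ (-ν.re - 3) * I₂)) := by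
        rw [integral_const_mul, integral_add h1 (h2.const_mul y), integral_const_mul,
          integral_rpow_mul_macK_comp_mul hx0, integral_rpow_mul_macK_comp_mul hx0,
          show -(ν.re + 1) - 1 = -ν.re - 2 by ring, show -(ν.re + 2) - 1 = -ν.re - 3 by ring]
    _ ≤ C * y ^ ν.re * (x ^ (-ν.re - 2) * I₁ + y * (x ^ (-ν.re - 2) * δ⁻¹ * I₂)) := by
        have : x ^ (-ν.re - 3) ≤ x ^ (-ν.re - 2) * δ⁻¹ := by
          rw [show -ν.re - 3 = -ν.re - 2 - 1 by ring, Real.rpow_sub_one hx0.ne', div_eq_mul_inv]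
          gcongr
        gcongr
    _ = _ := by ring

theorem sqrt_mul_sqrt_mul {u x y : ℝ} (hu : 0 < u) (hx : 0 < x) :
    Real.sqrt (u * y) * Real.sqrt (x * u) = u * (Real.sqrt x * Real.sqrt y) := by
  rw [Real.sqrt_mul hu.le, Real.sqrt_mul hx.le]
  have := Real.mul_self_sqrt hu.le
  linear_combination (Real.sqrt x * Real.sqrt y) * this

/-- The Hankel transform of the `K`-transform. The double integral need not converge absolutely, so
the outer integrand is multiplied by `exp(-εu²)`; both sides converge as `ε → 0` by dominated
convergence. -/
theorem hankelTransform_kTransform {ν : ℂ} (hν : -1 < ν.re) {f : ℝ → ℂ} {y : ℝ} (hy : 0 < y)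
    (hK : ∀ᵐ u ∂(volume.restrict (Ioi (0 : ℝ))), KExists ν f u)
    (hH : HankelExists ν (fun u => kTransform ν f u) y)
    (hP : WidderExists (fun x => (x : ℂ) ^ (-ν - 1 / 2) * f x) y) :
    hankelTransform ν (fun u => kTransform ν f u) y =
      (y : ℂ) ^ (ν + 1 / 2) * widderTransform (fun x => (x : ℂ) ^ (-ν - 1 / 2) * f x) y := by
  have hf := aestronglyMeasurable_of_widderExists hP
  obtain ⟨wt, δ, C, r, hδ, hδ1, hC, hr, hwint, hwt⟩ := exists_weight hν hf hK hy
  have htail := integrableOn_Ici_of_widderExists hP hδ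
  have hre : (-ν - 1 / 2 : ℂ).re - 1 = -ν.re - 3 / 2 := by simp; ring
  rw [hre] at htail
  have hyc : (y : ℂ) ≠ 0 := by exact_mod_cast hy.ne'
  -- the majorant of both dominated convergence arguments, up to constants
  have hdom : ∀ A B : ℝ, IntegrableOn (fun x =>
      (Ioo 0 δ).indicator (fun x => A * (Real.sqrt x * wt x * ‖f x‖)) x +
      (Ici δ).indicator (fun x => B * (x ^ (-ν.re - 3 / 2) * ‖f x‖)) x) (Ioi 0) := by
    intro A B
    have h1 : IntegrableOn (fun x => A * (Real.sqrt x * wt x * ‖f x‖)) (Ioo 0 δ) :=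
      hwint.const_mul A
    have h2 : IntegrableOn (fun x => B * (x ^ (-ν.re - 3 / 2) * ‖f x‖)) (Ici δ) :=
      htail.const_mul B
    exact ((h1.integrable_indicator measurableSet_Ioo).add
      (h2.integrable_indicator measurableSet_Ici)).integrableOn
  have hsq : ∀ x : ℝ, 0 < x → Real.sqrt x * x ^ (-ν.re - 2) = x ^ (-ν.re - 3 / 2) := by
    intro x hx
    rw [Real.sqrt_eq_rpow, ← Real.rpow_add hx]; congr 1; ring
  -- Gaussian regularisation of the left side
  have hlim1 : Tendsto (fun ε : ℝ => ∫ u in Ioi (0 : ℝ),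
      hankelIntegrand ν (fun u => kTransform ν f u) y u * (Real.exp (-(ε * u ^ 2)) : ℂ)) (𝓝[>] 0)
      (𝓝 (hankelTransform ν (fun u => kTransform ν f u) y)) := by
    refine tendsto_integral_filter_of_dominated_convergence
      (fun u => ‖hankelIntegrand ν (fun u => kTransform ν f u) y u‖) ?_ ?_ hH.norm ?_
    · refine .of_forall fun ε => hH.aestronglyMeasurable.mul ?_
      exact (Complex.measurable_ofReal.comp (by fun_prop)).aestronglyMeasurable
    · refine eventually_nhdsWithin_of_forall fun ε hε => .of_forall fun u => ?_
      rw [norm_mul, Complex.norm_real, Real.norm_of_nonneg (Real.exp_pos _).le]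
      refine mul_le_of_le_one_right (norm_nonneg _) (Real.exp_le_one_iff.2 ?_)
      have : 0 ≤ ε * u ^ 2 := mul_nonneg (le_of_lt hε) (sq_nonneg u)
      linarith
    · refine .of_forall fun u => ?_
      have hc : Continuous fun ε : ℝ => hankelIntegrand ν (fun u => kTransform ν f u) y u *
          (Real.exp (-(ε * u ^ 2)) : ℂ) :=
        continuous_const.mul (Complex.continuous_ofReal.comp (by fun_prop))
      have := (hc.tendsto 0).mono_left (nhdsWithin_le_nhds (s := Ioi 0))
      simpa using this
  set k : ℝ → ℝ → ℂ := fun ε x => (Real.sqrt x : ℂ) * (Real.sqrt y : ℂ) *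
    ((x : ℂ) ^ ν * (y : ℂ) ^ ν * ∫ t in Ioi (0 : ℝ), kernelIntegrand ν x y ε t) * f x with hk
  have hswap : ∀ ε : ℝ, 0 < ε → ∫ u in Ioi (0 : ℝ),
      hankelIntegrand ν (fun u => kTransform ν f u) y u * (Real.exp (-(ε * u ^ 2)) : ℂ) =
      ∫ x in Ioi (0 : ℝ), k ε x := by
    intro ε hε
    set Ψ : ℝ → ℝ → ℂ := fun u x => (Real.sqrt (u * y) : ℂ) * besselJ ν (u * y) *
      ((Real.sqrt (x * u) : ℂ) * besselK ν (x * u)) * (Real.exp (-(ε * u ^ 2)) : ℂ) * f x with hΨ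
    have hmeas : AEStronglyMeasurable (Function.uncurry Ψ)
        ((volume.restrict (Ioi (0 : ℝ))).prod (volume.restrict (Ioi (0 : ℝ)))) := by
      refine AEStronglyMeasurable.mul (Measurable.aestronglyMeasurable ?_) hf.comp_snd
      have h1 : Measurable fun p : ℝ × ℝ => (Real.sqrt (p.1 * y) : ℂ) :=
        Complex.measurable_ofReal.comp (by fun_prop)
      have h2 : Measurable fun p : ℝ × ℝ => besselJ ν (p.1 * y) :=
        (measurable_besselJ hν).comp (by fun_prop)
      have h3 : Measurable fun p : ℝ × ℝ => (Real.sqrt (p.2 * p.1) : ℂ) :=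
        Complex.measurable_ofReal.comp (by fun_prop)
      have h4 : Measurable fun p : ℝ × ℝ => besselK ν (p.2 * p.1) :=
        (measurable_besselK ν).comp (by fun_prop)
      have h5 : Measurable fun p : ℝ × ℝ => (Real.exp (-(ε * p.1 ^ 2)) : ℂ) :=
        Complex.measurable_ofReal.comp (by fun_prop)
      exact ((h1.mul h2).mul (h3.mul h4)).mul h5
    have hJm : Measurable fun u : ℝ => besselJ ν (u * y) :=
      (measurable_besselJ hν).comp (by fun_prop)
    have hΨn : ∀ u x : ℝ, 0 < u → 0 < x → ‖Ψ u x‖ = Real.sqrt x * Real.sqrt y * ‖f x‖ *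
        (u * ‖besselJ ν (u * y)‖ * ‖besselK ν (u * x)‖ * Real.exp (-(ε * u ^ 2))) := by
      intro u x hu hx
      simp only [hΨ]
      rw [norm_mul, norm_mul, norm_mul, norm_mul, norm_mul, norm_ofReal_sqrt, norm_ofReal_sqrt,
        Complex.norm_real, Real.norm_of_nonneg (Real.exp_pos _).le, mul_comm x u]
      have := sqrt_mul_sqrt_mul (y := y) hu hx
      rw [mul_comm x u] at this
      linear_combination (‖besselJ ν (u * y)‖ * ‖besselK ν (u * x)‖ * Real.exp (-(ε * u ^ 2)) *
        ‖f x‖) * this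
    have hBmeas : ∀ x : ℝ, AEStronglyMeasurable (fun u : ℝ =>
        u * ‖besselJ ν (u * y)‖ * ‖besselK ν (u * x)‖ * Real.exp (-(ε * u ^ 2)))
        (volume.restrict (Ioi 0)) := by
      intro x
      have h4 : Measurable fun u : ℝ => besselK ν (u * x) :=
        (measurable_besselK ν).comp (by fun_prop)
      exact (((measurable_id.mul hJm.norm).mul h4.norm).mul (by fun_prop)).aestronglyMeasurable
    have hmac : ∀ x : ℝ, 0 < x → ∀ u ∈ Ioi (0 : ℝ),
        u * ‖besselJ ν (u * y)‖ * ‖besselK ν (u * x)‖ * Real.exp (-(ε * u ^ 2)) ≤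
        u * ‖besselJ ν (u * y)‖ * macK ν.re (u * x) := by
      intro x hx u hu
      have hu0 : (0 : ℝ) < u := hu
      have h1 := norm_besselK_le ν (mul_pos hu0 hx)
      have h2 : Real.exp (-(ε * u ^ 2)) ≤ 1 := Real.exp_le_one_iff.2 (by
        have : 0 ≤ ε * u ^ 2 := by positivity
        linarith)
      have h3 := macK_nonneg ν.re (u * x)
      calc _ ≤ u * ‖besselJ ν (u * y)‖ * macK ν.re (u * x) * 1 := by gcongr
        _ = _ := mul_one _
    have hBint : ∀ x : ℝ, 0 < x → IntegrableOn (fun u : ℝ =>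
        u * ‖besselJ ν (u * y)‖ * ‖besselK ν (u * x)‖ * Real.exp (-(ε * u ^ 2))) (Ioi 0) := by
      intro x hx
      refine Integrable.mono' (integrableOn_mul_besselJ_mul_macK hν hx hy) (hBmeas x)
        ((ae_restrict_mem measurableSet_Ioi).mono fun u hu => ?_)
      have hu0 : (0 : ℝ) < u := hu
      rw [Real.norm_of_nonneg (by positivity)]
      exact hmac x hx u hu
    obtain ⟨D, hD, hDle⟩ := exists_integral_mul_besselJ_mul_macK_le hν hy hδ
    have hsmall := integrableOn_mul_besselJ_mul_exp hν hy hε hr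
    set E := ∫ u in Ioi (0 : ℝ), u * ‖besselJ ν (u * y)‖ * (1 + u ^ (-r)) *
      Real.exp (-(ε * u ^ 2)) with hE
    -- for `x < δ` only the Gaussian makes the integral over `u` of order `wt x`
    have hprod : Integrable (Function.uncurry Ψ)
        ((volume.restrict (Ioi (0 : ℝ))).prod (volume.restrict (Ioi (0 : ℝ)))) := by
      refine (integrable_prod_iff' hmeas).2 ⟨?_, ?_⟩
      · filter_upwards [hmeas.prod_swap.prodMk_left, ae_restrict_mem measurableSet_Ioi] with x hx hx0
        refine Integrable.mono' ((hBint x hx0).const_mul (Real.sqrt x * Real.sqrt y * ‖f x‖)) hx ?_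
        exact (ae_restrict_mem measurableSet_Ioi).mono fun u hu => (hΨn u x hu hx0).le
      · refine Integrable.mono' (hdom (Real.sqrt y * (C * E)) (Real.sqrt y * D))
          hmeas.norm.prod_swap.integral_prod_right' ?_
        refine (ae_restrict_mem measurableSet_Ioi).mono fun x hx => ?_
        have hx0 : (0 : ℝ) < x := hx
        rw [Real.norm_of_nonneg (integral_nonneg fun _ => norm_nonneg _)]
        have e1 : ∫ u in Ioi (0 : ℝ), ‖Function.uncurry Ψ (u, x)‖ =
            Real.sqrt x * Real.sqrt y * ‖f x‖ * ∫ u in Ioi (0 : ℝ), u * ‖besselJ ν (u * y)‖ *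
              ‖besselK ν (u * x)‖ * Real.exp (-(ε * u ^ 2)) := by
          rw [← integral_const_mul]
          exact setIntegral_congr_fun measurableSet_Ioi fun u hu => hΨn u x hu hx0
        rw [e1]
        rcases lt_or_ge x δ with hxδ | hxδ
        · rw [indicator_of_mem (show x ∈ Ioo 0 δ from ⟨hx0, hxδ⟩),
            indicator_of_notMem (show x ∉ Ici δ from not_le.2 hxδ), add_zero]
          obtain ⟨hw0, _, hw2⟩ := hwt x ⟨hx0, hxδ⟩
          have h2 : ∫ u in Ioi (0 : ℝ), u * ‖besselJ ν (u * y)‖ *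
              ‖besselK ν (u * x)‖ * Real.exp (-(ε * u ^ 2)) ≤ C * wt x * E := by
            rw [hE, ← integral_const_mul]
            refine setIntegral_mono_on (hBint x hx0) (hsmall.const_mul _) measurableSet_Ioi
              fun u hu => ?_
            have hu0 : (0 : ℝ) < u := hu
            have := hw2 u hu0
            calc _ ≤ u * ‖besselJ ν (u * y)‖ * (C * (1 + u ^ (-r)) * wt x) *
                  Real.exp (-(ε * u ^ 2)) := by gcongr
              _ = _ := by ring
          calc _ ≤ Real.sqrt x * Real.sqrt y * ‖f x‖ * (C * wt x * E) := by gcongr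
            _ = _ := by ring
        · rw [indicator_of_notMem (show x ∉ Ioo 0 δ from fun h => not_lt.2 hxδ h.2),
            indicator_of_mem (show x ∈ Ici δ from hxδ), zero_add]
          have h2 : ∫ u in Ioi (0 : ℝ), u * ‖besselJ ν (u * y)‖ *
              ‖besselK ν (u * x)‖ * Real.exp (-(ε * u ^ 2)) ≤ D * x ^ (-ν.re - 2) :=
            (setIntegral_mono_on (hBint x hx0) (integrableOn_mul_besselJ_mul_macK hν hx0 hy)
              measurableSet_Ioi (hmac x hx0)).trans (hDle x hxδ)
          calc _ ≤ Real.sqrt x * Real.sqrt y * ‖f x‖ * (D * x ^ (-ν.re - 2)) := by gcongr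
            _ = Real.sqrt y * D * ((Real.sqrt x * x ^ (-ν.re - 2)) * ‖f x‖) := by ring
            _ = _ := by rw [hsq x hx0]
    have hl : ∀ u : ℝ, hankelIntegrand ν (fun u => kTransform ν f u) y u *
        (Real.exp (-(ε * u ^ 2)) : ℂ) = ∫ x in Ioi (0 : ℝ), Ψ u x := by
      intro u
      simp only [hankelIntegrand, kTransform, kIntegrand]
      rw [mul_right_comm, ← integral_const_mul]
      refine setIntegral_congr_fun measurableSet_Ioi fun x _ => ?_
      simp only [hΨ]
      ring
    simp only [hl]
    rw [integral_integral_swap hprod]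
    refine setIntegral_congr_fun measurableSet_Ioi fun x hx => ?_
    have hx0 : (0 : ℝ) < x := hx
    simp only [hk]
    rw [← integral_besselJ_mul_truncK hν hx0 hy hε.le le_rfl, ← integral_const_mul,
      ← integral_mul_const]
    refine setIntegral_congr_fun measurableSet_Ioi fun u hu => ?_
    have hu0 : (0 : ℝ) < u := hu
    simp only [hΨ]
    rw [← besselK_eq_truncK ν (mul_pos hu0 hx0), mul_comm u x]
    have h1 : (Real.sqrt (u * y) : ℂ) * (Real.sqrt (x * u) : ℂ) =
        u * ((Real.sqrt x : ℂ) * (Real.sqrt y : ℂ)) := by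
      exact_mod_cast sqrt_mul_sqrt_mul (y := y) hu0 hx0
    linear_combination (besselJ ν (u * y) * besselK ν (x * u) * (Real.exp (-(ε * u ^ 2)) : ℂ) *
      f x) * h1
  have hlim2 : Tendsto (fun ε : ℝ => ∫ x in Ioi (0 : ℝ), k ε x) (𝓝[>] 0)
      (𝓝 (∫ x in Ioi (0 : ℝ), k 0 x)) := by
    refine tendsto_integral_filter_of_dominated_convergence _ ?_ ?_
      (hdom (Real.sqrt y * y ^ ν.re * C) (Real.sqrt y * y ^ ν.re)) ?_
    · refine .of_forall fun ε => AEStronglyMeasurable.mul (Measurable.aestronglyMeasurable ?_) hf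
      have h1 : Measurable fun x : ℝ => ∫ t in Ioi (0 : ℝ), kernelIntegrand ν x y ε t :=
        (measurable_kernelIntegrand ν y ε).stronglyMeasurable.integral_prod_right.measurable
      have h2 : Measurable fun x : ℝ => (Real.sqrt x : ℂ) :=
        Complex.measurable_ofReal.comp (by fun_prop)
      exact (h2.mul_const _).mul (((Complex.measurable_ofReal.pow_const ν).mul_const _).mul h1)
    · have hε1 : ∀ᶠ ε : ℝ in 𝓝[>] 0, ε ∈ Ioo (0 : ℝ) 1 := Ioo_mem_nhdsGT one_pos
      filter_upwards [hε1] with ε hε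
      refine (ae_restrict_mem measurableSet_Ioi).mono fun x hx => ?_
      have hx0 : (0 : ℝ) < x := hx
      simp only [hk]
      rw [norm_mul, norm_mul, norm_mul, norm_mul, norm_mul, norm_ofReal_sqrt, norm_ofReal_sqrt,
        norm_cpow_real hx0, norm_cpow_real hy]
      rcases lt_or_ge x δ with hxδ | hxδ
      · rw [indicator_of_mem (show x ∈ Ioo 0 δ from ⟨hx0, hxδ⟩),
          indicator_of_notMem (show x ∉ Ici δ from not_le.2 hxδ), add_zero]
        have h1 := (hwt x ⟨hx0, hxδ⟩).2.1 ε hε.1 hε.2.le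
        calc _ = Real.sqrt x * Real.sqrt y * y ^ ν.re * ‖f x‖ *
              (x ^ ν.re * ‖∫ t in Ioi (0 : ℝ), kernelIntegrand ν x y ε t‖) := by ring
          _ ≤ Real.sqrt x * Real.sqrt y * y ^ ν.re * ‖f x‖ * (C * wt x) := by gcongr
          _ = _ := by ring
      · rw [indicator_of_notMem (show x ∉ Ioo 0 δ from fun h => not_lt.2 hxδ h.2),
          indicator_of_mem (show x ∈ Ici δ from hxδ), zero_add]
        have h1 := norm_integral_kernelIntegrand_le (b := y) hν hx0 hε.1.le
        have h2 : x ^ ν.re * (x ^ 2) ^ (-ν.re - 1) = x ^ (-ν.re - 2) := by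
          rw [← Real.rpow_natCast x 2, ← Real.rpow_mul hx0.le, ← Real.rpow_add hx0]
          congr 1; push_cast; ring
        calc _ ≤ Real.sqrt x * Real.sqrt y * (x ^ ν.re * y ^ ν.re * (x ^ 2) ^ (-ν.re - 1)) *
              ‖f x‖ := by gcongr
          _ = Real.sqrt y * y ^ ν.re * ((Real.sqrt x * (x ^ ν.re * (x ^ 2) ^ (-ν.re - 1))) *
              ‖f x‖) := by ring
          _ = _ := by rw [h2, hsq x hx0]
    · refine (ae_restrict_mem measurableSet_Ioi).mono fun x hx => ?_
      exact (((tendsto_integral_kernelIntegrand hν hx).const_mul _).const_mul _).mul_const _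
  have heq : (fun ε : ℝ => ∫ u in Ioi (0 : ℝ), hankelIntegrand ν (fun u => kTransform ν f u) y u *
      (Real.exp (-(ε * u ^ 2)) : ℂ)) =ᶠ[𝓝[>] 0] fun ε => ∫ x in Ioi (0 : ℝ), k ε x :=
    eventually_nhdsWithin_of_forall fun ε hε => hswap ε hε
  rw [tendsto_nhds_unique (hlim1.congr' heq) hlim2, widderTransform, ← integral_const_mul]
  refine setIntegral_congr_fun measurableSet_Ioi fun x hx => ?_
  have hx0 : (0 : ℝ) < x := hx
  have hxc : (x : ℂ) ≠ 0 := by exact_mod_cast hx0.ne'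
  simp only [hk, widderIntegrand]
  rw [integral_kernelIntegrand_zero ν 0 hx0, mul_zero, neg_zero, Real.exp_zero, Complex.ofReal_one,
    ofReal_sqrt_eq_cpow hx0.le, ofReal_sqrt_eq_cpow hy.le, Complex.cpow_add _ _ hyc,
    Complex.cpow_sub _ _ hxc, Complex.cpow_neg, Complex.cpow_neg]
  have h1 : ((x ^ 2 : ℝ) : ℂ) ^ ν = (x : ℂ) ^ ν * (x : ℂ) ^ ν := by
    rw [pow_two, Complex.ofReal_mul, Complex.mul_cpow_ofReal_nonneg hx0.le hx0.le]
  have h2 : (x : ℂ) ^ (1 / 2 : ℂ) * (x : ℂ) ^ (1 / 2 : ℂ) = x := by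
    rw [← Complex.cpow_add _ _ hxc]; norm_num
  have h3 : (x : ℂ) ^ ν ≠ 0 := by rw [Complex.cpow_ne_zero_iff]; exact Or.inl hxc
  have h4 : (x : ℂ) ^ (1 / 2 : ℂ) ≠ 0 := by rw [Complex.cpow_ne_zero_iff]; exact Or.inl hxc
  rw [h1]
  generalize (x : ℂ) ^ (1 / 2 : ℂ) = q at h2 h4 ⊢
  rw [← h2]
  field_simp

/-! ### Integrability at infinity from the Hankel transform -/

/-- A function that is finite almost everywhere is bounded outside a set of small measure. -/
theorem exists_measurableSet_le_of_ae_lt_top {α : Type*} [MeasurableSpace α] {μ : Measure α}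
    [IsFiniteMeasure μ] {G : α → ENNReal} (hG : AEMeasurable G μ) (hfin : ∀ᵐ a ∂μ, G a < ⊤)
    {η : ENNReal} (hη : 0 < η) :
    ∃ (A : Set α) (M : ℕ), MeasurableSet A ∧ μ Aᶜ ≤ η ∧ ∀ᵐ a ∂μ, a ∈ A → G a ≤ M := by
  set g := hG.mk G with hg
  have hgm : Measurable g := hG.measurable_mk
  have hAm : ∀ n : ℕ, MeasurableSet {a | g a ≤ n} := fun n => measurableSet_le hgm measurable_const
  have hzero : μ (⋂ n : ℕ, {a | g a ≤ n}ᶜ) = 0 := by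
    have h1 : ∀ᵐ a ∂μ, g a < ⊤ := by
      filter_upwards [hfin, hG.ae_eq_mk] with a h1 h2
      show hG.mk G a < ⊤
      rwa [← h2]
    refine measure_mono_null (fun a ha => ?_) (ae_iff.1 h1)
    simp only [mem_iInter, mem_compl_iff, mem_ofPred_eq, not_le] at ha
    simp only [mem_ofPred_eq, not_lt, top_le_iff]
    by_contra hne
    obtain ⟨n, hn⟩ := ENNReal.exists_nat_gt hne
    exact absurd (ha n) (not_lt.2 hn.le)
  have hlim := tendsto_measure_iInter_atTop (μ := μ) (s := fun n : ℕ => {a | g a ≤ n}ᶜ)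
    (fun n => (hAm n).compl.nullMeasurableSet)
    (fun m n hmn => compl_subset_compl.2 fun a ha => le_trans (show g a ≤ m from ha) (by exact_mod_cast hmn))
    ⟨0, measure_ne_top _ _⟩
  rw [hzero] at hlim
  obtain ⟨M, hM⟩ := (hlim.eventually (Iio_mem_nhds hη)).exists
  refine ⟨{a | g a ≤ M}, M, hAm M, le_of_lt hM, ?_⟩
  filter_upwards [hG.ae_eq_mk] with a ha hmem
  rw [ha]; exact hmem

theorem measurable_sqrt_mul_besselJ {ν : ℂ} (hν : -1 < ν.re) :
    Measurable fun z : ℝ => (Real.sqrt z : ℂ) * besselJ ν z :=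
  (Complex.measurable_ofReal.comp (by fun_prop)).mul (measurable_besselJ hν)

/-- A Denjoy–Lusin argument: if the Hankel transform of `f` exists at almost every `u`, then `f` is
integrable at infinity, because `√(xu) |J_ν(xu)|` has a positive mean over every set of `u` that
nearly fills `[1, 2]`. -/
theorem exists_integrableOn_of_hankelExists {ν : ℂ} (hν : -1 < ν.re) {f : ℝ → ℂ}
    (hf : AEStronglyMeasurable f (volume.restrict (Ioi 0)))
    (h : ∀ᵐ u ∂(volume.restrict (Ioi (0 : ℝ))), HankelExists ν f u) :
    ∃ X : ℝ, 1 ≤ X ∧ IntegrableOn f (Ici X) := by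
  obtain ⟨c, X, hc, hX, hmean⟩ := exists_le_integral_norm_sqrt_mul_besselJ hν
  obtain ⟨C, hC, hbd⟩ := exists_norm_sqrt_mul_besselJ_le hν
  have hXpos : Ici X ⊆ Ioi (0 : ℝ) := fun x hx => lt_of_lt_of_le (by linarith : (0 : ℝ) < X) hx
  refine ⟨X, hX, hf.mono_measure (Measure.restrict_mono hXpos le_rfl), ?_⟩
  set μ := volume.restrict (Ioc (1 : ℝ) 2) with hμ
  have hsub : Ioc (1 : ℝ) 2 ⊆ Ioi 0 := fun u hu => lt_trans one_pos hu.1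
  have hmw : Measurable fun p : ℝ × ℝ =>
      (Real.sqrt (p.2 * p.1) : ℂ) * besselJ ν (p.2 * p.1) :=
    (measurable_sqrt_mul_besselJ hν).comp (by fun_prop)
  set G : ℝ → ENNReal := fun u => ∫⁻ x in Ici X, ‖hankelIntegrand ν f u x‖ₑ with hG
  have hjoint : AEMeasurable (fun p : ℝ × ℝ => ‖hankelIntegrand ν f p.1 p.2‖ₑ)
      (μ.prod (volume.restrict (Ici X))) :=
    ((hmw.aestronglyMeasurable).mul (hf.mono_measure
      (Measure.restrict_mono hXpos le_rfl)).comp_snd).enorm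
  have hGm : AEMeasurable G μ := hjoint.lintegral_prod_right'
  have hGfin : ∀ᵐ u ∂μ, G u < ⊤ := by
    filter_upwards [ae_restrict_of_ae_restrict_of_subset hsub h] with u hu
    exact lt_of_le_of_lt (lintegral_mono_set hXpos) hu.2
  obtain ⟨A, M, hA, hAc, hAM⟩ := exists_measurableSet_le_of_ae_lt_top hGm hGfin
    (η := ENNReal.ofReal (c / (2 * C))) (by rw [ENNReal.ofReal_pos]; positivity)
  -- the mean over `[1, 2]` is at least `c`, and the part over `Aᶜ` takes away at most `C · c/(2C)`
  have hlow : ∀ x ∈ Ici X, ENNReal.ofReal (c / 2) ≤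
      ∫⁻ u in A, ‖(Real.sqrt (x * u) : ℂ) * besselJ ν (x * u)‖ₑ ∂μ := by
    intro x hx
    have hx1 : 1 ≤ x := hX.trans hx
    have hb : ∀ u ∈ Ioc (1 : ℝ) 2, ‖(Real.sqrt (x * u) : ℂ) * besselJ ν (x * u)‖ ≤ C := by
      intro u hu
      exact hbd _ (by nlinarith [hu.1])
    have h1 := hmean x hx
    rw [intervalIntegral.integral_of_le one_le_two] at h1
    have h2 : ENNReal.ofReal c ≤ ∫⁻ u, ‖(Real.sqrt (x * u) : ℂ) * besselJ ν (x * u)‖ₑ ∂μ := by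
      refine (ENNReal.ofReal_le_ofReal h1).trans ?_
      rw [integral_norm_eq_lintegral_enorm]
      · exact ENNReal.ofReal_toReal_le
      · exact ((measurable_sqrt_mul_besselJ hν).comp (by fun_prop)).aestronglyMeasurable
    rw [← lintegral_add_compl _ hA] at h2
    have h3 : ∫⁻ u in Aᶜ, ‖(Real.sqrt (x * u) : ℂ) * besselJ ν (x * u)‖ₑ ∂μ ≤
        ENNReal.ofReal (c / 2) := by
      calc _ ≤ ∫⁻ _ in Aᶜ, ENNReal.ofReal C ∂μ := by
            refine lintegral_mono_ae (ae_restrict_of_ae ?_)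
            refine (ae_restrict_mem measurableSet_Ioc).mono fun u hu => ?_
            rw [← ofReal_norm]
            exact ENNReal.ofReal_le_ofReal (hb u hu)
        _ = ENNReal.ofReal C * μ Aᶜ := by rw [setLIntegral_const]
        _ ≤ ENNReal.ofReal C * ENNReal.ofReal (c / (2 * C)) := by gcongr
        _ = _ := by
            rw [← ENNReal.ofReal_mul hC.le]; congr 1; field_simp
    have h4 : ENNReal.ofReal (c / 2) + ENNReal.ofReal (c / 2) = ENNReal.ofReal c := by
      rw [← ENNReal.ofReal_add (by positivity) (by positivity)]; congr 1; ring
    rw [← h4] at h2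
    exact (ENNReal.add_le_add_iff_right ENNReal.ofReal_ne_top).1
      (h2.trans (add_le_add_right h3 _))
  -- on `A` the inner integrals are at most `M`, so Tonelli's theorem bounds `∫ |f|`
  have hmain : ENNReal.ofReal (c / 2) * ∫⁻ x in Ici X, ‖f x‖ₑ ≤ M := by
    calc ENNReal.ofReal (c / 2) * ∫⁻ x in Ici X, ‖f x‖ₑ
        = ∫⁻ x in Ici X, ENNReal.ofReal (c / 2) * ‖f x‖ₑ := by
          rw [lintegral_const_mul' _ _ ENNReal.ofReal_ne_top]
      _ ≤ ∫⁻ x in Ici X, ∫⁻ u in A, ‖hankelIntegrand ν f u x‖ₑ ∂μ := by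
          refine setLIntegral_mono_ae' measurableSet_Ici (.of_forall fun x hx => ?_)
          have e : ∀ u, ‖hankelIntegrand ν f u x‖ₑ =
              ‖(Real.sqrt (x * u) : ℂ) * besselJ ν (x * u)‖ₑ * ‖f x‖ₑ := fun u => by
            rw [hankelIntegrand, enorm_mul]
          simp only [e]
          have hxm : Measurable fun u : ℝ => (Real.sqrt (x * u) : ℂ) * besselJ ν (x * u) :=
            (measurable_sqrt_mul_besselJ hν).comp (by fun_prop)
          rw [lintegral_mul_const _ hxm.enorm]
          gcongr
          exact hlow x hx
      _ = ∫⁻ u in A, G u ∂μ := by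
          rw [lintegral_lintegral_swap]
          refine AEMeasurable.mono_measure hjoint.prod_swap ?_
          exact Measure.prod_mono le_rfl Measure.restrict_le_self
      _ ≤ ∫⁻ _ in A, (M : ENNReal) ∂μ := by
          refine lintegral_mono_ae ?_
          filter_upwards [ae_restrict_of_ae hAM, ae_restrict_mem hA] with u h1 h2 using h1 h2
      _ ≤ M := by
          rw [setLIntegral_const]
          refine mul_le_of_le_one_right (by simp) ((measure_mono (subset_univ _)).trans ?_)
          rw [hμ, Measure.restrict_apply_univ, Real.volume_Ioc]
          norm_num
  rw [hasFiniteIntegral_iff_enorm]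
  by_contra hcon
  rw [not_lt, top_le_iff] at hcon
  rw [hcon, ENNReal.mul_top (by rw [Ne, ENNReal.ofReal_eq_zero, not_le]; positivity)] at hmain
  exact absurd hmain (by simp)

/-! ### The `K`-transform of the Hankel transform -/

theorem integrableOn_Ioo_of_widderExists {a : ℂ} {f : ℝ → ℂ} {y : ℝ}
    (h : WidderExists (fun x => (x : ℂ) ^ a * f x) y) (X : ℝ) :
    IntegrableOn (fun x => x ^ (a.re + 1) * ‖f x‖) (Ioo 0 X) := by
  have hsub : Ioo 0 X ⊆ Ioi (0 : ℝ) := fun x hx => hx.1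
  have hW₀ : IntegrableOn (fun x => (X ^ 2 + y ^ 2) *
      ‖widderIntegrand (fun x => (x : ℂ) ^ a * f x) y x‖) (Ioi 0) := h.norm.const_mul _
  refine Integrable.mono' (hW₀.mono_set hsub) (AEStronglyMeasurable.mul
    (Measurable.aestronglyMeasurable (by fun_prop))
    ((aestronglyMeasurable_of_widderExists h).mono_measure
      (Measure.restrict_mono hsub le_rfl)).norm)
    ((ae_restrict_mem measurableSet_Ioo).mono fun x hx => ?_)
  have hx0 : 0 < x := hx.1
  rw [Real.norm_of_nonneg (by positivity), norm_widderIntegrand _ _ _ hx0, ← mul_div_assoc,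
    le_div_iff₀ (by positivity), mul_comm]
  have := hx.2.le
  gcongr

theorem exists_integral_mul_besselJ_mul_macK_le_rpow {ν : ℂ} (hν : -1 < ν.re) {y : ℝ} (hy : 0 < y)
    (X : ℝ) : ∃ D : ℝ, ∀ x : ℝ, 0 < x → x < X →
      ∫ u in Ioi (0 : ℝ), u * ‖besselJ ν (u * x)‖ * macK ν.re (u * y) ≤ D * x ^ ν.re := by
  obtain ⟨C, hC, hJ⟩ := exists_norm_besselJ_le hν
  have habs : |ν.re| < ν.re + 2 := abs_lt.2 ⟨by linarith, by linarith⟩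
  have h1 := integrableOn_rpow_mul_macK_comp_mul (a := ν.re + 1) (s := ν.re) (by linarith) hy
  have h2 := integrableOn_rpow_mul_macK_comp_mul (a := ν.re + 2) (s := ν.re) (by linarith) hy
  have hg : IntegrableOn (fun u : ℝ => u ^ (ν.re + 1) * macK ν.re (y * u) +
      X * (u ^ (ν.re + 2) * macK ν.re (y * u))) (Ioi 0) := h1.add (h2.const_mul X)
  refine ⟨C * ∫ u in Ioi (0 : ℝ), (u ^ (ν.re + 1) * macK ν.re (y * u) +
      X * (u ^ (ν.re + 2) * macK ν.re (y * u))), fun x hx hxX => ?_⟩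
  rw [mul_right_comm, ← integral_const_mul]
  refine setIntegral_mono_on (integrableOn_mul_besselJ_mul_macK hν hy hx) (hg.const_mul _)
    measurableSet_Ioi fun u hu => ?_
  have hu0 : (0 : ℝ) < u := hu
  have hK := macK_nonneg ν.re (u * y)
  have := hJ (u * x) (by positivity)
  calc u * ‖besselJ ν (u * x)‖ * macK ν.re (u * y)
      ≤ u * (C * ((u * x) ^ ν.re * (1 + u * X))) * macK ν.re (u * y) := by
        gcongr
        refine this.trans ?_
        gcongr
    _ = _ := by
      rw [Real.mul_rpow hu0.le hx.le, Real.rpow_add hu0, Real.rpow_add hu0, Real.rpow_one,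
        Real.rpow_two, mul_comm y u]
      ring

/-- Interchange of the order of integration for a truncated Macdonald function, with the resulting
kernel in closed form. -/
theorem integral_truncK_mul_hankelTransform {ν : ℂ} (hν : -1 < ν.re) {f : ℝ → ℂ} {y η X : ℝ}
    (hy : 0 < y) (hη : 0 ≤ η) (hX : 1 ≤ X) (hfX : IntegrableOn f (Ici X))
    (hP : WidderExists (fun x => (x : ℂ) ^ (ν - 1 / 2) * f x) y)
    (hκ : IntegrableOn (fun u : ℝ => Real.sqrt u * (1 + u ^ min 0 (ν.re + 1 / 2)) *
      ‖truncK ν η (u * y)‖) (Ioi 0)) :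
    ∫ u in Ioi (0 : ℝ), (Real.sqrt (u * y) : ℂ) * truncK ν η (u * y) * hankelTransform ν f u =
      (y : ℂ) ^ (-ν + 1 / 2) * ∫ x in Ioi (0 : ℝ),
        widderIntegrand (fun x => (x : ℂ) ^ (ν - 1 / 2) * f x) y x *
          (Real.exp (-((1 + x ^ 2 / y ^ 2) * η)) : ℂ) := by
  have hf := aestronglyMeasurable_of_widderExists hP
  have hhead := integrableOn_Ioo_of_widderExists hP X
  have hre : (ν - 1 / 2 : ℂ).re + 1 = ν.re + 1 / 2 := by simp; ring
  rw [hre] at hhead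
  have hyc : (y : ℂ) ≠ 0 := by exact_mod_cast hy.ne'
  set Ψ : ℝ → ℝ → ℂ := fun u x => (Real.sqrt (u * y) : ℂ) * truncK ν η (u * y) *
    ((Real.sqrt (x * u) : ℂ) * besselJ ν (x * u)) * f x with hΨ
  have hmeas : AEStronglyMeasurable (Function.uncurry Ψ)
      ((volume.restrict (Ioi (0 : ℝ))).prod (volume.restrict (Ioi (0 : ℝ)))) := by
    refine AEStronglyMeasurable.mul (Measurable.aestronglyMeasurable ?_) hf.comp_snd
    have h1 : Measurable fun p : ℝ × ℝ => (Real.sqrt (p.1 * y) : ℂ) :=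
      Complex.measurable_ofReal.comp (by fun_prop)
    have h2 : Measurable fun p : ℝ × ℝ => truncK ν η (p.1 * y) :=
      (measurable_truncK ν η).comp (by fun_prop)
    have h3 : Measurable fun p : ℝ × ℝ =>
        (Real.sqrt (p.2 * p.1) : ℂ) * besselJ ν (p.2 * p.1) :=
      (measurable_sqrt_mul_besselJ hν).comp (by fun_prop)
    exact (h1.mul h2).mul h3
  have hΨn : ∀ u x : ℝ, 0 < u → 0 < x → ‖Ψ u x‖ = Real.sqrt x * Real.sqrt y * ‖f x‖ *
      (u * ‖besselJ ν (u * x)‖ * ‖truncK ν η (u * y)‖) := by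
    intro u x hu hx
    simp only [hΨ]
    rw [norm_mul, norm_mul, norm_mul, norm_mul, norm_ofReal_sqrt, norm_ofReal_sqrt, mul_comm u x]
    have := sqrt_mul_sqrt_mul (y := y) hu hx
    linear_combination (‖besselJ ν (x * u)‖ * ‖truncK ν η (u * y)‖ * ‖f x‖) * this
  have hmac : ∀ x : ℝ, ∀ u ∈ Ioi (0 : ℝ), u * ‖besselJ ν (u * x)‖ * ‖truncK ν η (u * y)‖ ≤
      u * ‖besselJ ν (u * x)‖ * macK ν.re (u * y) := by
    intro x u hu
    have hu0 : (0 : ℝ) < u := hu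
    have := norm_truncK_le ν hη (mul_pos hu0 hy)
    gcongr
  have hBint : ∀ x : ℝ, 0 < x → IntegrableOn (fun u : ℝ =>
      u * ‖besselJ ν (u * x)‖ * ‖truncK ν η (u * y)‖) (Ioi 0) := by
    intro x hx
    have hJm : Measurable fun u : ℝ => besselJ ν (u * x) :=
      (measurable_besselJ hν).comp (by fun_prop)
    have hTm : Measurable fun u : ℝ => truncK ν η (u * y) :=
      (measurable_truncK ν η).comp (by fun_prop)
    refine Integrable.mono' (integrableOn_mul_besselJ_mul_macK hν hy hx)
      ((measurable_id.mul hJm.norm).mul hTm.norm).aestronglyMeasurable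
      ((ae_restrict_mem measurableSet_Ioi).mono fun u hu => ?_)
    have hu0 : (0 : ℝ) < u := hu
    rw [Real.norm_of_nonneg (by positivity)]
    exact hmac x u hu
  obtain ⟨D, hD⟩ := exists_integral_mul_besselJ_mul_macK_le_rpow hν hy X
  obtain ⟨C, hC, hJ⟩ := exists_norm_sqrt_mul_besselJ_le_min hν
  set I := ∫ u in Ioi (0 : ℝ), Real.sqrt u * (1 + u ^ min 0 (ν.re + 1 / 2)) *
    ‖truncK ν η (u * y)‖ with hI
  have hdom : Integrable (fun x =>
      (Ioo 0 X).indicator (fun x => Real.sqrt y * D * (x ^ (ν.re + 1 / 2) * ‖f x‖)) x +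
      (Ici X).indicator (fun x => Real.sqrt y * C * I * ‖f x‖) x)
      (volume.restrict (Ioi 0)) := by
    have h1 : IntegrableOn (fun x => Real.sqrt y * D * (x ^ (ν.re + 1 / 2) * ‖f x‖)) (Ioo 0 X) :=
      hhead.const_mul _
    have h2 : IntegrableOn (fun x => Real.sqrt y * C * I * ‖f x‖) (Ici X) :=
      hfX.norm.const_mul _
    exact ((h1.integrable_indicator measurableSet_Ioo).add
      (h2.integrable_indicator measurableSet_Ici)).integrableOn
  -- for `x < X` the potential transform controls `f`, for `x ≥ X` its integrability does
  have hprod : Integrable (Function.uncurry Ψ)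
      ((volume.restrict (Ioi (0 : ℝ))).prod (volume.restrict (Ioi (0 : ℝ)))) := by
    refine (integrable_prod_iff' hmeas).2 ⟨?_, ?_⟩
    · filter_upwards [hmeas.prod_swap.prodMk_left, ae_restrict_mem measurableSet_Ioi] with x hx hx0
      refine Integrable.mono' ((hBint x hx0).const_mul (Real.sqrt x * Real.sqrt y * ‖f x‖)) hx ?_
      exact (ae_restrict_mem measurableSet_Ioi).mono fun u hu => (hΨn u x hu hx0).le
    · refine Integrable.mono' hdom hmeas.norm.prod_swap.integral_prod_right' ?_
      refine (ae_restrict_mem measurableSet_Ioi).mono fun x hx => ?_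
      have hx0 : (0 : ℝ) < x := hx
      rw [Real.norm_of_nonneg (integral_nonneg fun _ => norm_nonneg _)]
      have e1 : ∫ u in Ioi (0 : ℝ), ‖Function.uncurry Ψ (u, x)‖ =
          Real.sqrt x * Real.sqrt y * ‖f x‖ * ∫ u in Ioi (0 : ℝ), u * ‖besselJ ν (u * x)‖ *
            ‖truncK ν η (u * y)‖ := by
        rw [← integral_const_mul]
        exact setIntegral_congr_fun measurableSet_Ioi fun u hu => hΨn u x hu hx0
      rcases lt_or_ge x X with hxX | hxX
      · rw [indicator_of_mem (show x ∈ Ioo 0 X from ⟨hx0, hxX⟩),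
          indicator_of_notMem (show x ∉ Ici X from not_le.2 hxX), add_zero]
        have h2 : ∫ u in Ioi (0 : ℝ), u * ‖besselJ ν (u * x)‖ * ‖truncK ν η (u * y)‖ ≤
            D * x ^ ν.re :=
          (setIntegral_mono_on (hBint x hx0) (integrableOn_mul_besselJ_mul_macK hν hy hx0)
            measurableSet_Ioi (hmac x)).trans (hD x hx0 hxX)
        refine e1.le.trans ?_
        calc _ ≤ Real.sqrt x * Real.sqrt y * ‖f x‖ * (D * x ^ ν.re) := by gcongr
          _ = _ := by rw [Real.rpow_add hx0, ← Real.sqrt_eq_rpow]; ring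
      · rw [indicator_of_notMem (show x ∉ Ioo 0 X from fun h => not_lt.2 hxX h.2),
          indicator_of_mem (show x ∈ Ici X from hxX), zero_add]
        have h3 : ∫ u in Ioi (0 : ℝ), ‖Function.uncurry Ψ (u, x)‖ ≤
            ∫ u in Ioi (0 : ℝ), Real.sqrt y * C * ‖f x‖ *
              (Real.sqrt u * (1 + u ^ min 0 (ν.re + 1 / 2)) * ‖truncK ν η (u * y)‖) := by
          refine integral_mono_of_nonneg (.of_forall fun _ => norm_nonneg _) (hκ.const_mul _)
            ((ae_restrict_mem measurableSet_Ioi).mono fun u hu => ?_)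
          have hu0 : (0 : ℝ) < u := hu
          have h4 := hJ (x * u) (by positivity)
          have h5 : (x * u) ^ min 0 (ν.re + 1 / 2) ≤ u ^ min 0 (ν.re + 1 / 2) := by
            rw [Real.mul_rpow hx0.le hu0.le]
            exact mul_le_of_le_one_left (by positivity)
              (Real.rpow_le_one_of_one_le_of_nonpos (hX.trans hxX) (min_le_left _ _))
          simp only [Function.uncurry_apply_pair, hΨ]
          rw [norm_mul, norm_mul, norm_mul, norm_ofReal_sqrt, Real.sqrt_mul hu0.le]
          calc _ ≤ Real.sqrt u * Real.sqrt y * ‖truncK ν η (u * y)‖ *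
                (C * (1 + u ^ min 0 (ν.re + 1 / 2))) * ‖f x‖ := by
                gcongr
                exact h4.trans (by gcongr)
            _ = _ := by ring
        refine h3.trans (le_of_eq ?_)
        rw [integral_const_mul, ← hI]
        ring
  have hl : ∀ u : ℝ, (Real.sqrt (u * y) : ℂ) * truncK ν η (u * y) * hankelTransform ν f u =
      ∫ x in Ioi (0 : ℝ), Ψ u x := by
    intro u
    simp only [hankelTransform, hankelIntegrand]
    rw [← integral_const_mul]
    refine setIntegral_congr_fun measurableSet_Ioi fun x _ => ?_
    simp only [hΨ]
    ring
  simp only [hl]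
  rw [integral_integral_swap hprod, ← integral_const_mul]
  refine setIntegral_congr_fun measurableSet_Ioi fun x hx => ?_
  have hx0 : (0 : ℝ) < x := hx
  have hxc : (x : ℂ) ≠ 0 := by exact_mod_cast hx0.ne'
  have hker := integral_besselJ_mul_truncK hν hy hx0 (ε := 0) le_rfl hη
  rw [integral_kernelIntegrand_zero ν η hy] at hker
  have e2 : ∫ u in Ioi (0 : ℝ), Ψ u x = (Real.sqrt x : ℂ) * (Real.sqrt y : ℂ) * f x *
      ∫ u in Ioi (0 : ℝ), (u : ℂ) * besselJ ν (u * x) * truncK ν η (u * y) *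
        (Real.exp (-(0 * u ^ 2)) : ℂ) := by
    rw [← integral_const_mul]
    refine setIntegral_congr_fun measurableSet_Ioi fun u hu => ?_
    have hu0 : (0 : ℝ) < u := hu
    simp only [hΨ]
    rw [zero_mul, neg_zero, Real.exp_zero, Complex.ofReal_one, mul_comm u x]
    have h1 : (Real.sqrt (u * y) : ℂ) * (Real.sqrt (x * u) : ℂ) =
        u * ((Real.sqrt x : ℂ) * (Real.sqrt y : ℂ)) := by
      exact_mod_cast sqrt_mul_sqrt_mul (y := y) hu0 hx0
    linear_combination (besselJ ν (x * u) * truncK ν η (u * y) * f x) * h1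
  simp only [widderIntegrand]
  rw [e2, hker, ofReal_sqrt_eq_cpow hx0.le, ofReal_sqrt_eq_cpow hy.le, Complex.cpow_add _ _ hyc,
    Complex.cpow_sub _ _ hxc, Complex.cpow_neg, Complex.cpow_neg]
  have h1 : ((y ^ 2 : ℝ) : ℂ) ^ ν = (y : ℂ) ^ ν * (y : ℂ) ^ ν := by
    rw [pow_two, Complex.ofReal_mul, Complex.mul_cpow_ofReal_nonneg hy.le hy.le]
  have h2 : (x : ℂ) ^ (1 / 2 : ℂ) * (x : ℂ) ^ (1 / 2 : ℂ) = x := by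
    rw [← Complex.cpow_add _ _ hxc]; norm_num
  have h3 : (y : ℂ) ^ ν ≠ 0 := by rw [Complex.cpow_ne_zero_iff]; exact Or.inl hyc
  have h4 : (x : ℂ) ^ (1 / 2 : ℂ) ≠ 0 := by rw [Complex.cpow_ne_zero_iff]; exact Or.inl hxc
  rw [h1, add_comm ((y : ℂ) ^ 2)]
  generalize (x : ℂ) ^ (1 / 2 : ℂ) = q at h2 h4 ⊢
  rw [show (x : ℂ) * ((x : ℂ) ^ ν / q * f x) = q * q * ((x : ℂ) ^ ν / q * f x) by rw [h2]]
  field_simp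

/-- The Hankel transform grows at most polynomially: `f` is controlled by the potential transform on
`(0, X)` and is integrable on `[X, ∞)`. -/
theorem exists_norm_hankelTransform_le {ν : ℂ} (hν : -1 < ν.re) {f : ℝ → ℂ} {y X : ℝ}
    (hX : 1 ≤ X) (hfX : IntegrableOn f (Ici X))
    (hP : WidderExists (fun x => (x : ℂ) ^ (ν - 1 / 2) * f x) y) :
    ∃ A B : ℝ, 0 ≤ A ∧ 0 ≤ B ∧ ∀ u : ℝ, 0 < u → ‖hankelTransform ν f u‖ ≤
      A * (u ^ (ν.re + 1 / 2) * (1 + u)) + B * (1 + u ^ min 0 (ν.re + 1 / 2)) := by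
  have hhead := integrableOn_Ioo_of_widderExists hP X
  have hre : (ν - 1 / 2 : ℂ).re + 1 = ν.re + 1 / 2 := by simp; ring
  rw [hre] at hhead
  obtain ⟨C₁, hC₁, h₁⟩ := exists_norm_besselJ_le hν
  obtain ⟨C₂, hC₂, h₂⟩ := exists_norm_sqrt_mul_besselJ_le_min hν
  have hI₁ : 0 ≤ ∫ x in Ioo 0 X, x ^ (ν.re + 1 / 2) * ‖f x‖ :=
    setIntegral_nonneg measurableSet_Ioo fun x hx =>
      mul_nonneg (Real.rpow_nonneg hx.1.le _) (norm_nonneg _)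
  have hI₂ : 0 ≤ ∫ x in Ici X, ‖f x‖ := integral_nonneg fun _ => norm_nonneg _
  refine ⟨C₁ * X * ∫ x in Ioo 0 X, x ^ (ν.re + 1 / 2) * ‖f x‖, C₂ * ∫ x in Ici X, ‖f x‖,
    by positivity, by positivity, fun u hu => ?_⟩
  set g₁ : ℝ → ℝ := fun x =>
    C₁ * X * (u ^ (ν.re + 1 / 2) * (1 + u)) * (x ^ (ν.re + 1 / 2) * ‖f x‖) with hg₁
  set g₂ : ℝ → ℝ := fun x => C₂ * (1 + u ^ min 0 (ν.re + 1 / 2)) * ‖f x‖ with hg₂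
  have i₁ : IntegrableOn g₁ (Ioo 0 X) := hhead.const_mul _
  have i₂ : IntegrableOn g₂ (Ici X) := hfX.norm.const_mul _
  have i₁' := (i₁.integrable_indicator measurableSet_Ioo).integrableOn (s := Ioi (0 : ℝ))
  have i₂' := (i₂.integrable_indicator measurableSet_Ici).integrableOn (s := Ioi (0 : ℝ))
  have hle : ‖hankelTransform ν f u‖ ≤
      ∫ x in Ioi (0 : ℝ), ((Ioo 0 X).indicator g₁ x + (Ici X).indicator g₂ x) := by
    refine norm_integral_le_of_norm_le (i₁'.add i₂')
      ((ae_restrict_mem measurableSet_Ioi).mono fun x hx => ?_)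
    have hx0 : (0 : ℝ) < x := hx
    rw [hankelIntegrand, norm_mul]
    rcases lt_or_ge x X with hxX | hxX
    · rw [indicator_of_mem (show x ∈ Ioo 0 X from ⟨hx0, hxX⟩),
        indicator_of_notMem (show x ∉ Ici X from not_le.2 hxX), add_zero, norm_mul,
        norm_ofReal_sqrt]
      have h3 := h₁ (x * u) (by positivity)
      have h4 : 1 + x * u ≤ X * (1 + u) := by nlinarith
      calc _ ≤ Real.sqrt (x * u) * (C₁ * ((x * u) ^ ν.re * (X * (1 + u)))) * ‖f x‖ := by
            gcongr
            exact h3.trans (by gcongr)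
        _ = (x * u) ^ (ν.re + 1 / 2) * (C₁ * X * (1 + u) * ‖f x‖) := by
            rw [Real.rpow_add (by positivity), ← Real.sqrt_eq_rpow]; ring
        _ = _ := by rw [Real.mul_rpow hx0.le hu.le, hg₁]; ring
    · rw [indicator_of_notMem (show x ∉ Ioo 0 X from fun h => not_lt.2 hxX h.2),
        indicator_of_mem (show x ∈ Ici X from hxX), zero_add, hg₂]
      have h3 := h₂ (x * u) (by positivity)
      have h5 : (x * u) ^ min 0 (ν.re + 1 / 2) ≤ u ^ min 0 (ν.re + 1 / 2) := by
        rw [Real.mul_rpow hx0.le hu.le]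
        exact mul_le_of_le_one_left (by positivity)
          (Real.rpow_le_one_of_one_le_of_nonpos (hX.trans hxX) (min_le_left _ _))
      exact mul_le_mul_of_nonneg_right (h3.trans (by gcongr)) (norm_nonneg _)
  refine hle.trans (le_of_eq ?_)
  have hs₁ : Ioo 0 X ⊆ Ioi (0 : ℝ) := fun x hx => hx.1
  have hs₂ : Ici X ⊆ Ioi (0 : ℝ) := fun x hx => lt_of_lt_of_le (by linarith : (0 : ℝ) < X) hx
  rw [integral_add i₁' i₂', setIntegral_indicator measurableSet_Ioo,
    setIntegral_indicator measurableSet_Ici,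
    inter_eq_right.2 hs₁, inter_eq_right.2 hs₂,
    hg₁, hg₂, integral_const_mul, integral_const_mul]
  ring

theorem aestronglyMeasurable_hankelTransform {ν : ℂ} (hν : -1 < ν.re) {f : ℝ → ℂ}
    (hf : AEStronglyMeasurable f (volume.restrict (Ioi 0))) :
    AEStronglyMeasurable (hankelTransform ν f) (volume.restrict (Ioi 0)) := by
  have hmw : Measurable fun p : ℝ × ℝ =>
      (Real.sqrt (p.2 * p.1) : ℂ) * besselJ ν (p.2 * p.1) :=
    (measurable_sqrt_mul_besselJ hν).comp (by fun_prop)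
  have hjoint : AEStronglyMeasurable (fun p : ℝ × ℝ => hankelIntegrand ν f p.1 p.2)
      ((volume.restrict (Ioi (0 : ℝ))).prod (volume.restrict (Ioi (0 : ℝ)))) :=
    hmw.aestronglyMeasurable.mul hf.comp_snd
  exact hjoint.integral_prod_right'

theorem tendsto_truncK (ν : ℂ) {z : ℝ} (hz : 0 < z) :
    Tendsto (fun η : ℝ => truncK ν η z) (𝓝[>] 0) (𝓝 (besselK ν z)) := by
  rw [besselK_eq_truncK ν hz]
  have hcov : AECover (volume.restrict (Ioi (0 : ℝ))) (𝓝[>] (0 : ℝ)) fun η : ℝ => Ioi η :=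
    aecover_Ioi_of_Ioi (tendsto_id.mono_left nhdsWithin_le_nhds)
  have h := hcov.integral_tendsto_of_countably_generated (integrableOn_macdonaldIntegrand ν hz)
  refine Tendsto.const_mul _ (h.congr' (eventually_nhdsWithin_of_forall fun η hη => ?_))
  rw [Measure.restrict_restrict measurableSet_Ioi,
    inter_eq_left.2 (Ioi_subset_Ioi (le_of_lt hη))]

theorem exists_norm_truncK_le_rpow {ν : ℂ} (hν : 0 < ν.re) {η : ℝ} (hη : 0 < η) :
    ∃ C : ℝ, 0 ≤ C ∧ ∀ z : ℝ, 0 < z → ‖truncK ν η z‖ ≤ C * (z / 2) ^ ν.re := by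
  have hint : IntegrableOn (fun t : ℝ => t ^ (-ν.re - 1)) (Ioi η) :=
    integrableOn_Ioi_rpow_of_lt (by linarith) hη
  have h0 : 0 ≤ ∫ t in Ioi η, t ^ (-ν.re - 1) := setIntegral_nonneg measurableSet_Ioi fun t ht =>
    Real.rpow_nonneg (hη.trans ht).le _
  refine ⟨1 / 2 * ∫ t in Ioi η, t ^ (-ν.re - 1), by positivity, fun z hz => ?_⟩
  have h1 : ‖∫ t in Ioi η, macdonaldIntegrand ν z t‖ ≤ ∫ t in Ioi η, t ^ (-ν.re - 1) := by
    refine norm_integral_le_of_norm_le hint ((ae_restrict_mem measurableSet_Ioi).mono fun t ht => ?_)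
    have ht0 : 0 < t := hη.trans ht
    rw [norm_macdonaldIntegrand _ _ ht0]
    refine mul_le_of_le_one_right (by positivity) (Real.exp_le_one_iff.2 ?_)
    rw [neg_nonpos]
    positivity
  rw [truncK, norm_mul, norm_mul, norm_half_cpow hz]
  calc _ ≤ ‖(1 / 2 : ℂ)‖ * (z / 2) ^ ν.re * ∫ t in Ioi η, t ^ (-ν.re - 1) := by gcongr
    _ = _ := by norm_num; ring

/-- For `Re ν ≤ 0` the untruncated Macdonald function is integrable against the bound for the
Hankel kernel. -/
theorem integrableOn_mul_truncK_zero {ν : ℂ} (hν : -1 < ν.re) (h0 : ν.re ≤ 0) {y : ℝ}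
    (hy : 0 < y) :
    IntegrableOn (fun u : ℝ => Real.sqrt u * (1 + u ^ min 0 (ν.re + 1 / 2)) *
      ‖truncK ν 0 (u * y)‖) (Ioi 0) := by
  have habs : |ν.re| = -ν.re := abs_of_nonpos h0
  have h1 := integrableOn_rpow_mul_macK_comp_mul (a := 1 / 2) (s := ν.re) (by rw [habs]; linarith) hy
  have h2 := integrableOn_rpow_mul_macK_comp_mul (a := 1 / 2 + min 0 (ν.re + 1 / 2)) (s := ν.re)
    (by rw [habs]; rcases min_choice 0 (ν.re + 1 / 2) with h | h <;> rw [h] <;> linarith) hy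
  have hTm : Measurable fun u : ℝ => truncK ν 0 (u * y) :=
    (measurable_truncK ν 0).comp (by fun_prop)
  refine Integrable.mono' (h1.add h2)
    (Measurable.mul (by fun_prop) hTm.norm).aestronglyMeasurable
    ((ae_restrict_mem measurableSet_Ioi).mono fun u hu => ?_)
  have hu0 : (0 : ℝ) < u := hu
  rw [Real.norm_of_nonneg (by positivity)]
  have h3 := norm_truncK_le ν le_rfl (mul_pos hu0 hy)
  calc _ ≤ Real.sqrt u * (1 + u ^ min 0 (ν.re + 1 / 2)) * macK ν.re (u * y) := by gcongr
    _ = _ := by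
      simp only [Pi.add_apply]
      rw [Real.rpow_add hu0, Real.sqrt_eq_rpow, mul_comm y u]; ring

/-- For `Re ν > 0` the cut-off removes the singularity of `K_ν` at the origin. -/
theorem integrableOn_mul_truncK_of_re_pos {ν : ℂ} (h0 : 0 < ν.re) {y η : ℝ} (hy : 0 < y)
    (hη : 0 < η) :
    IntegrableOn (fun u : ℝ => Real.sqrt u * (1 + u ^ min 0 (ν.re + 1 / 2)) *
      ‖truncK ν η (u * y)‖) (Ioi 0) := by
  have hm : min 0 (ν.re + 1 / 2) = 0 := min_eq_left (by linarith)
  simp only [hm, Real.rpow_zero]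
  obtain ⟨C, hC, hT⟩ := exists_norm_truncK_le_rpow h0 hη
  have hTm : Measurable fun u : ℝ => truncK ν η (u * y) :=
    (measurable_truncK ν η).comp (by fun_prop)
  have hmeas : Measurable fun u : ℝ => Real.sqrt u * (1 + 1) * ‖truncK ν η (u * y)‖ :=
    Measurable.mul (by fun_prop) hTm.norm
  rw [← Ioc_union_Ioi_eq_Ioi zero_le_one]
  refine IntegrableOn.union ?_ ?_
  · have hc : IntegrableOn (fun _ : ℝ => 2 * (C * (y / 2) ^ ν.re)) (Ioc 0 1) :=
      integrableOn_const (by simp)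
    refine Integrable.mono' hc hmeas.aestronglyMeasurable
      ((ae_restrict_mem measurableSet_Ioc).mono fun u hu => ?_)
    have hu0 : (0 : ℝ) < u := hu.1
    have hu1 : u ≤ 1 := hu.2
    rw [Real.norm_of_nonneg (by positivity)]
    have h1 := hT (u * y) (by positivity)
    have h2 : Real.sqrt u ≤ 1 := Real.sqrt_le_one.2 hu1
    have h3 : u * y ≤ y := mul_le_of_le_one_left hy.le hu1
    calc _ ≤ 1 * (1 + 1) * (C * (y / 2) ^ ν.re) := by
          gcongr
          exact h1.trans (by gcongr)
      _ = _ := by ring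
  · have h1 := integrableOn_rpow_mul_macK_comp_mul (a := ν.re + 1) (s := ν.re)
      (by rw [abs_of_pos h0]; linarith) hy
    have h2 : IntegrableOn (fun u : ℝ => 2 * (u ^ (ν.re + 1) * macK ν.re (y * u))) (Ioi 1) :=
      IntegrableOn.mono_set (h1.const_mul 2) (Ioi_subset_Ioi zero_le_one)
    refine Integrable.mono' h2 hmeas.aestronglyMeasurable
      ((ae_restrict_mem measurableSet_Ioi).mono fun u hu => ?_)
    have hu1 : (1 : ℝ) < u := hu
    have hu0 : (0 : ℝ) < u := one_pos.trans hu1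
    rw [Real.norm_of_nonneg (by positivity)]
    have h3 := norm_truncK_le ν hη.le (mul_pos hu0 hy)
    have h4 : Real.sqrt u ≤ u ^ (ν.re + 1) := by
      rw [Real.sqrt_eq_rpow]
      exact Real.rpow_le_rpow_of_exponent_le hu1.le (by linarith)
    calc _ ≤ u ^ (ν.re + 1) * (1 + 1) * macK ν.re (u * y) := by gcongr
      _ = _ := by rw [mul_comm y u]; ring

/-- For `Re ν > 0`, existence of `K_ν{H_ν f; y}` passes to the majorant `K_{Re ν}` of `|K_ν|`: near
`0` the two are comparable, and elsewhere the Hankel transform has at most polynomial growth. -/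
theorem integrableOn_macK_mul_hankelTransform {ν : ℂ} (h0 : 0 < ν.re) {f : ℝ → ℂ} {y X : ℝ}
    (hy : 0 < y) (hX : 1 ≤ X) (hfX : IntegrableOn f (Ici X))
    (hK : KExists ν (fun u => hankelTransform ν f u) y)
    (hP : WidderExists (fun x => (x : ℂ) ^ (ν - 1 / 2) * f x) y) :
    IntegrableOn (fun u => Real.sqrt (u * y) * macK ν.re (u * y) * ‖hankelTransform ν f u‖)
      (Ioi 0) := by
  have hν : -1 < ν.re := by linarith
  have hm : min 0 (ν.re + 1 / 2) = 0 := min_eq_left (by linarith)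
  obtain ⟨A, B, hA, hB, hAB⟩ := exists_norm_hankelTransform_le hν hX hfX hP
  simp only [hm, Real.rpow_zero] at hAB
  obtain ⟨c, δ, hc, hδ, hlow⟩ := exists_rpow_le_norm_besselK h0.ne'
  obtain ⟨C, hC, hup⟩ := exists_macK_le_rpow (s := ν.re) (b := |ν.re|) (abs_pos.2 h0.ne') le_rfl
  have hMm : Measurable fun u : ℝ => macK ν.re (u * y) := (measurable_macK _).comp (by fun_prop)
  have hsq : Measurable fun u : ℝ => Real.sqrt (u * y) := by fun_prop
  have hmeas : AEStronglyMeasurable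
      (fun u => Real.sqrt (u * y) * macK ν.re (u * y) * ‖hankelTransform ν f u‖)
      (volume.restrict (Ioi 0)) :=
    (hsq.mul hMm).aestronglyMeasurable.mul
      (aestronglyMeasurable_hankelTransform hν (aestronglyMeasurable_of_widderExists hP)).norm
  set d := δ / y with hd
  have hd0 : 0 < d := by positivity
  rw [← Ioo_union_Ici_eq_Ioi hd0]
  refine IntegrableOn.union ?_ ?_
  · have hsub : Ioo 0 d ⊆ Ioi 0 := fun u hu => hu.1
    have hKn : IntegrableOn (fun u => C / c * ‖kIntegrand ν (fun u => hankelTransform ν f u) y u‖)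
        (Ioi 0) := hK.norm.const_mul _
    refine Integrable.mono' (hKn.mono_set hsub)
      (hmeas.mono_measure (Measure.restrict_mono hsub le_rfl))
      ((ae_restrict_mem measurableSet_Ioo).mono fun u hu => ?_)
    have hu0 : (0 : ℝ) < u := hu.1
    have huy : 0 < u * y := by positivity
    have h1 := hlow (u * y) huy (by rw [← lt_div_iff₀ hy]; exact hu.2)
    have h2 : macK ν.re (u * y) ≤ C / c * ‖besselK ν (u * y)‖ := by
      refine (hup _ huy).trans ?_
      rw [div_mul_eq_mul_div, le_div_iff₀ hc]
      calc _ = C * (c * (u * y) ^ (-|ν.re|)) := by ring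
        _ ≤ _ := by gcongr
    have h3 := macK_nonneg ν.re (u * y)
    rw [Real.norm_of_nonneg (by positivity), kIntegrand, norm_mul, norm_mul, norm_ofReal_sqrt]
    calc _ ≤ Real.sqrt (u * y) * (C / c * ‖besselK ν (u * y)‖) * ‖hankelTransform ν f u‖ := by
          gcongr
      _ = _ := by ring
  · have hsub : Ici d ⊆ Ioi 0 := fun u hu => hd0.trans_le hu
    have habs : |ν.re| = ν.re := abs_of_pos h0
    have h1 := integrableOn_rpow_mul_macK_comp_mul (a := ν.re + 1) (s := ν.re)
      (by linarith) hy
    have h2 := integrableOn_rpow_mul_macK_comp_mul (a := ν.re + 2) (s := ν.re)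
      (by linarith) hy
    set E := A + B * 2 / d ^ (ν.re + 1 / 2) with hE
    have h3 : IntegrableOn (fun u : ℝ => Real.sqrt y * E * (u ^ (ν.re + 1) * macK ν.re (y * u) +
        u ^ (ν.re + 2) * macK ν.re (y * u))) (Ioi 0) := (h1.add h2).const_mul _
    refine Integrable.mono' (h3.mono_set hsub)
      (hmeas.mono_measure (Measure.restrict_mono hsub le_rfl))
      ((ae_restrict_mem measurableSet_Ici).mono fun u hu => ?_)
    have hud : d ≤ u := hu
    have hu0 : (0 : ℝ) < u := hd0.trans_le hud
    have h4 := macK_nonneg ν.re (u * y)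
    have h5 : ‖hankelTransform ν f u‖ ≤ E * (u ^ (ν.re + 1 / 2) * (1 + u)) := by
      refine (hAB u hu0).trans ?_
      rw [hE, add_mul]
      refine add_le_add le_rfl ?_
      rw [div_mul_eq_mul_div, le_div_iff₀ (by positivity)]
      calc B * (1 + 1) * d ^ (ν.re + 1 / 2) ≤ B * (1 + 1) * u ^ (ν.re + 1 / 2) := by gcongr
        _ ≤ B * (1 + 1) * (u ^ (ν.re + 1 / 2) * (1 + u)) := by
          gcongr
          exact le_mul_of_one_le_right (by positivity) (by linarith)
        _ = _ := by ring
    rw [Real.norm_of_nonneg (by positivity), Real.sqrt_mul hu0.le]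
    calc _ ≤ Real.sqrt u * Real.sqrt y * macK ν.re (u * y) *
          (E * (u ^ (ν.re + 1 / 2) * (1 + u))) := by gcongr
      _ = Real.sqrt y * E * (u ^ (ν.re + 1 / 2) * Real.sqrt u * (1 + u) * macK ν.re (u * y)) := by
          ring
      _ = Real.sqrt y * E * (u ^ (ν.re + 1) * (1 + u) * macK ν.re (u * y)) := by
          rw [Real.sqrt_eq_rpow u, ← Real.rpow_add hu0]; norm_num [add_assoc]
      _ = _ := by
          rw [show ν.re + 2 = ν.re + 1 + 1 by ring, Real.rpow_add_one hu0.ne' (ν.re + 1),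
            mul_comm y u]
          ring

/-- The `K`-transform of the Hankel transform. For `Re ν ≤ 0` the double integral converges
absolutely. For `Re ν > 0` it does so after truncating the integral representation of `K_ν` at
height `η`, and `η → 0` is taken by dominated convergence. -/
theorem kTransform_hankelTransform {ν : ℂ} (hν : -1 < ν.re) {f : ℝ → ℂ} {y : ℝ} (hy : 0 < y)
    (hH : ∀ᵐ u ∂(volume.restrict (Ioi (0 : ℝ))), HankelExists ν f u)
    (hK : KExists ν (fun u => hankelTransform ν f u) y)
    (hP : WidderExists (fun x => (x : ℂ) ^ (ν - 1 / 2) * f x) y) :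
    kTransform ν (fun u => hankelTransform ν f u) y =
      (y : ℂ) ^ (-ν + 1 / 2) * widderTransform (fun x => (x : ℂ) ^ (ν - 1 / 2) * f x) y := by
  have hf := aestronglyMeasurable_of_widderExists hP
  obtain ⟨X, hX, hfX⟩ := exists_integrableOn_of_hankelExists hν hf hH
  rcases le_or_gt ν.re 0 with h0 | h0
  · have h := integral_truncK_mul_hankelTransform hν hy le_rfl hX hfX hP
      (integrableOn_mul_truncK_zero hν h0 hy)
    simp only [mul_zero, neg_zero, Real.exp_zero, Complex.ofReal_one, mul_one] at h
    rw [widderTransform, ← h]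
    refine setIntegral_congr_fun measurableSet_Ioi fun u hu => ?_
    simp only [kIntegrand]
    rw [besselK_eq_truncK ν (mul_pos hu hy)]
  · have hlim1 : Tendsto (fun η : ℝ => ∫ u in Ioi (0 : ℝ),
        (Real.sqrt (u * y) : ℂ) * truncK ν η (u * y) * hankelTransform ν f u) (𝓝[>] 0)
        (𝓝 (kTransform ν (fun u => hankelTransform ν f u) y)) := by
      refine tendsto_integral_filter_of_dominated_convergence _ (.of_forall fun η => ?_) ?_
        (integrableOn_macK_mul_hankelTransform h0 hy hX hfX hK hP) ?_
      · have h1 : Measurable fun u : ℝ => (Real.sqrt (u * y) : ℂ) :=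
          Complex.measurable_ofReal.comp (by fun_prop)
        have h2 : Measurable fun u : ℝ => truncK ν η (u * y) :=
          (measurable_truncK ν η).comp (by fun_prop)
        exact (h1.mul h2).aestronglyMeasurable.mul (aestronglyMeasurable_hankelTransform hν hf)
      · refine eventually_nhdsWithin_of_forall fun η hη =>
          (ae_restrict_mem measurableSet_Ioi).mono fun u hu => ?_
        rw [norm_mul, norm_mul, norm_ofReal_sqrt]
        have := norm_truncK_le ν (le_of_lt hη) (mul_pos hu hy)
        gcongr
      · refine (ae_restrict_mem measurableSet_Ioi).mono fun u hu => ?_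
        exact ((tendsto_truncK ν (mul_pos hu hy)).const_mul _).mul_const _
    have hlim2 : Tendsto (fun η : ℝ => ∫ x in Ioi (0 : ℝ),
        widderIntegrand (fun x => (x : ℂ) ^ (ν - 1 / 2) * f x) y x *
          (Real.exp (-((1 + x ^ 2 / y ^ 2) * η)) : ℂ)) (𝓝[>] 0)
        (𝓝 (widderTransform (fun x => (x : ℂ) ^ (ν - 1 / 2) * f x) y)) := by
      refine tendsto_integral_filter_of_dominated_convergence _ (.of_forall fun η => ?_) ?_
        hP.norm ?_
      · refine hP.aestronglyMeasurable.mul ?_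
        exact (Complex.measurable_ofReal.comp (by fun_prop)).aestronglyMeasurable
      · refine eventually_nhdsWithin_of_forall fun η hη => .of_forall fun x => ?_
        rw [norm_mul, Complex.norm_real, Real.norm_of_nonneg (Real.exp_pos _).le]
        refine mul_le_of_le_one_right (norm_nonneg _) (Real.exp_le_one_iff.2 ?_)
        have hη0 : (0 : ℝ) < η := hη
        rw [neg_nonpos]
        positivity
      · refine .of_forall fun x => ?_
        have hc : Continuous fun η : ℝ =>
            widderIntegrand (fun x => (x : ℂ) ^ (ν - 1 / 2) * f x) y x *
              (Real.exp (-((1 + x ^ 2 / y ^ 2) * η)) : ℂ) :=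
          continuous_const.mul (Complex.continuous_ofReal.comp (by fun_prop))
        have := (hc.tendsto 0).mono_left (nhdsWithin_le_nhds (s := Ioi 0))
        simpa using this
    refine tendsto_nhds_unique hlim1 ((hlim2.const_mul ((y : ℂ) ^ (-ν + 1 / 2))).congr' ?_)
    exact eventually_nhdsWithin_of_forall fun η hη =>
      (integral_truncK_mul_hankelTransform hν hy (le_of_lt hη) hX hfX hP
        (integrableOn_mul_truncK_of_re_pos h0 hy hη)).symm

theorem lemma1 (ν : ℂ) (hν : -1 < ν.re) (f : ℝ → ℂ) (y : ℝ) (hy : 0 < y) :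
    ((∀ᵐ u ∂(volume.restrict (Ioi (0 : ℝ))), KExists ν f u) →
      HankelExists ν (fun u => kTransform ν f u) y →
      WidderExists (fun x => (x : ℂ) ^ (-ν - 1 / 2) * f x) y →
      hankelTransform ν (fun u => kTransform ν f u) y =
        (y : ℂ) ^ (ν + 1 / 2) * widderTransform (fun x => (x : ℂ) ^ (-ν - 1 / 2) * f x) y) ∧
    ((∀ᵐ u ∂(volume.restrict (Ioi (0 : ℝ))), HankelExists ν f u) →
      KExists ν (fun u => hankelTransform ν f u) y →
      WidderExists (fun x => (x : ℂ) ^ (ν - 1 / 2) * f x) y →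
      kTransform ν (fun u => hankelTransform ν f u) y =
        (y : ℂ) ^ (-ν + 1 / 2) * widderTransform (fun x => (x : ℂ) ^ (ν - 1 / 2) * f x) y) :=
  ⟨hankelTransform_kTransform hν hy, kTransform_hankelTransform hν hy⟩
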